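/- Let $\Bbbk$ be an algebraically closed field of characteristic $0$ and let $\mathcal C$ be a finite tensor category over $\Bbbk$ (a finite abelian $\Bbbk$-linear rigid monoidal category with bilinear tensor product and simple unit object $\mathbf 1$). The dual $X^*$ of an object $X$ has evaluation $X^*\otimes X\to\mathbf 1$. Let a finite group $G$ act on $\mathcal C$ by $\Bbbk$-linear tensor autoequivalences $F_g$ ($g\in G$), and let $N\trianglelefteq G$ be a normal subgroup. Let $\mathcal C\rtimes G=\bigoplus_{g\in G}\mathcal C_g$ be the crossed product, with objects $\bigoplus_g[X_g,g]$ and $[X,g]\otimes[Y,h]=[X\otimes F_g(Y),gh]$. It acts on $\mathcal C$ by $[X,g]\triangleright Y=X\otimes F_g(Y)$. Let $(\mathcal C\rtimes G)^*_{\mathcal C}$ be the category of $\Bbbk$-linear $\mathcal C\rtimes G$-module endofunctors of $\mathcal C$ and module natural transformations, with composition of functors as tensor product; it acts on $\mathcal C$ by evaluation. For $V\in\mathrm{Rep}(G/N)$ (finite-dimensional) let $V\blacktriangleright\mathbf 1\in\mathcal C$ be the object with $\mathrm{Hom}(V\blacktriangleright\mathbf 1,B)\cong\mathrm{Hom}_\Bbbk(V,\mathrm{Hom}(\mathbf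 1,B))$, and let $L_V(Y)=Y\otimes(V\blacktriangleright\mathbf 1)$, with the module structure $$L_V([X,g]\triangleright Y)=X\otimes F_g(Y)\otimes(V\blacktriangleright\mathbf 1)\xrightarrow{\ \mathrm{id}\otimes s_g\ }X\otimes F_g(Y)\otimes F_g(V\blacktriangleright\mathbf 1)\cong X\otimes F_g(Y\otimes(V\blacktriangleright\mathbf 1))=[X,g]\triangleright L_V(Y),$$ where $s_g:V\blacktriangleright\mathbf 1\cong V\blacktriangleright F_g(\mathbf 1)\cong F_g(V\blacktriangleright\mathbf 1)$ is induced by the map $v\mapsto \bar g^{-1}v$ of $V$. 1. The assignment $V\mapsto L_V$ is a fully faithful $\Bbbk$-linear functor $\mathrm{Rep}(G/N)\to(\mathcal C\rtimes G)^*_{\mathcal C}$ that admits the structure of a (strong) monoidal functor. 2. For every $g\in G$ the end $\mathcal A_g=\int_{X\in\mathcal C}X\otimes F_g(X)^*$ exists in $\mathcal C$, and the $\mathcal C\rtimes G$-module category $\mathcal C$ has an internal Hom $\underline{\mathrm{Hom}}:\mathcal C^{op}\times\mathcal C\to\mathcal C\rtimes G$, with natural bijections $\mathrm{Hom}_{\mathcal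 C\rtimes G}(Z,\underline{\mathrm{Hom}}(M,M'))\cong\mathrm{Hom}_{\mathcal C}(Z\triangleright M,M')$. 3. Let $\underline{\mathrm{Hom}}$ be any such internal Hom, and let $\mathcal D\subseteq(\mathcal C\rtimes G)^*_{\mathcal C}$ be the essential image of $V\mapsto L_V$. For $D\in\mathcal D$ with dual $D^*$ (the left adjoint of $D$) and evaluation $\mathrm{ev}^D:D^*\circ D\to\mathrm{Id}$, let $\xi^D_{M,M'}:\underline{\mathrm{Hom}}(M,D(M'))\to\underline{\mathrm{Hom}}(D^*(M),M')$ be the morphism that corresponds to the composition $$\underline{\mathrm{Hom}}(M,D(M'))\triangleright D^*(M)\cong D^*\big(\underline{\mathrm{Hom}}(M,D(M'))\triangleright M\big)\to D^*(D(M'))\xrightarrow{\ \mathrm{ev}^D_{M'}\ }M'$$ of the module structure of $D^*$, the evaluation of the internal Hom and $\mathrm{ev}^D_{M'}$. Then there is a relative adjoint $\mathcal A_{\mathrm{Rep}(G/N),\mathcal C}$, that is, an object $E$ of $\mathcal C\rtimes G$ with a dinatural transformation $\pi_M:E\to\underline{\mathrm{Hom}}(M,M)$, $M\in\mathcal C$,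 such that $$\underline{\mathrm{Hom}}(\mathrm{ev}^D_M,\mathrm{id}_M)\,\pi_M=\xi^D_{D(M),M}\,\pi_{D(M)}\qquad\text{for all }D\in\mathcal D,\ M\in\mathcal C,$$ and which is universal with this property. Every such object satisfies $$\mathcal A_{\mathrm{Rep}(G/N),\mathcal C}\;\cong\;\bigoplus_{n\in N}[\mathcal A_n,n]$$ as objects of $\mathcal C\rtimes G$. -/

import Mathlib

open CategoryTheory CategoryTheory.Limits MonoidalCategory

attribute [local instance] Abelian.hasFiniteBiproducts

section
variable {C : Type*} [Category* C] [Abelian C] {D : Type*} [Category* D] [Abelian D]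

/-- The morphism out of `Φ (⨁ A)`, for an additive functor `Φ`, with given components. -/
noncomputable def sumDesc {J : Type*} [Finite J] {A : J → C} (Φ : C ⥤ D) {T : D}
    (f : ∀ j, Φ.obj (A j) ⟶ T) : Φ.obj (⨁ A) ⟶ T :=
  letI := Fintype.ofFinite J
  ∑ j, Φ.map (biproduct.π A j) ≫ f j

lemma map_ι_sumDesc {J : Type*} [Finite J] {A : J → C} (Φ : C ⥤ D) [Φ.Additive] {T : D}
    (f : ∀ j, Φ.obj (A j) ⟶ T) (j : J) : Φ.map (biproduct.ι A j) ≫ sumDesc Φ f = f j := by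
  classical
  letI := Fintype.ofFinite J
  rw [sumDesc, Preadditive.comp_sum, Finset.sum_eq_single j]
  · rw [← Category.assoc, ← Φ.map_comp]
    simp
  · intro i _ hi
    rw [← Category.assoc, ← Φ.map_comp, biproduct.ι_π_ne _ hi.symm]
    simp
  · simp

lemma sum_hom_ext {J : Type*} [Finite J] {A : J → C} (Φ : C ⥤ D) [Φ.Additive] {T : D}
    {f g : Φ.obj (⨁ A) ⟶ T}
    (w : ∀ j, Φ.map (biproduct.ι A j) ≫ f = Φ.map (biproduct.ι A j) ≫ g) : f = g := by
  letI := Fintype.ofFinite J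
  have h : 𝟙 (Φ.obj (⨁ A)) = ∑ j, Φ.map (biproduct.π A j) ≫ Φ.map (biproduct.ι A j) := by
    have h' : 𝟙 (⨁ A) = ∑ j, biproduct.π A j ≫ biproduct.ι A j := by
      classical
      apply biproduct.hom_ext'
      intro j
      rw [Category.comp_id, Preadditive.comp_sum, Finset.sum_eq_single j]
      · simp
      · intro i _ hi
        rw [← Category.assoc, biproduct.ι_π_ne _ hi.symm]
        simp
      · simp
    rw [← Φ.map_id, h', Functor.map_sum]
    simp
  rw [← Category.id_comp f, ← Category.id_comp g, h, Preadditive.sum_comp, Preadditive.sum_comp]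
  simp [w]
end

/-- An action of a group `G` on a `k`-linear monoidal category `C` by tensor autoequivalences: linear
monoidal functors `F_g` with monoidal isomorphisms `F_g ∘ F_h ≅ F_{gh}` and `Id ≅ F_1` which are
associative and unital. The product `gh` is allowed to be given as any `m` with `gh = m`. -/
structure TensorAction (k : Type*) [Field k] (G : Type*) [Group G] (C : Type*) [Category* C]
    [Abelian C] [Linear k C] [MonoidalCategory C] where
  F : G → C ⥤ C
  monoidal (g : G) : (F g).Monoidal
  additive (g : G) : (F g).Additive
  linear (g : G) : (F g).Linear k
  comp {g h m : G} (e : g * h = m) : F h ⋙ F g ≅ F m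
  unit : 𝟭 C ≅ F 1
  comp_monoidal {g h m : G} (e : g * h = m) : (comp e).hom.IsMonoidal
  unit_monoidal : unit.hom.IsMonoidal
  comp_assoc {g h l gh hl m : G} (e₁ : g * h = gh) (e₂ : gh * l = m) (e₃ : h * l = hl)
    (e₄ : g * hl = m) (X : C) :
    (comp e₁).hom.app ((F l).obj X) ≫ (comp e₂).hom.app X =
      (F g).map ((comp e₃).hom.app X) ≫ (comp e₄).hom.app X
  unit_comp (g : G) (X : C) :
    unit.hom.app ((F g).obj X) ≫ (comp (one_mul g)).hom.app X = 𝟙 _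
  comp_unit (g : G) (X : C) :
    (F g).map (unit.hom.app X) ≫ (comp (mul_one g)).hom.app X = 𝟙 _

attribute [instance] TensorAction.monoidal TensorAction.additive TensorAction.linear
  TensorAction.comp_monoidal TensorAction.unit_monoidal

namespace TensorAction

variable {k : Type*} [Field k] {G : Type*} [Group G] {C : Type*} [Category* C]
    [Abelian C] [Linear k C] [MonoidalCategory C] (T : TensorAction k G C)

open Functor

/-- The isomorphism `(X ⊗ F_g Y) ⊗ F_{gh} Z ≅ X ⊗ F_g (Y ⊗ F_h Z)`. -/
def hAssoc {g h m : G} (e : g * h = m) (X Y Z : C) :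
    (X ⊗ (T.F g).obj Y) ⊗ (T.F m).obj Z ≅ X ⊗ (T.F g).obj (Y ⊗ (T.F h).obj Z) :=
  α_ _ _ _ ≪≫ whiskerLeftIso X
    (whiskerLeftIso _ ((T.comp e).symm.app Z) ≪≫ Monoidal.μIso (T.F g) Y ((T.F h).obj Z))

lemma hAssoc_hom {g h m : G} (e : g * h = m) (X Y Z : C) :
    (T.hAssoc e X Y Z).hom = (α_ _ _ _).hom ≫ X ◁ ((T.F g).obj Y ◁ (T.comp e).inv.app Z) ≫
      X ◁ LaxMonoidal.μ (T.F g) Y ((T.F h).obj Z) := by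
  simp [hAssoc]

lemma hAssoc_nat {g h m : G} (e : g * h = m) {X X' Y Y' Z Z' : C} (f : X ⟶ X') (f' : Y ⟶ Y')
    (f'' : Z ⟶ Z') :
    ((f ⊗ₘ (T.F g).map f') ⊗ₘ (T.F m).map f'') ≫ (T.hAssoc e X' Y' Z').hom =
      (T.hAssoc e X Y Z).hom ≫ (f ⊗ₘ (T.F g).map (f' ⊗ₘ (T.F h).map f'')) := by
  simp only [hAssoc_hom]
  rw [associator_naturality_assoc]
  simp only [Category.assoc, ← id_tensorHom, tensorHom_comp_tensorHom, Category.id_comp,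
    Category.comp_id, NatTrans.naturality, LaxMonoidal.μ_natural]
  simp only [← LaxMonoidal.μ_natural, tensorHom_comp_tensorHom_assoc, Category.comp_id,
    Category.id_comp]
  have := (T.comp e).inv.naturality f''
  rw [this]
  rfl

lemma comp_inv_assoc {g h l gh hl m : G} (e₁ : g * h = gh) (e₂ : gh * l = m) (e₃ : h * l = hl)
    (e₄ : g * hl = m) (X : C) :
    (T.comp e₂).inv.app X ≫ (T.comp e₁).inv.app ((T.F l).obj X) =
      (T.comp e₄).inv.app X ≫ (T.F g).map ((T.comp e₃).inv.app X) := by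
  rw [← cancel_mono ((T.comp e₁).hom.app ((T.F l).obj X) ≫ (T.comp e₂).hom.app X)]
  conv_rhs => rw [T.comp_assoc e₁ e₂ e₃ e₄]
  have h1 : (T.F g).map ((T.comp e₃).inv.app X) ≫ (T.F g).map ((T.comp e₃).hom.app X) = 𝟙 _ := by
    rw [← Functor.map_comp]; simp
  simp [reassoc_of% h1]

lemma comp_inv_μ {g h m : G} (e : g * h = m) (X Y : C) :
    LaxMonoidal.μ (T.F m) X Y ≫ (T.comp e).inv.app (X ⊗ Y) =
      ((T.comp e).inv.app X ⊗ₘ (T.comp e).inv.app Y) ≫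
        LaxMonoidal.μ (T.F g) _ _ ≫ (T.F g).map (LaxMonoidal.μ (T.F h) X Y) := by
  have := NatTrans.IsMonoidal.tensor (τ := (T.comp e).inv) X Y
  simpa using this

lemma aux_pentagon {C : Type*} [Category* C] [MonoidalCategory C] (Φ : C ⥤ C) [Φ.Monoidal] {Y B D M N : C} (u : M ⟶ Φ.obj B) (w : N ⟶ Φ.obj D) :
    (Φ.obj Y ◁ u) ▷ N ≫ LaxMonoidal.μ Φ Y B ▷ N ≫ Φ.obj (Y ⊗ B) ◁ w ≫
      LaxMonoidal.μ Φ (Y ⊗ B) D ≫ Φ.map (α_ Y B D).hom =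
    (α_ _ _ _).hom ≫ Φ.obj Y ◁ ((u ⊗ₘ w) ≫ LaxMonoidal.μ Φ B D) ≫ LaxMonoidal.μ Φ Y (B ⊗ D) := by
  rw [← whisker_exchange_assoc, LaxMonoidal.associativity, ← whisker_exchange_assoc,
    associator_naturality_middle_assoc, associator_naturality_right_assoc]
  simp only [tensorHom_def', MonoidalCategory.whiskerLeft_comp, Category.assoc]

lemma aux_assoc {C : Type*} [Category* C] [MonoidalCategory C] {X A M N P K : C}
    (u : A ⊗ M ⟶ P) (v : P ⊗ N ⟶ K) (w : A ⊗ (M ⊗ N) ⟶ K)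
    (h : u ▷ N ≫ v = (α_ _ _ _).hom ≫ w) :
    ((α_ X A M).hom ≫ X ◁ u) ▷ N ≫ (α_ X P N).hom ≫ X ◁ v =
      (α_ (X ⊗ A) M N).hom ≫ (α_ X A (M ⊗ N)).hom ≫ X ◁ w := by
  rw [comp_whiskerRight, Category.assoc, associator_naturality_middle_assoc,
    ← MonoidalCategory.whiskerLeft_comp, h]
  simp

/-- The component `F_{gh} Z ⟶ F_g F_h Z` of the inverse of the composition isomorphism. -/
def cinv {g h m : G} (e : g * h = m) (Z : C) : (T.F m).obj Z ⟶ (T.F g).obj ((T.F h).obj Z) :=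
  (T.comp e).inv.app Z

lemma cinv_assoc {g h l gh hl m : G} (e₁ : g * h = gh) (e₂ : gh * l = m) (e₃ : h * l = hl)
    (e₄ : g * hl = m) (X : C) :
    T.cinv e₂ X ≫ T.cinv e₁ ((T.F l).obj X) = T.cinv e₄ X ≫ (T.F g).map (T.cinv e₃ X) :=
  T.comp_inv_assoc e₁ e₂ e₃ e₄ X

lemma cinv_μ {g h m : G} (e : g * h = m) (X Y : C) :
    LaxMonoidal.μ (T.F m) X Y ≫ T.cinv e (X ⊗ Y) =
      (T.cinv e X ⊗ₘ T.cinv e Y) ≫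
        LaxMonoidal.μ (T.F g) _ _ ≫ (T.F g).map (LaxMonoidal.μ (T.F h) X Y) :=
  T.comp_inv_μ e X Y

lemma hAssoc_hom' {g h m : G} (e : g * h = m) (X Y Z : C) :
    (T.hAssoc e X Y Z).hom = (α_ _ _ _).hom ≫ X ◁ ((T.F g).obj Y ◁ T.cinv e Z ≫
      LaxMonoidal.μ (T.F g) Y ((T.F h).obj Z)) := by
  simp [hAssoc, cinv]

lemma hAssoc_pentagon {g h l m r n : G} (e₁ : g * h = m) (e₂ : m * l = n) (e₃ : h * l = r)
    (e₄ : g * r = n) (X Y Z W : C) :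
    (T.hAssoc e₁ X Y Z).hom ▷ (T.F n).obj W ≫ (T.hAssoc e₄ X (Y ⊗ (T.F h).obj Z) W).hom ≫
      X ◁ (T.F g).map (T.hAssoc e₃ Y Z W).hom =
    (T.hAssoc e₂ (X ⊗ (T.F g).obj Y) Z W).hom ≫
      (T.hAssoc e₁ X Y (Z ⊗ (T.F l).obj W)).hom := by
  simp only [hAssoc_hom', Category.assoc, ← MonoidalCategory.whiskerLeft_comp]
  rw [associator_naturality_right_assoc, ← MonoidalCategory.whiskerLeft_comp]
  apply aux_assoc
  have hb : (T.F m).obj Z ◁ T.cinv e₂ W ≫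
      LaxMonoidal.μ (T.F m) Z ((T.F l).obj W) ≫ T.cinv e₁ (Z ⊗ (T.F l).obj W) =
      (T.cinv e₁ Z ⊗ₘ T.cinv e₄ W) ≫
      (T.F g).obj ((T.F h).obj Z) ◁ (T.F g).map (T.cinv e₃ W) ≫
      LaxMonoidal.μ (T.F g) _ _ ≫ (T.F g).map (LaxMonoidal.μ (T.F h) Z ((T.F l).obj W)) := by
    rw [T.cinv_μ e₁, ← id_tensorHom, tensorHom_comp_tensorHom_assoc, Category.id_comp,
      T.cinv_assoc e₁ e₂ e₃ e₄, ← id_tensorHom, tensorHom_comp_tensorHom_assoc]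
    simp
  have := aux_pentagon (T.F g) (Y := Y) (T.cinv e₁ Z) (T.cinv e₄ W)
  simp only [comp_whiskerRight, Category.assoc, Functor.map_comp]
  rw [reassoc_of% this]
  rw [← LaxMonoidal.μ_natural_right, ← MonoidalCategory.whiskerLeft_comp_assoc,
    ← MonoidalCategory.whiskerLeft_comp_assoc]
  simp only [Category.assoc]
  rw [hb]
  simp

lemma hAssoc_nat_left {g h m : G} (e : g * h = m) {X X' : C} (f : X ⟶ X') (Y Z : C) :
    (f ▷ (T.F g).obj Y) ▷ (T.F m).obj Z ≫ (T.hAssoc e X' Y Z).hom =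
      (T.hAssoc e X Y Z).hom ≫ f ▷ (T.F g).obj (Y ⊗ (T.F h).obj Z) := by
  have := T.hAssoc_nat e f (𝟙 Y) (𝟙 Z)
  simpa using this

lemma hAssoc_nat_middle {g h m : G} (e : g * h = m) (X : C) {Y Y' : C} (f : Y ⟶ Y') (Z : C) :
    (X ◁ (T.F g).map f) ▷ (T.F m).obj Z ≫ (T.hAssoc e X Y' Z).hom =
      (T.hAssoc e X Y Z).hom ≫ X ◁ (T.F g).map (f ▷ (T.F h).obj Z) := by
  have := T.hAssoc_nat e (𝟙 X) f (𝟙 Z)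
  simpa only [CategoryTheory.Functor.map_id, id_tensorHom, tensorHom_id] using this

lemma hAssoc_nat_right {g h m : G} (e : g * h = m) (X Y : C) {Z Z' : C} (f : Z ⟶ Z') :
    (X ⊗ (T.F g).obj Y) ◁ (T.F m).map f ≫ (T.hAssoc e X Y Z').hom =
      (T.hAssoc e X Y Z).hom ≫ X ◁ (T.F g).map (Y ◁ (T.F h).map f) := by
  have := T.hAssoc_nat e (𝟙 X) (𝟙 Y) f
  simpa only [CategoryTheory.Functor.map_id, id_tensorHom, tensorHom_id, id_whiskerRight]
    using this

/-- The isomorphism `Id ≅ F_g` for `g = 1`. -/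
def unitIso {g : G} (e : 1 = g) : 𝟭 C ≅ T.F g := T.unit ≪≫ eqToIso (congrArg T.F e)

/-- The isomorphism `𝟙 ⊗ F_1 X ≅ X`. -/
def hLeftUnitor {g : G} (e : 1 = g) (X : C) : 𝟙_ C ⊗ (T.F g).obj X ≅ X :=
  λ_ _ ≪≫ (T.unitIso e).symm.app X

/-- The isomorphism `X ⊗ F_g 𝟙 ≅ X`. -/
def hRightUnitor (g : G) (X : C) : X ⊗ (T.F g).obj (𝟙_ C) ≅ X :=
  whiskerLeftIso X (Monoidal.εIso (T.F g)).symm ≪≫ ρ_ X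

lemma hLeftUnitor_nat {g : G} (e : 1 = g) {X Y : C} (f : X ⟶ Y) :
    𝟙_ C ◁ (T.F g).map f ≫ (T.hLeftUnitor e Y).hom = (T.hLeftUnitor e X).hom ≫ f := by
  have := (T.unitIso e).inv.naturality f
  simp only [hLeftUnitor, Iso.trans_hom, leftUnitor_naturality_assoc, Category.assoc]
  congr 1

lemma hRightUnitor_nat (g : G) {X Y : C} (f : X ⟶ Y) :
    f ▷ (T.F g).obj (𝟙_ C) ≫ (T.hRightUnitor g Y).hom = (T.hRightUnitor g X).hom ≫ f := by
  simp [hRightUnitor, ← whisker_exchange_assoc]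

lemma hTriangle {g h : G} (e : g * h = g) (e' : 1 = h) (X Y : C) :
    (T.hAssoc e X (𝟙_ C) Y).hom ≫ X ◁ (T.F g).map (T.hLeftUnitor e' Y).hom =
      (T.hRightUnitor g X).hom ▷ (T.F g).obj Y := by
  subst e'
  have h1 : T.cinv e Y ≫ (T.F g).map (T.unit.inv.app Y) = 𝟙 _ := by
    have h2 : T.comp e = T.comp (mul_one g) := rfl
    have h3 : (T.F g).map (T.unit.hom.app Y) ≫ (T.F g).map (T.unit.inv.app Y) = 𝟙 _ := by
      rw [← Functor.map_comp]; simp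
    rw [← cancel_epi ((T.comp e).hom.app Y), ← cancel_epi ((T.F g).map (T.unit.hom.app Y))]
    simp only [cinv, Iso.hom_inv_id_app_assoc, Category.comp_id]
    rw [h2, comp_unit]
    exact h3
  simp only [hAssoc_hom', hLeftUnitor, hRightUnitor, unitIso, Iso.trans_hom, Category.assoc,
    comp_whiskerRight, whiskerLeftIso_hom, eqToIso_refl, Iso.trans_refl,
    Iso.symm_hom, Monoidal.εIso_inv, Iso.app_hom, whisker_assoc, triangle_assoc_comp_right]
  simp only [← MonoidalCategory.whiskerLeft_comp, Functor.map_comp]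
  have h4 : ∀ Z : C, LaxMonoidal.μ (T.F g) (𝟙_ C) Z ≫ (T.F g).map (λ_ Z).hom =
      OplaxMonoidal.η (T.F g) ▷ (T.F g).obj Z ≫ (λ_ _).hom := by
    intro Z
    rw [LaxMonoidal.left_unitality, ← comp_whiskerRight_assoc, Monoidal.η_ε]
    simp
  rw [Category.assoc, reassoc_of% h4, whisker_exchange_assoc, leftUnitor_naturality_assoc, h1,
    Category.comp_id]

lemma hLeftTriangle {h : G} (e : 1 * h = h) (X Y : C) :
    (T.hAssoc e (𝟙_ C) X Y).hom ≫ (T.hLeftUnitor rfl (X ⊗ (T.F h).obj Y)).hom =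
      (T.hLeftUnitor rfl X).hom ▷ (T.F h).obj Y := by
  have h1 : T.cinv e Y ≫ T.unit.inv.app ((T.F h).obj Y) = 𝟙 _ := by
    have h2 : T.comp e = T.comp (one_mul h) := rfl
    rw [← cancel_epi ((T.comp e).hom.app Y), ← cancel_epi (T.unit.hom.app ((T.F h).obj Y))]
    simp only [cinv, Iso.hom_inv_id_app_assoc, Category.comp_id]
    rw [h2, unit_comp]
    exact Iso.hom_inv_id_app _ _
  have h5 : LaxMonoidal.μ (T.F 1) X ((T.F h).obj Y) ≫ T.unit.inv.app (X ⊗ (T.F h).obj Y) =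
      T.unit.inv.app X ⊗ₘ T.unit.inv.app ((T.F h).obj Y) := by
    have := NatTrans.IsMonoidal.tensor (τ := T.unit.inv) X ((T.F h).obj Y)
    exact this.trans (Category.comp_id _)
  simp only [hAssoc_hom', hLeftUnitor, unitIso, Iso.trans_hom, Category.assoc,
    comp_whiskerRight, eqToIso_refl, Iso.trans_refl, Iso.symm_hom, Iso.app_hom,
    MonoidalCategory.whiskerLeft_comp, leftUnitor_naturality_assoc]
  rw [h5]
  rw [tensorHom_def', ← MonoidalCategory.whiskerLeft_comp_assoc, h1]
  simp [-LaxMonoidal.left_unitality]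

end TensorAction


/-- Objects of the crossed product `C ⋊ G`: families `(X_g)_{g ∈ G}` of objects of `C`,
standing for `⨁_g [X_g, g]`. -/
structure CrossedProduct {k : Type*} [Field k] {G : Type*} [Group G] {C : Type*} [Category* C]
    [Abelian C] [Linear k C] [MonoidalCategory C] (T : TensorAction k G C) where
  comp : G → C

namespace CrossedProduct

variable {k : Type*} [Field k] {G : Type*} [Group G] {C : Type*} [Category* C]
    [Abelian C] [Linear k C] [MonoidalCategory C] {T : TensorAction k G C}

/-- Morphisms of `C ⋊ G` are families of morphisms. -/
@[ext]
structure Hom (X Y : CrossedProduct T) where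
  app (g : G) : X.comp g ⟶ Y.comp g

instance : Category (CrossedProduct T) where
  Hom X Y := Hom X Y
  id X := ⟨fun g => 𝟙 (X.comp g)⟩
  comp f f' := ⟨fun g => f.app g ≫ f'.app g⟩

@[ext]
lemma hom_ext {X Y : CrossedProduct T} {f f' : X ⟶ Y} (h : ∀ g, f.app g = f'.app g) : f = f' :=
  Hom.ext (funext h)

@[simp] lemma id_app (X : CrossedProduct T) (g : G) : Hom.app (𝟙 X) g = 𝟙 (X.comp g) := rfl
@[simp] lemma comp_app {X Y Z : CrossedProduct T} (f : X ⟶ Y) (f' : Y ⟶ Z) (g : G) :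
    (f ≫ f').app g = f.app g ≫ f'.app g := rfl

/-- Isomorphisms in `C ⋊ G` from families of isomorphisms. -/
@[simps]
def mkIso {X Y : CrossedProduct T} (e : ∀ g, X.comp g ≅ Y.comp g) : X ≅ Y where
  hom := ⟨fun g => (e g).hom⟩
  inv := ⟨fun g => (e g).inv⟩

/-- Transport of components along an equality of degrees. -/
def tr (X : CrossedProduct T) {g h : G} (e : g = h) : X.comp g ≅ X.comp h :=
  eqToIso (congrArg X.comp e)

variable [Finite G]

/-- `(X ⊗ Y)_m = ⨁_{gh = m} X_g ⊗ F_g (Y_h)`. -/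
noncomputable def tensorObj (X Y : CrossedProduct T) : CrossedProduct T where
  comp m := ⨁ fun p : {p : G × G // p.1 * p.2 = m} => X.comp p.1.1 ⊗ (T.F p.1.1).obj (Y.comp p.1.2)

/-- The inclusion of the summand `X_g ⊗ F_g (Y_h)` into `(X ⊗ Y)_{gh}`. -/
noncomputable def ι (X Y : CrossedProduct T) {g h m : G} (e : g * h = m) :
    X.comp g ⊗ (T.F g).obj (Y.comp h) ⟶ (tensorObj X Y).comp m :=
  biproduct.ι (fun p : {p : G × G // p.1 * p.2 = m} =>
    X.comp p.1.1 ⊗ (T.F p.1.1).obj (Y.comp p.1.2)) ⟨(g, h), e⟩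

lemma tensor_hom_ext {D : Type*} [Category* D] [Abelian D] (Φ : C ⥤ D) [Φ.Additive]
    {X Y : CrossedProduct T} {m : G} {Z : D}
    {f f' : Φ.obj ((tensorObj X Y).comp m) ⟶ Z}
    (w : ∀ g h (e : g * h = m), Φ.map (ι X Y e) ≫ f = Φ.map (ι X Y e) ≫ f') : f = f' :=
  sum_hom_ext Φ (fun ⟨_, e⟩ => w _ _ e)

lemma tensor_hom_ext' {X Y : CrossedProduct T} {m : G} {Z : C}
    {f f' : (tensorObj X Y).comp m ⟶ Z}
    (w : ∀ g h (e : g * h = m), ι X Y e ≫ f = ι X Y e ≫ f') : f = f' :=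
  biproduct.hom_ext' _ _ (fun ⟨_, e⟩ => w _ _ e)

/-- The tensor product of morphisms. -/
noncomputable def tensorHom {X X' Y Y' : CrossedProduct T} (f : X ⟶ X') (f' : Y ⟶ Y') :
    tensorObj X Y ⟶ tensorObj X' Y' where
  app _ := biproduct.map fun p => f.app p.1.1 ⊗ₘ (T.F p.1.1).map (f'.app p.1.2)

lemma ι_tensorHom {X X' Y Y' : CrossedProduct T} (f : X ⟶ X') (f' : Y ⟶ Y') {g h m : G}
    (e : g * h = m) : ι X Y e ≫ (tensorHom f f').app m =
      (f.app g ⊗ₘ (T.F g).map (f'.app h)) ≫ ι X' Y' e := by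
  dsimp only [ι, tensorHom]
  erw [biproduct.ι_map]
  rfl

/-- The object `[X, g]`, concentrated in degree `g`: the sum over the proofs of `g = h` is `X` if
`g = h`, and `0` otherwise. -/
noncomputable def single (g : G) (X : C) : CrossedProduct T where
  comp h := ⨁ fun _ : PLift (g = h) => X

noncomputable def singleι (g : G) (X : C) {h : G} (e : g = h) :
    X ⟶ (single (T := T) g X).comp h :=
  biproduct.ι (fun _ : PLift (g = h) => X) ⟨e⟩

variable [MonoidalPreadditive C]

noncomputable def assocHom (X Y Z : CrossedProduct T) :
    tensorObj (tensorObj X Y) Z ⟶ tensorObj X (tensorObj Y Z) where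
  app m := biproduct.desc fun p => sumDesc (tensorRight _)
    fun q => (T.hAssoc q.2 _ _ _).hom ≫
      X.comp q.1.1 ◁ (T.F q.1.1).map (ι Y Z rfl) ≫
        ι X (tensorObj Y Z) (by rw [← mul_assoc, q.2, p.2])

noncomputable def assocInv (X Y Z : CrossedProduct T) :
    tensorObj X (tensorObj Y Z) ⟶ tensorObj (tensorObj X Y) Z where
  app m := biproduct.desc fun p => sumDesc (T.F p.1.1 ⋙ tensorLeft (X.comp p.1.1))
    fun q => (T.hAssoc rfl _ _ _).inv ≫
      ι X Y rfl ▷ _ ≫ ι (tensorObj X Y) Z (by rw [mul_assoc, q.2, p.2])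

lemma ι_assocHom (X Y Z : CrossedProduct T) {g h l m r n : G} (e₁ : g * h = m) (e₂ : m * l = n)
    (e₃ : h * l = r) (e₄ : g * r = n) :
    ι X Y e₁ ▷ (T.F m).obj (Z.comp l) ≫ ι (tensorObj X Y) Z e₂ ≫ (assocHom X Y Z).app n =
      (T.hAssoc e₁ _ _ _).hom ≫ X.comp g ◁ (T.F g).map (ι Y Z e₃) ≫ ι X (tensorObj Y Z) e₄ := by
  subst e₃
  dsimp only [assocHom]
  erw [biproduct.ι_desc]
  exact map_ι_sumDesc (tensorRight ((T.F m).obj (Z.comp l))) _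
    (⟨(g, h), e₁⟩ : {p : G × G // p.1 * p.2 = m})

lemma ι_assocInv (X Y Z : CrossedProduct T) {g h l m r n : G} (e₁ : g * h = m) (e₂ : m * l = n)
    (e₃ : h * l = r) (e₄ : g * r = n) :
    X.comp g ◁ (T.F g).map (ι Y Z e₃) ≫ ι X (tensorObj Y Z) e₄ ≫ (assocInv X Y Z).app n =
      (T.hAssoc e₁ _ _ _).inv ≫ ι X Y e₁ ▷ (T.F m).obj (Z.comp l) ≫ ι (tensorObj X Y) Z e₂ := by
  subst e₁
  dsimp only [assocInv]
  erw [biproduct.ι_desc]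
  exact map_ι_sumDesc (T.F g ⋙ tensorLeft (X.comp g)) _
    (⟨(h, l), e₃⟩ : {p : G × G // p.1 * p.2 = r})

lemma tensor_ext_left {X Y Z : CrossedProduct T} {n : G} {W : C}
    {f f' : (tensorObj (tensorObj X Y) Z).comp n ⟶ W}
    (w : ∀ g h m l (e₁ : g * h = m) (e₂ : m * l = n),
      ι X Y e₁ ▷ (T.F m).obj (Z.comp l) ≫ ι (tensorObj X Y) Z e₂ ≫ f =
        ι X Y e₁ ▷ (T.F m).obj (Z.comp l) ≫ ι (tensorObj X Y) Z e₂ ≫ f') : f = f' :=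
  tensor_hom_ext' fun m l e₂ => tensor_hom_ext (tensorRight _) fun g h e₁ => w g h m l e₁ e₂

lemma tensor_ext_right {X Y Z : CrossedProduct T} {n : G} {W : C}
    {f f' : (tensorObj X (tensorObj Y Z)).comp n ⟶ W}
    (w : ∀ g h l r (e₃ : h * l = r) (e₄ : g * r = n),
      X.comp g ◁ (T.F g).map (ι Y Z e₃) ≫ ι X (tensorObj Y Z) e₄ ≫ f =
        X.comp g ◁ (T.F g).map (ι Y Z e₃) ≫ ι X (tensorObj Y Z) e₄ ≫ f') : f = f' :=
  tensor_hom_ext' fun g r e₄ => tensor_hom_ext (T.F g ⋙ tensorLeft _) fun h l e₃ =>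
    w g h l r e₃ e₄

/-- The associator of `C ⋊ G`. -/
noncomputable def associator (X Y Z : CrossedProduct T) :
    tensorObj (tensorObj X Y) Z ≅ tensorObj X (tensorObj Y Z) where
  hom := assocHom X Y Z
  inv := assocInv X Y Z
  hom_inv_id := by
    ext n
    refine tensor_ext_left fun g h m l e₁ e₂ => ?_
    rw [comp_app, reassoc_of% ι_assocHom X Y Z e₁ e₂ rfl (by rw [← mul_assoc, e₁, e₂]),
      ι_assocInv X Y Z e₁ e₂ rfl (by rw [← mul_assoc, e₁, e₂])]
    simp
  inv_hom_id := by
    ext n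
    refine tensor_ext_right fun g h l r e₃ e₄ => ?_
    rw [comp_app, reassoc_of% ι_assocInv X Y Z rfl (by rw [mul_assoc, e₃, e₄]) e₃ e₄,
      ι_assocHom X Y Z rfl (by rw [mul_assoc, e₃, e₄]) e₃ e₄]
    simp

lemma single_ext {D : Type*} [Category* D] [Abelian D] (Φ : C ⥤ D) [Φ.Additive] {g h : G} {X : C}
    {Z : D} {f f' : Φ.obj ((single (T := T) g X).comp h) ⟶ Z}
    (w : ∀ e : g = h, Φ.map (singleι g X e) ≫ f = Φ.map (singleι g X e) ≫ f') : f = f' :=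
  sum_hom_ext Φ (fun ⟨e⟩ => w e)

lemma tr_nat {X Y : CrossedProduct T} (f : X ⟶ Y) {g h : G} (e : g = h) :
    (X.tr e).hom ≫ f.app h = f.app g ≫ (Y.tr e).hom := by
  subst e
  simp [tr]

noncomputable def leftUnitorHom (X : CrossedProduct T) :
    tensorObj (single 1 (𝟙_ C)) X ⟶ X where
  app m := biproduct.desc fun p => sumDesc (tensorRight _)
    fun q : PLift (1 = p.1.1) => (T.hLeftUnitor q.down _).hom ≫
      (X.tr (by have := p.2; rwa [← q.down, one_mul] at this)).hom

lemma ι_leftUnitorHom (X : CrossedProduct T) {g h m : G} (e : 1 = g) (e' : g * h = m)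
    (e'' : h = m) :
    singleι 1 (𝟙_ C) e ▷ (T.F g).obj (X.comp h) ≫ ι (single 1 (𝟙_ C)) X e' ≫
      (leftUnitorHom X).app m = (T.hLeftUnitor e _).hom ≫ (X.tr e'').hom := by
  dsimp only [leftUnitorHom]
  erw [biproduct.ι_desc]
  exact map_ι_sumDesc (tensorRight ((T.F g).obj (X.comp h))) _ (⟨e⟩ : PLift (1 = g))

noncomputable def rightUnitorHom (X : CrossedProduct T) :
    tensorObj X (single 1 (𝟙_ C)) ⟶ X where
  app m := biproduct.desc fun p => sumDesc (T.F p.1.1 ⋙ tensorLeft (X.comp p.1.1))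
    fun q : PLift (1 = p.1.2) => (T.hRightUnitor p.1.1 _).hom ≫
      (X.tr (by have := p.2; rwa [← q.down, mul_one] at this)).hom

lemma ι_rightUnitorHom (X : CrossedProduct T) {g h m : G} (e : 1 = h) (e' : g * h = m)
    (e'' : g = m) :
    X.comp g ◁ (T.F g).map (singleι 1 (𝟙_ C) e) ≫ ι X (single 1 (𝟙_ C)) e' ≫
      (rightUnitorHom X).app m = (T.hRightUnitor g _).hom ≫ (X.tr e'').hom := by
  dsimp only [rightUnitorHom]
  erw [biproduct.ι_desc]
  exact map_ι_sumDesc (T.F g ⋙ tensorLeft (X.comp g)) _ (⟨e⟩ : PLift (1 = h))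

lemma leftUnit_ext {X : CrossedProduct T} {m : G} {W : C}
    {f f' : (tensorObj (single 1 (𝟙_ C)) X).comp m ⟶ W}
    (w : singleι 1 (𝟙_ C) rfl ▷ (T.F 1).obj (X.comp m) ≫
        ι (single 1 (𝟙_ C)) X (one_mul m) ≫ f =
      singleι 1 (𝟙_ C) rfl ▷ (T.F 1).obj (X.comp m) ≫
        ι (single 1 (𝟙_ C)) X (one_mul m) ≫ f') : f = f' :=
  tensor_hom_ext' fun g h e' => single_ext (tensorRight _) fun e => by
    subst e
    obtain rfl : h = m := by simpa using e'
    exact w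

lemma rightUnit_ext {X : CrossedProduct T} {m : G} {W : C}
    {f f' : (tensorObj X (single 1 (𝟙_ C))).comp m ⟶ W}
    (w : X.comp m ◁ (T.F m).map (singleι 1 (𝟙_ C) rfl) ≫
        ι X (single 1 (𝟙_ C)) (mul_one m) ≫ f =
      X.comp m ◁ (T.F m).map (singleι 1 (𝟙_ C) rfl) ≫
        ι X (single 1 (𝟙_ C)) (mul_one m) ≫ f') : f = f' :=
  tensor_hom_ext' fun g h e' => single_ext (T.F g ⋙ tensorLeft (X.comp g)) fun e => by
    subst e
    obtain rfl : g = m := by simpa using e'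
    exact w

/-- The left unitor of `C ⋊ G`. -/
noncomputable def leftUnitor (X : CrossedProduct T) : tensorObj (single 1 (𝟙_ C)) X ≅ X where
  hom := leftUnitorHom X
  inv := ⟨fun m => (T.hLeftUnitor rfl _).inv ≫ singleι 1 (𝟙_ C) rfl ▷ (T.F 1).obj (X.comp m) ≫
    ι (single 1 (𝟙_ C)) X (one_mul m)⟩
  hom_inv_id := by
    ext m
    refine leftUnit_ext ?_
    rw [comp_app, reassoc_of% ι_leftUnitorHom X rfl (one_mul m) rfl]
    simp [tr]
  inv_hom_id := by
    ext m
    rw [comp_app, Category.assoc, Category.assoc, ι_leftUnitorHom X rfl (one_mul m) rfl]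
    simp [tr]

/-- The right unitor of `C ⋊ G`. -/
noncomputable def rightUnitor (X : CrossedProduct T) : tensorObj X (single 1 (𝟙_ C)) ≅ X where
  hom := rightUnitorHom X
  inv := ⟨fun m => (T.hRightUnitor m _).inv ≫ X.comp m ◁ (T.F m).map (singleι 1 (𝟙_ C) rfl) ≫
    ι X (single 1 (𝟙_ C)) (mul_one m)⟩
  hom_inv_id := by
    ext m
    refine rightUnit_ext ?_
    rw [comp_app, reassoc_of% ι_rightUnitorHom X rfl (mul_one m) rfl]
    simp [tr]
  inv_hom_id := by
    ext m
    rw [comp_app, Category.assoc, Category.assoc, ι_rightUnitorHom X rfl (mul_one m) rfl]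
    simp [tr]

@[simps]
noncomputable instance : MonoidalCategoryStruct (CrossedProduct T) where
  tensorObj := tensorObj
  whiskerLeft X _ _ f := tensorHom (𝟙 X) f
  whiskerRight f Y := tensorHom f (𝟙 Y)
  tensorHom := tensorHom
  tensorUnit := single 1 (𝟙_ C)
  associator := associator
  leftUnitor := leftUnitor
  rightUnitor := rightUnitor

lemma pentagon_aux (X Y Z W : CrossedProduct T) :
    tensorHom (assocHom X Y Z) (𝟙 W) ≫ assocHom X (tensorObj Y Z) W ≫
      tensorHom (𝟙 X) (assocHom Y Z W) =
    assocHom (tensorObj X Y) Z W ≫ assocHom X Y (tensorObj Z W) := by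
  ext n
  refine tensor_ext_left fun m l n' q e₂ e₃ => tensor_hom_ext (tensorRight _ ⋙ tensorRight _)
    fun g h e₁ => ?_
  have a1 : h * l = h * l := rfl
  have a2 : g * (h * l) = n' := by rw [← mul_assoc, e₁, e₂]
  have a3 : l * q = l * q := rfl
  have a4 : h * (l * q) = h * l * q := by rw [mul_assoc]
  have a5 : g * (h * l * q) = n := by rw [← mul_assoc, a2, e₃]
  have a6 : m * (l * q) = n := by rw [← mul_assoc, e₂, e₃]
  simp only [comp_app]
  have L : (ι X Y e₁ ▷ (T.F m).obj (Z.comp l)) ▷ (T.F n').obj (W.comp q) ≫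
      ι (tensorObj X Y) Z e₂ ▷ (T.F n').obj (W.comp q) ≫ ι (tensorObj (tensorObj X Y) Z) W e₃ ≫
      (tensorHom (assocHom X Y Z) (𝟙 W)).app n ≫ (assocHom X (tensorObj Y Z) W).app n ≫
      (tensorHom (𝟙 X) (assocHom Y Z W)).app n =
      (T.hAssoc e₁ _ _ _).hom ▷ _ ≫ (T.hAssoc a2 _ _ _).hom ≫
        X.comp g ◁ (T.F g).map ((T.hAssoc a1 _ _ _).hom) ≫
        X.comp g ◁ (T.F g).map (Y.comp h ◁ (T.F h).map (ι Z W a3)) ≫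
        X.comp g ◁ (T.F g).map (ι Y (tensorObj Z W) a4) ≫ ι X _ a5 := by
    rw [reassoc_of% ι_tensorHom]
    simp only [id_app, CategoryTheory.Functor.map_id, tensorHom_id]
    rw [← comp_whiskerRight_assoc, ← comp_whiskerRight_assoc]
    simp only [Category.assoc]
    rw [ι_assocHom X Y Z e₁ e₂ a1 a2]
    simp only [comp_whiskerRight, Category.assoc]
    rw [reassoc_of% ι_assocHom X (tensorObj Y Z) W a2 e₃ rfl a5,
      reassoc_of% T.hAssoc_nat_middle a2, ι_tensorHom]
    simp only [id_app, id_tensorHom]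
    simp only [← MonoidalCategory.whiskerLeft_comp_assoc, ← Functor.map_comp]
    rw [ι_assocHom Y Z W a1 rfl a3 a4]
  have R : (ι X Y e₁ ▷ (T.F m).obj (Z.comp l)) ▷ (T.F n').obj (W.comp q) ≫
      ι (tensorObj X Y) Z e₂ ▷ (T.F n').obj (W.comp q) ≫ ι (tensorObj (tensorObj X Y) Z) W e₃ ≫
      (assocHom (tensorObj X Y) Z W).app n ≫ (assocHom X Y (tensorObj Z W)).app n =
      (T.hAssoc e₁ _ _ _).hom ▷ _ ≫ (T.hAssoc a2 _ _ _).hom ≫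
        X.comp g ◁ (T.F g).map ((T.hAssoc a1 _ _ _).hom) ≫
        X.comp g ◁ (T.F g).map (Y.comp h ◁ (T.F h).map (ι Z W a3)) ≫
        X.comp g ◁ (T.F g).map (ι Y (tensorObj Z W) a4) ≫ ι X _ a5 := by
    rw [reassoc_of% ι_assocHom (tensorObj X Y) Z W e₂ e₃ a3 a6, reassoc_of% T.hAssoc_nat_left e₂,
      ← whisker_exchange_assoc, ι_assocHom X Y (tensorObj Z W) e₁ a6 a4 a5,
      reassoc_of% T.hAssoc_nat_right e₁, reassoc_of% T.hAssoc_pentagon e₁ e₂ a1 a2]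
  exact L.trans R.symm

lemma tensorHom_id_id (X Y : CrossedProduct T) : tensorHom (𝟙 X) (𝟙 Y) = 𝟙 (tensorObj X Y) := by
  ext m
  refine tensor_hom_ext' fun g h e => ?_
  rw [ι_tensorHom]
  simp only [id_app, CategoryTheory.Functor.map_id, id_tensorHom_id, Category.id_comp]
  exact (Category.comp_id _).symm

lemma tensorHom_comp {X₁ X₂ X₃ Y₁ Y₂ Y₃ : CrossedProduct T} (f₁ : X₁ ⟶ X₂) (f₂ : X₂ ⟶ X₃)
    (g₁ : Y₁ ⟶ Y₂) (g₂ : Y₂ ⟶ Y₃) :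
    tensorHom f₁ g₁ ≫ tensorHom f₂ g₂ = tensorHom (f₁ ≫ f₂) (g₁ ≫ g₂) := by
  ext m
  refine tensor_hom_ext' fun g h e => ?_
  simp only [comp_app, ι_tensorHom, reassoc_of% ι_tensorHom, Functor.map_comp,
    tensorHom_comp_tensorHom_assoc]

lemma associator_nat {X₁ X₂ Y₁ Y₂ Z₁ Z₂ : CrossedProduct T} (f : X₁ ⟶ X₂) (f' : Y₁ ⟶ Y₂)
    (f'' : Z₁ ⟶ Z₂) : tensorHom (tensorHom f f') f'' ≫ assocHom X₂ Y₂ Z₂ =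
      assocHom X₁ Y₁ Z₁ ≫ tensorHom f (tensorHom f' f'') := by
  ext n
  refine tensor_ext_left fun g h m l e₁ e₂ => ?_
  have a3 : h * l = h * l := rfl
  have a4 : g * (h * l) = n := by rw [← mul_assoc, e₁, e₂]
  simp only [comp_app]
  rw [reassoc_of% ι_tensorHom, reassoc_of% ι_assocHom X₁ Y₁ Z₁ e₁ e₂ a3 a4, ι_tensorHom,
    ← tensorHom_id, tensorHom_comp_tensorHom_assoc, ι_tensorHom, Category.id_comp]
  have h1 : (f.app g ⊗ₘ (T.F g).map (f'.app h)) ≫ ι X₂ Y₂ e₁ ⊗ₘ (T.F m).map (f''.app l) =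
      ((f.app g ⊗ₘ (T.F g).map (f'.app h)) ⊗ₘ (T.F m).map (f''.app l)) ≫
        ι X₂ Y₂ e₁ ▷ (T.F m).obj (Z₂.comp l) := by
    rw [← tensorHom_id, tensorHom_comp_tensorHom, Category.comp_id]
  rw [h1, Category.assoc, ι_assocHom X₂ Y₂ Z₂ e₁ e₂ a3 a4, reassoc_of% T.hAssoc_nat e₁]
  rw [← id_tensorHom, ← id_tensorHom, tensorHom_comp_tensorHom_assoc,
    tensorHom_comp_tensorHom_assoc, ← Functor.map_comp, ← Functor.map_comp, ι_tensorHom]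
  simp only [Category.id_comp, Category.comp_id]

lemma leftUnitor_nat {X Y : CrossedProduct T} (f : X ⟶ Y) :
    tensorHom (𝟙 (single 1 (𝟙_ C))) f ≫ leftUnitorHom Y = leftUnitorHom X ≫ f := by
  ext m
  refine leftUnit_ext ?_
  simp only [comp_app]
  rw [reassoc_of% ι_leftUnitorHom X rfl (one_mul m) rfl, reassoc_of% ι_tensorHom, id_app, id_tensorHom,
    ← whisker_exchange_assoc, ι_leftUnitorHom Y rfl (one_mul m) rfl, reassoc_of% T.hLeftUnitor_nat,
    tr_nat]

lemma rightUnitor_nat {X Y : CrossedProduct T} (f : X ⟶ Y) :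
    tensorHom f (𝟙 (single 1 (𝟙_ C))) ≫ rightUnitorHom Y = rightUnitorHom X ≫ f := by
  ext m
  refine rightUnit_ext ?_
  simp only [comp_app]
  rw [reassoc_of% ι_rightUnitorHom X rfl (mul_one m) rfl, reassoc_of% ι_tensorHom, id_app,
    CategoryTheory.Functor.map_id, tensorHom_id,
    whisker_exchange_assoc, ι_rightUnitorHom Y rfl (mul_one m) rfl, reassoc_of% T.hRightUnitor_nat,
    tr_nat]

lemma triangle_aux (X Y : CrossedProduct T) :
    assocHom X (single 1 (𝟙_ C)) Y ≫ tensorHom (𝟙 X) (leftUnitorHom Y) =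
      tensorHom (rightUnitorHom X) (𝟙 Y) := by
  ext n
  refine tensor_hom_ext' fun m l e₂ => ?_
  refine tensor_hom_ext (tensorRight _) fun g h e₁ => ?_
  refine single_ext (T.F g ⋙ tensorLeft _ ⋙ tensorRight _) fun e => ?_
  subst e
  obtain rfl : g = m := by simpa using e₁
  have L : (X.comp g ◁ (T.F g).map (singleι 1 (𝟙_ C) rfl)) ▷ (T.F g).obj (Y.comp l) ≫
      ι X (single 1 (𝟙_ C)) e₁ ▷ (T.F g).obj (Y.comp l) ≫ ι (tensorObj X (single 1 (𝟙_ C))) Y e₂ ≫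
      (assocHom X (single 1 (𝟙_ C)) Y).app n ≫ (tensorHom (𝟙 X) (leftUnitorHom Y)).app n =
      (T.hRightUnitor g (X.comp g)).hom ▷ (T.F g).obj (Y.comp l) ≫ ι X Y e₂ := by
    rw [reassoc_of% ι_assocHom X _ Y e₁ e₂ (one_mul l) e₂, ι_tensorHom, id_app, id_tensorHom,
      reassoc_of% T.hAssoc_nat_middle]
    simp only [← MonoidalCategory.whiskerLeft_comp_assoc, ← Functor.map_comp]
    rw [ι_leftUnitorHom Y rfl (one_mul l) rfl, ← T.hTriangle e₁ rfl]
    simp [tr]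
  have R : (X.comp g ◁ (T.F g).map (singleι 1 (𝟙_ C) rfl)) ▷ (T.F g).obj (Y.comp l) ≫
      ι X (single 1 (𝟙_ C)) e₁ ▷ (T.F g).obj (Y.comp l) ≫ ι (tensorObj X (single 1 (𝟙_ C))) Y e₂ ≫
      (tensorHom (rightUnitorHom X) (𝟙 Y)).app n =
      (T.hRightUnitor g (X.comp g)).hom ▷ (T.F g).obj (Y.comp l) ≫ ι X Y e₂ := by
    rw [ι_tensorHom, id_app, CategoryTheory.Functor.map_id, tensorHom_id]
    simp only [← comp_whiskerRight_assoc]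
    rw [ι_rightUnitorHom X rfl e₁ rfl]
    simp [tr]
  exact L.trans R.symm

noncomputable instance : MonoidalCategory (CrossedProduct T) :=
  MonoidalCategory.ofTensorHom
    (id_tensorHom_id := tensorHom_id_id)
    (id_tensorHom := fun _ _ _ _ => rfl)
    (tensorHom_id := fun _ _ => rfl)
    (tensorHom_comp_tensorHom := fun f₁ f₂ g₁ g₂ => tensorHom_comp f₁ g₁ f₂ g₂)
    (associator_naturality := fun f g h => associator_nat f g h)
    (leftUnitor_naturality := fun f => leftUnitor_nat f)
    (rightUnitor_naturality := fun f => rightUnitor_nat f)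
    (pentagon := pentagon_aux)
    (triangle := triangle_aux)


/-- `X ▷ M = ⨁_g X_g ⊗ F_g M`. -/
noncomputable def actObj (X : CrossedProduct T) (M : C) : C :=
  ⨁ fun g : G => X.comp g ⊗ (T.F g).obj M

noncomputable def actι (X : CrossedProduct T) (M : C) (g : G) :
    X.comp g ⊗ (T.F g).obj M ⟶ actObj X M :=
  biproduct.ι (fun g : G => X.comp g ⊗ (T.F g).obj M) g

noncomputable def actHom {X X' : CrossedProduct T} {M M' : C} (f : X ⟶ X') (f' : M ⟶ M') :
    actObj X M ⟶ actObj X' M' :=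
  biproduct.map fun g => f.app g ⊗ₘ (T.F g).map f'

lemma act_hom_ext {D : Type*} [Category* D] [Abelian D] (Φ : C ⥤ D) [Φ.Additive]
    {X : CrossedProduct T} {M : C} {Z : D} {f f' : Φ.obj (actObj X M) ⟶ Z}
    (w : ∀ g, Φ.map (actι X M g) ≫ f = Φ.map (actι X M g) ≫ f') : f = f' :=
  sum_hom_ext Φ w

lemma act_hom_ext' {X : CrossedProduct T} {M : C} {Z : C} {f f' : actObj X M ⟶ Z}
    (w : ∀ g, actι X M g ≫ f = actι X M g ≫ f') : f = f' :=
  biproduct.hom_ext' _ _ w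

lemma ι_actHom {X X' : CrossedProduct T} {M M' : C} (f : X ⟶ X') (f' : M ⟶ M') (g : G) :
    actι X M g ≫ actHom f f' = (f.app g ⊗ₘ (T.F g).map f') ≫ actι X' M' g := by
  dsimp only [actι, actHom]
  erw [biproduct.ι_map]
  rfl

noncomputable def actAssocHom (X Y : CrossedProduct T) (M : C) :
    actObj (tensorObj X Y) M ⟶ actObj X (actObj Y M) :=
  biproduct.desc fun m => sumDesc (tensorRight _)
    fun q => (T.hAssoc q.2 _ _ _).hom ≫
      X.comp q.1.1 ◁ (T.F q.1.1).map (actι Y M q.1.2) ≫ actι X (actObj Y M) q.1.1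

noncomputable def actAssocInv (X Y : CrossedProduct T) (M : C) :
    actObj X (actObj Y M) ⟶ actObj (tensorObj X Y) M :=
  biproduct.desc fun g => sumDesc (T.F g ⋙ tensorLeft (X.comp g))
    fun h => (T.hAssoc rfl _ _ _).inv ≫ ι X Y rfl ▷ _ ≫ actι (tensorObj X Y) M (g * h)

lemma ι_actAssocHom (X Y : CrossedProduct T) (M : C) {g h m : G} (e : g * h = m) :
    ι X Y e ▷ (T.F m).obj M ≫ actι (tensorObj X Y) M m ≫ actAssocHom X Y M =
      (T.hAssoc e _ _ _).hom ≫ X.comp g ◁ (T.F g).map (actι Y M h) ≫ actι X (actObj Y M) g := by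
  dsimp only [actAssocHom, actι]
  erw [biproduct.ι_desc]
  exact map_ι_sumDesc (tensorRight ((T.F m).obj M)) _
    (⟨(g, h), e⟩ : {p : G × G // p.1 * p.2 = m})

lemma ι_actAssocInv (X Y : CrossedProduct T) (M : C) {g h m : G} (e : g * h = m) :
    X.comp g ◁ (T.F g).map (actι Y M h) ≫ actι X (actObj Y M) g ≫ actAssocInv X Y M =
      (T.hAssoc e _ _ _).inv ≫ ι X Y e ▷ (T.F m).obj M ≫ actι (tensorObj X Y) M m := by
  subst e
  dsimp only [actAssocInv, actι]
  erw [biproduct.ι_desc]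
  exact map_ι_sumDesc (T.F g ⋙ tensorLeft (X.comp g)) _ h

lemma act_ext_left {X Y : CrossedProduct T} {M : C} {W : C}
    {f f' : actObj (tensorObj X Y) M ⟶ W}
    (w : ∀ g h m (e : g * h = m),
      ι X Y e ▷ (T.F m).obj M ≫ actι (tensorObj X Y) M m ≫ f =
        ι X Y e ▷ (T.F m).obj M ≫ actι (tensorObj X Y) M m ≫ f') : f = f' :=
  act_hom_ext' fun m => tensor_hom_ext (tensorRight _) fun g h e => w g h m e

lemma act_ext_right {X Y : CrossedProduct T} {M : C} {W : C}
    {f f' : actObj X (actObj Y M) ⟶ W}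
    (w : ∀ g h, X.comp g ◁ (T.F g).map (actι Y M h) ≫ actι X (actObj Y M) g ≫ f =
        X.comp g ◁ (T.F g).map (actι Y M h) ≫ actι X (actObj Y M) g ≫ f') : f = f' :=
  act_hom_ext' fun g => act_hom_ext (T.F g ⋙ tensorLeft _) fun h => w g h

/-- The associativity isomorphism `(X ⊗ Y) ▷ M ≅ X ▷ (Y ▷ M)`. -/
noncomputable def actAssoc (X Y : CrossedProduct T) (M : C) :
    actObj (tensorObj X Y) M ≅ actObj X (actObj Y M) where
  hom := actAssocHom X Y M
  inv := actAssocInv X Y M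
  hom_inv_id := by
    refine act_ext_left fun g h m e => ?_
    rw [reassoc_of% ι_actAssocHom X Y M e, ι_actAssocInv X Y M e]
    simp
  inv_hom_id := by
    refine act_ext_right fun g h => ?_
    rw [reassoc_of% ι_actAssocInv X Y M rfl, ι_actAssocHom X Y M rfl]
    simp

noncomputable def actUnitHom (M : C) : actObj (single (T := T) 1 (𝟙_ C)) M ⟶ M :=
  biproduct.desc fun g => sumDesc (tensorRight _)
    fun q : PLift (1 = g) => (T.hLeftUnitor q.down M).hom

lemma ι_actUnitHom (M : C) {g : G} (e : 1 = g) :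
    singleι 1 (𝟙_ C) e ▷ (T.F g).obj M ≫ actι (single 1 (𝟙_ C)) M g ≫ actUnitHom M =
      (T.hLeftUnitor e M).hom := by
  dsimp only [actUnitHom, actι]
  erw [biproduct.ι_desc]
  exact map_ι_sumDesc (tensorRight ((T.F g).obj M)) _ (⟨e⟩ : PLift (1 = g))

lemma actUnit_ext {M : C} {W : C} {f f' : actObj (single (T := T) 1 (𝟙_ C)) M ⟶ W}
    (w : singleι 1 (𝟙_ C) rfl ▷ (T.F 1).obj M ≫ actι (single 1 (𝟙_ C)) M 1 ≫ f =
      singleι 1 (𝟙_ C) rfl ▷ (T.F 1).obj M ≫ actι (single 1 (𝟙_ C)) M 1 ≫ f') : f = f' :=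
  act_hom_ext' fun g => single_ext (tensorRight _) fun e => by
    subst e
    exact w

/-- The unit isomorphism `𝟙 ▷ M ≅ M`. -/
noncomputable def actUnit (M : C) : actObj (single (T := T) 1 (𝟙_ C)) M ≅ M where
  hom := actUnitHom M
  inv := (T.hLeftUnitor rfl M).inv ≫ singleι 1 (𝟙_ C) rfl ▷ (T.F 1).obj M ≫
    actι (single 1 (𝟙_ C)) M 1
  hom_inv_id := by
    refine actUnit_ext ?_
    rw [reassoc_of% ι_actUnitHom M rfl]
    simp
  inv_hom_id := by
    rw [Category.assoc, Category.assoc, ι_actUnitHom M rfl]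
    simp

lemma actHom_id_id (X : CrossedProduct T) (M : C) : actHom (𝟙 X) (𝟙 M) = 𝟙 (actObj X M) := by
  refine act_hom_ext' fun g => ?_
  rw [ι_actHom]
  simp

lemma actHom_comp {X₁ X₂ X₃ : CrossedProduct T} {M₁ M₂ M₃ : C} (f₁ : X₁ ⟶ X₂) (f₂ : X₂ ⟶ X₃)
    (g₁ : M₁ ⟶ M₂) (g₂ : M₂ ⟶ M₃) :
    actHom (f₁ ≫ f₂) (g₁ ≫ g₂) = actHom f₁ g₁ ≫ actHom f₂ g₂ := by
  refine act_hom_ext' fun g => ?_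
  simp only [comp_app, ι_actHom, reassoc_of% ι_actHom, Functor.map_comp,
    tensorHom_comp_tensorHom_assoc]

lemma actAssoc_nat {X₁ X₂ Y₁ Y₂ : CrossedProduct T} {M₁ M₂ : C} (f : X₁ ⟶ X₂) (f' : Y₁ ⟶ Y₂)
    (f'' : M₁ ⟶ M₂) : actHom (tensorHom f f') f'' ≫ actAssocHom X₂ Y₂ M₂ =
      actAssocHom X₁ Y₁ M₁ ≫ actHom f (actHom f' f'') := by
  refine act_ext_left fun g h m e => ?_
  rw [reassoc_of% ι_actHom, reassoc_of% ι_actAssocHom X₁ Y₁ M₁ e, ι_actHom,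
    ← tensorHom_id, tensorHom_comp_tensorHom_assoc, ι_tensorHom, Category.id_comp]
  have h1 : (f.app g ⊗ₘ (T.F g).map (f'.app h)) ≫ ι X₂ Y₂ e ⊗ₘ (T.F m).map f'' =
      ((f.app g ⊗ₘ (T.F g).map (f'.app h)) ⊗ₘ (T.F m).map f'') ≫
        ι X₂ Y₂ e ▷ (T.F m).obj M₂ := by
    rw [← tensorHom_id, tensorHom_comp_tensorHom, Category.comp_id]
  rw [h1, Category.assoc, ι_actAssocHom X₂ Y₂ M₂ e, reassoc_of% T.hAssoc_nat e]
  rw [← id_tensorHom, ← id_tensorHom, tensorHom_comp_tensorHom_assoc,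
    tensorHom_comp_tensorHom_assoc, ← Functor.map_comp, ← Functor.map_comp, ι_actHom]
  simp only [Category.id_comp, Category.comp_id]

lemma actUnit_nat {M N : C} (f : M ⟶ N) :
    actUnitHom (T := T) M ≫ f = actHom (𝟙 (single 1 (𝟙_ C))) f ≫ actUnitHom N := by
  refine actUnit_ext ?_
  rw [reassoc_of% ι_actUnitHom M rfl, reassoc_of% ι_actHom, id_app, id_tensorHom,
    ← whisker_exchange_assoc, ι_actUnitHom N rfl, T.hLeftUnitor_nat]

lemma act_pentagon (X Y Z : CrossedProduct T) (M : C) :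
    actHom (assocHom X Y Z) (𝟙 M) ≫ actAssocHom X (tensorObj Y Z) M ≫
      actHom (𝟙 X) (actAssocHom Y Z M) =
    actAssocHom (tensorObj X Y) Z M ≫ actAssocHom X Y (actObj Z M) := by
  refine act_ext_left fun m l n e₂ => tensor_hom_ext (tensorRight _ ⋙ tensorRight _)
    fun g h e₁ => ?_
  have a1 : h * l = h * l := rfl
  have a2 : g * (h * l) = n := by rw [← mul_assoc, e₁, e₂]
  have L : (ι X Y e₁ ▷ (T.F m).obj (Z.comp l)) ▷ (T.F n).obj M ≫
      ι (tensorObj X Y) Z e₂ ▷ (T.F n).obj M ≫ actι (tensorObj (tensorObj X Y) Z) M n ≫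
      actHom (assocHom X Y Z) (𝟙 M) ≫ actAssocHom X (tensorObj Y Z) M ≫
      actHom (𝟙 X) (actAssocHom Y Z M) =
      (T.hAssoc e₁ _ _ _).hom ▷ _ ≫ (T.hAssoc a2 _ _ _).hom ≫
        X.comp g ◁ (T.F g).map ((T.hAssoc a1 _ _ _).hom) ≫
        X.comp g ◁ (T.F g).map (Y.comp h ◁ (T.F h).map (actι Z M l)) ≫
        X.comp g ◁ (T.F g).map (actι Y (actObj Z M) h) ≫ actι X _ g := by
    rw [reassoc_of% ι_actHom]
    simp only [CategoryTheory.Functor.map_id, tensorHom_id]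
    rw [← comp_whiskerRight_assoc, ← comp_whiskerRight_assoc]
    simp only [Category.assoc]
    rw [ι_assocHom X Y Z e₁ e₂ a1 a2]
    simp only [comp_whiskerRight, Category.assoc]
    rw [reassoc_of% ι_actAssocHom X (tensorObj Y Z) M a2,
      reassoc_of% T.hAssoc_nat_middle a2, ι_actHom]
    simp only [id_app, id_tensorHom]
    simp only [← MonoidalCategory.whiskerLeft_comp_assoc, ← Functor.map_comp]
    rw [ι_actAssocHom Y Z M a1]
  have R : (ι X Y e₁ ▷ (T.F m).obj (Z.comp l)) ▷ (T.F n).obj M ≫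
      ι (tensorObj X Y) Z e₂ ▷ (T.F n).obj M ≫ actι (tensorObj (tensorObj X Y) Z) M n ≫
      actAssocHom (tensorObj X Y) Z M ≫ actAssocHom X Y (actObj Z M) =
      (T.hAssoc e₁ _ _ _).hom ▷ _ ≫ (T.hAssoc a2 _ _ _).hom ≫
        X.comp g ◁ (T.F g).map ((T.hAssoc a1 _ _ _).hom) ≫
        X.comp g ◁ (T.F g).map (Y.comp h ◁ (T.F h).map (actι Z M l)) ≫
        X.comp g ◁ (T.F g).map (actι Y (actObj Z M) h) ≫ actι X _ g := by
    rw [reassoc_of% ι_actAssocHom (tensorObj X Y) Z M e₂, reassoc_of% T.hAssoc_nat_left e₂,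
      ← whisker_exchange_assoc, ι_actAssocHom X Y (actObj Z M) e₁,
      reassoc_of% T.hAssoc_nat_right e₁, reassoc_of% T.hAssoc_pentagon e₁ e₂ a1 a2]
  exact L.trans R.symm

lemma act_leftUnitor (X : CrossedProduct T) (M : C) :
    actHom (leftUnitorHom X) (𝟙 M) = actAssocHom (single 1 (𝟙_ C)) X M ≫ actUnitHom _ := by
  refine act_hom_ext' fun m => ?_
  refine tensor_hom_ext (tensorRight _) fun g h e' => ?_
  refine single_ext (tensorRight _ ⋙ tensorRight _) fun e => ?_
  subst e
  obtain rfl : h = m := by simpa using e'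
  have L : (singleι 1 (𝟙_ C) rfl ▷ (T.F 1).obj (X.comp h)) ▷ (T.F h).obj M ≫
      ι (single 1 (𝟙_ C)) X e' ▷ (T.F h).obj M ≫ actι _ M h ≫ actHom (leftUnitorHom X) (𝟙 M) =
      (T.hLeftUnitor rfl (X.comp h)).hom ▷ (T.F h).obj M ≫ actι X M h := by
    rw [ι_actHom, CategoryTheory.Functor.map_id, tensorHom_id]
    simp only [← comp_whiskerRight_assoc]
    rw [ι_leftUnitorHom X rfl e' rfl]
    simp [tr]
  have R : (singleι 1 (𝟙_ C) rfl ▷ (T.F 1).obj (X.comp h)) ▷ (T.F h).obj M ≫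
      ι (single 1 (𝟙_ C)) X e' ▷ (T.F h).obj M ≫ actι _ M h ≫
        actAssocHom (single 1 (𝟙_ C)) X M ≫ actUnitHom _ =
      (T.hLeftUnitor rfl (X.comp h)).hom ▷ (T.F h).obj M ≫ actι X M h := by
    rw [reassoc_of% ι_actAssocHom _ X M e', reassoc_of% T.hAssoc_nat_left, ← whisker_exchange_assoc,
      ι_actUnitHom _ rfl, T.hLeftUnitor_nat, reassoc_of% T.hLeftTriangle]
  exact L.trans R.symm

lemma act_rightUnitor (X : CrossedProduct T) (M : C) :
    actHom (rightUnitorHom X) (𝟙 M) =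
      actAssocHom X (single 1 (𝟙_ C)) M ≫ actHom (𝟙 X) (actUnitHom M) := by
  refine act_hom_ext' fun m => ?_
  refine tensor_hom_ext (tensorRight _) fun g h e₁ => ?_
  refine single_ext (T.F g ⋙ tensorLeft _ ⋙ tensorRight _) fun e => ?_
  subst e
  obtain rfl : g = m := by simpa using e₁
  have L : (X.comp g ◁ (T.F g).map (singleι 1 (𝟙_ C) rfl)) ▷ (T.F g).obj M ≫
      ι X (single 1 (𝟙_ C)) e₁ ▷ (T.F g).obj M ≫ actι (tensorObj X (single 1 (𝟙_ C))) M g ≫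
      actAssocHom X (single 1 (𝟙_ C)) M ≫ actHom (𝟙 X) (actUnitHom M) =
      (T.hRightUnitor g (X.comp g)).hom ▷ (T.F g).obj M ≫ actι X M g := by
    rw [reassoc_of% ι_actAssocHom X _ M e₁, ι_actHom, id_app, id_tensorHom,
      reassoc_of% T.hAssoc_nat_middle]
    simp only [← MonoidalCategory.whiskerLeft_comp_assoc, ← Functor.map_comp]
    rw [ι_actUnitHom M rfl, ← T.hTriangle e₁ rfl]
    simp
  have R : (X.comp g ◁ (T.F g).map (singleι 1 (𝟙_ C) rfl)) ▷ (T.F g).obj M ≫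
      ι X (single 1 (𝟙_ C)) e₁ ▷ (T.F g).obj M ≫ actι (tensorObj X (single 1 (𝟙_ C))) M g ≫
      actHom (rightUnitorHom X) (𝟙 M) =
      (T.hRightUnitor g (X.comp g)).hom ▷ (T.F g).obj M ≫ actι X M g := by
    rw [ι_actHom, CategoryTheory.Functor.map_id, tensorHom_id]
    simp only [← comp_whiskerRight_assoc]
    rw [ι_rightUnitorHom X rfl e₁ rfl]
    simp [tr]
  exact R.trans L.symm

open scoped MonoidalLeftAction in
noncomputable instance : MonoidalLeftActionStruct (CrossedProduct T) C where
  actionObj := actObj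
  actionHomLeft f M := actHom f (𝟙 M)
  actionHomRight X _ _ f := actHom (𝟙 X) f
  actionHom := actHom
  actionAssocIso := actAssoc
  actionUnitIso := actUnit

/-- The action of `C ⋊ G` on `C`. -/
noncomputable instance : MonoidalLeftAction (CrossedProduct T) C where
  actionHom_def {_ _ _ _} f f' := by
    change actHom f f' = actHom f (𝟙 _) ≫ actHom (𝟙 _) f'
    rw [← actHom_comp, Category.comp_id, Category.id_comp]
  actionHomRight_id := actHom_id_id
  id_actionHomLeft := actHom_id_id
  actionHom_comp f₁ f₂ g₁ g₂ := actHom_comp f₁ f₂ g₁ g₂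
  actionAssocIso_hom_naturality f f' f'' := actAssoc_nat f f' f''
  actionUnitIso_hom_naturality f := actUnit_nat f
  whiskerLeft_actionHomLeft X _ _ f M := by
    have := actAssoc_nat (𝟙 X) f (𝟙 M)
    change actHom (tensorHom (𝟙 X) f) (𝟙 M) = (actAssoc _ _ _).hom ≫
      actHom (𝟙 X) (actHom f (𝟙 M)) ≫ (actAssoc _ _ _).inv
    rw [← Category.assoc, Iso.eq_comp_inv]
    exact this
  whiskerRight_actionHomLeft Y f M := by
    have := actAssoc_nat f (𝟙 Y) (𝟙 M)
    change actHom (tensorHom f (𝟙 Y)) (𝟙 M) = (actAssoc _ _ _).hom ≫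
      actHom f (𝟙 (actObj Y M)) ≫ (actAssoc _ _ _).inv
    rw [← Category.assoc, Iso.eq_comp_inv, ← actHom_id_id]
    exact this
  associator_actionHom X Y Z M := act_pentagon X Y Z M
  leftUnitor_actionHom X M := act_leftUnitor X M
  rightUnitor_actionHom X M := act_rightUnitor X M

end CrossedProduct

namespace CrossedProduct

variable {k : Type*} [Field k] {G : Type*} [Group G] {C : Type*} [Category* C]
    [Abelian C] [Linear k C] [MonoidalCategory C] {T : TensorAction k G C}

/-- Morphisms of `C ⋊ G` as families; their addition is componentwise. -/
def homEquivPi (X Y : CrossedProduct T) : (X ⟶ Y) ≃ (∀ g, X.comp g ⟶ Y.comp g) where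
  toFun f := f.app
  invFun f := ⟨f⟩
  left_inv _ := rfl
  right_inv _ := rfl

instance (X Y : CrossedProduct T) : AddCommGroup (X ⟶ Y) := (homEquivPi X Y).addCommGroup

@[simp] lemma add_app {X Y : CrossedProduct T} (f f' : X ⟶ Y) (g : G) :
    (f + f').app g = f.app g + f'.app g := rfl

instance : Preadditive (CrossedProduct T) where
  add_comp _ _ _ _ _ _ := by ext; simp
  comp_add _ _ _ _ _ _ := by ext; simp

/-- Evaluation at a degree, on morphisms. -/
def appHom (X Y : CrossedProduct T) (g : G) : (X ⟶ Y) →+ (X.comp g ⟶ Y.comp g) where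
  toFun f := f.app g
  map_zero' := rfl
  map_add' _ _ := rfl

/-- Direct sums in `C ⋊ G` are computed componentwise. -/
noncomputable def sumBicone {J : Type*} [Finite J] (X : J → CrossedProduct T) : Bicone X where
  pt := ⟨fun g => ⨁ fun j => (X j).comp g⟩
  π j := ⟨fun g => biproduct.π (fun j => (X j).comp g) j⟩
  ι j := ⟨fun g => biproduct.ι (fun j => (X j).comp g) j⟩
  ι_π i j := by
    classical
    split_ifs with h
    · subst h
      ext g
      simp
    · ext g
      exact biproduct.ι_π_ne _ h

@[simp] lemma sum_app {X Y : CrossedProduct T} {J : Type*} (s : Finset J) (f : J → (X ⟶ Y))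
    (g : G) : (∑ j ∈ s, f j).app g = ∑ j ∈ s, (f j).app g :=
  map_sum (appHom X Y g) f s

instance : HasFiniteBiproducts (CrossedProduct T) where
  out n := ⟨fun X => hasBiproduct_of_total (sumBicone X) (by
    ext g
    rw [sum_app, id_app]
    exact biproduct.total)⟩

end CrossedProduct

section DualCategory
open MonoidalLeftAction Functor LaxLeftLinear OplaxLeftLinear

/-- A `k`-linear module endofunctor of the `𝒟`-module category `ℳ`; the structure isomorphisms
`F (X ▷ M) ⟶ X ▷ F M` are `δₗ F X M`. -/
structure ModuleEnd (k : Type*) [Field k] (𝒟 : Type*) [Category* 𝒟] [MonoidalCategory 𝒟]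
    (ℳ : Type*) [Category* ℳ] [Preadditive ℳ] [Linear k ℳ] [MonoidalLeftAction 𝒟 ℳ] where
  functor : ℳ ⥤ ℳ
  additive : functor.Additive
  linear : functor.Linear k
  leftLinear : functor.LeftLinear 𝒟

namespace ModuleEnd

attribute [instance] ModuleEnd.additive ModuleEnd.linear ModuleEnd.leftLinear

variable {k : Type*} [Field k] {𝒟 : Type*} [Category* 𝒟] [MonoidalCategory 𝒟]
    {ℳ : Type*} [Category* ℳ] [Preadditive ℳ] [Linear k ℳ] [MonoidalLeftAction 𝒟 ℳ]

/-- Natural module transformations. -/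
@[ext]
structure Hom (D D' : ModuleEnd k 𝒟 ℳ) where
  natTrans : D.functor ⟶ D'.functor
  comm (X : 𝒟) (M : ℳ) : natTrans.app (X ⊙ₗ M) ≫ δₗ D'.functor X M =
    δₗ D.functor X M ≫ X ⊴ₗ natTrans.app M

instance : Category (ModuleEnd k 𝒟 ℳ) where
  Hom D D' := Hom D D'
  id D := ⟨𝟙 D.functor, fun X M => by simp⟩
  comp f f' := ⟨f.natTrans ≫ f'.natTrans, fun X M => by
    rw [NatTrans.comp_app, NatTrans.comp_app, Category.assoc, f'.comm, ← Category.assoc, f.comm,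
      Category.assoc, ← actionHomRight_comp]⟩

@[ext]
lemma hom_ext {D D' : ModuleEnd k 𝒟 ℳ} {f f' : D ⟶ D'}
    (h : ∀ M, f.natTrans.app M = f'.natTrans.app M) : f = f' :=
  Hom.ext (NatTrans.ext (funext h))

@[simp] lemma id_natTrans (D : ModuleEnd k 𝒟 ℳ) : Hom.natTrans (𝟙 D) = 𝟙 D.functor := rfl
@[simp] lemma comp_natTrans {D D' D'' : ModuleEnd k 𝒟 ℳ} (f : D ⟶ D') (f' : D' ⟶ D'') :
    (f ≫ f').natTrans = f.natTrans ≫ f'.natTrans := rfl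

variable (k 𝒟 ℳ) in
/-- The functor underlying a module functor. -/
def forget : ModuleEnd k 𝒟 ℳ ⥤ (ℳ ⥤ ℳ) where
  obj D := D.functor
  map f := f.natTrans

lemma comm_μ {D D' : ModuleEnd k 𝒟 ℳ} (f : D ⟶ D') (X : 𝒟) (M : ℳ) :
    μₗ D.functor X M ≫ f.natTrans.app (X ⊙ₗ M) =
      X ⊴ₗ f.natTrans.app M ≫ μₗ D'.functor X M := by
  rw [← cancel_mono (δₗ D'.functor X M), Category.assoc, Category.assoc, f.comm]
  simp

variable (k 𝒟 ℳ) in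
/-- The identity module functor. -/
def unit : ModuleEnd k 𝒟 ℳ where
  functor := 𝟭 ℳ
  additive := inferInstance
  linear := inferInstance
  leftLinear :=
    { μₗ := fun X M => 𝟙 (X ⊙ₗ M)
      δₗ := fun X M => 𝟙 (X ⊙ₗ M)
      μₗ_comp_δₗ := by simp
      δₗ_comp_μₗ := by simp }

/-- The composition `D ∘ D'` of module functors. -/
def tensorObj (D D' : ModuleEnd k 𝒟 ℳ) : ModuleEnd k 𝒟 ℳ where
  functor := D'.functor ⋙ D.functor
  additive := inferInstance
  linear := inferInstance
  leftLinear :=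
    { μₗ := fun X M => μₗ D.functor X (D'.functor.obj M) ≫ D.functor.map (μₗ D'.functor X M)
      δₗ := fun X M => D.functor.map (δₗ D'.functor X M) ≫ δₗ D.functor X (D'.functor.obj M)
      μₗ_naturality_left := fun f M => by
        simp [← Functor.map_comp]
      μₗ_naturality_right := fun X _ _ f => by
        simp [← Functor.map_comp]
      μₗ_associativity := fun X Y M => by
        dsimp only [Functor.comp_obj, Functor.comp_map]
        rw [Category.assoc, ← Functor.map_comp, μₗ_associativity, Functor.map_comp,
          μₗ_associativity_assoc, Functor.map_comp, actionHomRight_comp, Category.assoc,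
          μₗ_naturality_right_assoc]
      μₗ_unitality := fun M => by
        simp [← Functor.map_comp]
      δₗ_naturality_left := fun f M => by
        dsimp only [Functor.comp_obj, Functor.comp_map]
        rw [← Functor.map_comp_assoc, δₗ_naturality_left, Functor.map_comp, Category.assoc,
          δₗ_naturality_left, Category.assoc]
      δₗ_naturality_right := fun X _ _ f => by
        dsimp only [Functor.comp_obj, Functor.comp_map]
        rw [← Functor.map_comp_assoc, δₗ_naturality_right, Functor.map_comp, Category.assoc,
          δₗ_naturality_right, Category.assoc]
      δₗ_associativity := fun X Y M => by
        dsimp only [Functor.comp_obj, Functor.comp_map]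
        rw [Category.assoc, δₗ_associativity, ← Functor.map_comp_assoc, δₗ_associativity,
          Functor.map_comp, Functor.map_comp, actionHomRight_comp]
        simp only [Category.assoc]
        rw [δₗ_naturality_right_assoc]
      δₗ_unitality_inv := fun M => by
        rw [Functor.comp_map, ← Functor.map_comp_assoc, ← δₗ_unitality_inv, ← δₗ_unitality_inv]
        rfl
      μₗ_comp_δₗ := fun X M => by
        rw [Category.assoc, ← Functor.map_comp_assoc, LeftLinear.μₗ_comp_δₗ]
        simp
      δₗ_comp_μₗ := fun X M => by
        rw [Category.assoc, LeftLinear.δₗ_comp_μₗ_assoc, ← Functor.map_comp,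
          LeftLinear.δₗ_comp_μₗ]
        simp }

lemma tensorObj_δ (D D' : ModuleEnd k 𝒟 ℳ) (X : 𝒟) (M : ℳ) :
    δₗ (tensorObj D D').functor X M =
      D.functor.map (δₗ D'.functor X M) ≫ δₗ D.functor X (D'.functor.obj M) := rfl

/-- `D ∘ f`. -/
def whiskerLeft (D : ModuleEnd k 𝒟 ℳ) {E E' : ModuleEnd k 𝒟 ℳ} (f : E ⟶ E') :
    tensorObj D E ⟶ tensorObj D E' where
  natTrans := Functor.whiskerRight f.natTrans D.functor
  comm X M := by
    rw [tensorObj_δ, tensorObj_δ]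
    change D.functor.map (f.natTrans.app (X ⊙ₗ M)) ≫ _ =
      _ ≫ X ⊴ₗ D.functor.map (f.natTrans.app M)
    rw [← Functor.map_comp_assoc, f.comm]
    simp

/-- `f ∘ E`. -/
def whiskerRight {D D' : ModuleEnd k 𝒟 ℳ} (f : D ⟶ D') (E : ModuleEnd k 𝒟 ℳ) :
    tensorObj D E ⟶ tensorObj D' E where
  natTrans := Functor.whiskerLeft E.functor f.natTrans
  comm X M := by
    rw [tensorObj_δ, tensorObj_δ]
    change f.natTrans.app (E.functor.obj (X ⊙ₗ M)) ≫ _ =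
      _ ≫ X ⊴ₗ f.natTrans.app (E.functor.obj M)
    rw [← Category.assoc, ← f.natTrans.naturality, Category.assoc, f.comm]
    simp

/-- An isomorphism of module functors from a compatible isomorphism of functors. -/
def isoOfEq (D D' : ModuleEnd k 𝒟 ℳ) (e : D.functor ≅ D'.functor)
    (h : ∀ (X : 𝒟) (M : ℳ), e.hom.app (X ⊙ₗ M) ≫ δₗ D'.functor X M =
      δₗ D.functor X M ≫ X ⊴ₗ e.hom.app M) : D ≅ D' where
  hom := ⟨e.hom, h⟩
  inv := ⟨e.inv, fun X M => by
    rw [← cancel_epi (e.hom.app (X ⊙ₗ M)), e.hom_inv_id_app_assoc, ← Category.assoc, h,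
      Category.assoc, ← actionHomRight_comp, e.hom_inv_id_app]
    simp⟩
  hom_inv_id := by ext; simp
  inv_hom_id := by ext; simp

lemma comp_id_aux {X : 𝒟} {A B : ℳ} (f f' : A ⟶ X ⊙ₗ B) (h : f = f') :
    𝟙 A ≫ f = f' ≫ X ⊴ₗ 𝟙 B := by
  simp [h]

instance : MonoidalCategoryStruct (ModuleEnd k 𝒟 ℳ) where
  tensorObj := tensorObj
  whiskerLeft D _ _ f := whiskerLeft D f
  whiskerRight f E := whiskerRight f E
  tensorUnit := unit k 𝒟 ℳ
  associator D D' D'' := isoOfEq (tensorObj (tensorObj D D') D'') (tensorObj D (tensorObj D' D''))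
    (Functor.associator _ _ _).symm (fun X M => comp_id_aux _ _ (by
      rw [tensorObj_δ, tensorObj_δ, tensorObj_δ, tensorObj_δ]
      exact (D.functor.map_comp_assoc _ _ _)))
  leftUnitor D := isoOfEq (tensorObj (unit k 𝒟 ℳ) D) D (Functor.rightUnitor _)
    (fun X M => comp_id_aux _ _ (Category.comp_id _).symm)
  rightUnitor D := isoOfEq (tensorObj D (unit k 𝒟 ℳ)) D (Functor.leftUnitor _)
    (fun X M => comp_id_aux _ _ (by
      rw [tensorObj_δ]
      erw [D.functor.map_id]
      exact (Category.id_comp _).symm))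

lemma whiskerLeft_app (D : ModuleEnd k 𝒟 ℳ) {E E' : ModuleEnd k 𝒟 ℳ} (f : E ⟶ E') (M : ℳ) :
    (D ◁ f).natTrans.app M = D.functor.map (f.natTrans.app M) := rfl

lemma whiskerRight_app {D D' : ModuleEnd k 𝒟 ℳ} (f : D ⟶ D') (E : ModuleEnd k 𝒟 ℳ) (M : ℳ) :
    (f ▷ E).natTrans.app M = f.natTrans.app (E.functor.obj M) := rfl

lemma associator_hom_app (D D' D'' : ModuleEnd k 𝒟 ℳ) (M : ℳ) :
    (α_ D D' D'').hom.natTrans.app M = 𝟙 (D.functor.obj (D'.functor.obj (D''.functor.obj M))) :=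
  rfl

lemma leftUnitor_hom_app (D : ModuleEnd k 𝒟 ℳ) (M : ℳ) :
    (λ_ D).hom.natTrans.app M = 𝟙 (D.functor.obj M) := rfl

lemma rightUnitor_hom_app (D : ModuleEnd k 𝒟 ℳ) (M : ℳ) :
    (ρ_ D).hom.natTrans.app M = 𝟙 (D.functor.obj M) := rfl

/-- The dual category: module endofunctors, with composition as tensor product. -/
instance : MonoidalCategory (ModuleEnd k 𝒟 ℳ) where
  tensorHom_def _ _ := rfl
  id_tensorHom_id D E := by
    ext M
    exact (Category.id_comp _).trans (D.functor.map_id _)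
  tensorHom_comp_tensorHom {D₁ D₂ D₃ E₁ E₂ E₃} f₁ f₂ g₁ g₂ := by
    ext M
    change (f₁.natTrans.app _ ≫ D₂.functor.map (f₂.natTrans.app M)) ≫
      g₁.natTrans.app _ ≫ D₃.functor.map (g₂.natTrans.app M) =
      (f₁.natTrans.app _ ≫ g₁.natTrans.app _) ≫ D₃.functor.map
        (f₂.natTrans.app M ≫ g₂.natTrans.app M)
    simp
  whiskerLeft_id D E := by
    ext M
    exact D.functor.map_id _
  id_whiskerRight D E := rfl
  associator_naturality {D₁ D₂ D₃ E₁ E₂ E₃} f₁ f₂ f₃ := by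
    ext M
    change ((f₁.natTrans.app _ ≫ E₁.functor.map (f₂.natTrans.app _)) ≫
      E₁.functor.map (E₂.functor.map (f₃.natTrans.app M))) ≫ 𝟙 _ =
      𝟙 _ ≫ f₁.natTrans.app _ ≫ E₁.functor.map (f₂.natTrans.app _ ≫
        E₂.functor.map (f₃.natTrans.app M))
    simp
  leftUnitor_naturality f := by
    ext M
    exact (Category.comp_id _).trans (Category.id_comp _).symm
  rightUnitor_naturality {D E} f := by
    ext M
    exact (Category.comp_id _).trans (Category.id_comp _).symm
  pentagon D₁ D₂ D₃ D₄ := by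
    ext M
    change 𝟙 _ ≫ 𝟙 _ ≫ D₁.functor.map (𝟙 _) = 𝟙 _ ≫ 𝟙 _
    simp
  triangle D E := by
    ext M
    change 𝟙 _ ≫ D.functor.map (𝟙 _) = 𝟙 _
    simp

/-- The action of the dual category on `ℳ` by evaluation. -/
instance : MonoidalLeftAction (ModuleEnd k 𝒟 ℳ) ℳ where
  actionObj D M := D.functor.obj M
  actionHomLeft f M := f.natTrans.app M
  actionHomRight D _ _ f := D.functor.map f
  actionAssocIso _ _ _ := Iso.refl _
  actionUnitIso _ := Iso.refl _
  actionAssocIso_hom_naturality {D D' E E' M M'} f f' φ := by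
    change ((f.natTrans.app _ ≫ D'.functor.map (f'.natTrans.app M)) ≫
      D'.functor.map (E'.functor.map φ)) ≫ 𝟙 _ =
      𝟙 _ ≫ f.natTrans.app _ ≫ D'.functor.map (f'.natTrans.app M ≫ E'.functor.map φ)
    simp
  actionUnitIso_hom_naturality f := (Category.id_comp f).trans (Category.comp_id f).symm
  whiskerLeft_actionHomLeft D _ _ f M :=
    ((Category.id_comp _).trans (Category.comp_id _)).symm
  whiskerRight_actionHomLeft E f M :=
    ((Category.id_comp _).trans (Category.comp_id _)).symm
  associator_actionHom D D' D'' M := by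
    change 𝟙 _ ≫ 𝟙 _ ≫ D.functor.map (𝟙 _) = 𝟙 _ ≫ 𝟙 _
    simp
  leftUnitor_actionHom D M := (Category.comp_id _).symm
  rightUnitor_actionHom D M :=
    ((Category.id_comp _).trans (D.functor.map_id M)).symm

end ModuleEnd
end DualCategory

section
open MonoidalLeftAction Functor

/-- A module functor structure given by invertible morphisms `F (X ▷ M) ⟶ X ▷ F M`. -/
abbrev leftLinearOfIso {𝒟 : Type*} [Category* 𝒟] [MonoidalCategory 𝒟]
    {ℳ : Type*} [Category* ℳ] [MonoidalLeftAction 𝒟 ℳ] (F : ℳ ⥤ ℳ)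
    (c : ∀ (X : 𝒟) (M : ℳ), F.obj (X ⊙ₗ M) ≅ X ⊙ₗ F.obj M)
    (naturality_left : ∀ {X X' : 𝒟} (f : X ⟶ X') (M : ℳ),
      F.map (f ⊵ₗ M) ≫ (c X' M).hom = (c X M).hom ≫ f ⊵ₗ F.obj M)
    (naturality_right : ∀ (X : 𝒟) {M M' : ℳ} (f : M ⟶ M'),
      F.map (X ⊴ₗ f) ≫ (c X M').hom = (c X M).hom ≫ X ⊴ₗ F.map f)
    (associativity : ∀ (X Y : 𝒟) (M : ℳ), (c (X ⊗ Y) M).hom ≫ (αₗ X Y (F.obj M)).hom =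
      F.map (αₗ X Y M).hom ≫ (c X (Y ⊙ₗ M)).hom ≫ X ⊴ₗ (c Y M).hom)
    (unitality : ∀ M : ℳ, (c (𝟙_ 𝒟) M).hom ≫ (λₗ[𝒟] (F.obj M)).hom = F.map (λₗ[𝒟] M).hom) :
    F.LeftLinear 𝒟 where
  δₗ X M := (c X M).hom
  μₗ X M := (c X M).inv
  δₗ_naturality_left := naturality_left
  δₗ_naturality_right := naturality_right
  δₗ_associativity := associativity
  δₗ_unitality_inv M := by
    rw [← cancel_mono (λₗ[𝒟] (F.obj M)).hom, Iso.inv_hom_id, Category.assoc, unitality,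
      ← F.map_comp]
    simp
  μₗ_naturality_left f M := by
    rw [Iso.eq_inv_comp, ← Category.assoc, ← naturality_left]
    simp
  μₗ_naturality_right X _ _ f := by
    rw [Iso.eq_inv_comp, ← Category.assoc, ← naturality_right]
    simp
  μₗ_associativity X Y M := by
    rw [Iso.inv_comp_eq, ← Category.assoc, associativity]
    simp [← actionHomRight_comp_assoc]
  μₗ_unitality M := by
    rw [Iso.eq_inv_comp, unitality]
  μₗ_comp_δₗ X M := (c X M).inv_hom_id
  δₗ_comp_μₗ X M := (c X M).hom_inv_id

end

/-- An object `W` of `C` with compatible isomorphisms `W ≅ F_g W`. -/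
structure EquivariantObj {k : Type*} [Field k] {G : Type*} [Group G] {C : Type*} [Category* C]
    [Abelian C] [Linear k C] [MonoidalCategory C] (T : TensorAction k G C) where
  obj : C
  s (g : G) : obj ≅ (T.F g).obj obj
  s_mul {g h m : G} (e : g * h = m) :
    (s m).hom ≫ T.cinv e obj = (s g).hom ≫ (T.F g).map (s h).hom
  s_one : (s 1).hom = T.unit.hom.app obj

namespace TensorAction

variable {k : Type*} [Field k] {G : Type*} [Group G] {C : Type*} [Category* C]
    [Abelian C] [Linear k C] [MonoidalCategory C] (T : TensorAction k G C)

open Functor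

/-- The isomorphism `(X ⊗ F_g M) ⊗ F_g Z ≅ X ⊗ F_g (M ⊗ Z)` given by the tensor structure. -/
def hμ (g : G) (X M Z : C) :
    (X ⊗ (T.F g).obj M) ⊗ (T.F g).obj Z ≅ X ⊗ (T.F g).obj (M ⊗ Z) :=
  α_ _ _ _ ≪≫ whiskerLeftIso X (Monoidal.μIso (T.F g) M Z)

lemma hμ_hom (g : G) (X M Z : C) : (T.hμ g X M Z).hom =
    (α_ _ _ _).hom ≫ X ◁ LaxMonoidal.μ (T.F g) M Z := rfl

lemma hμ_nat (g : G) {X X' M M' Z Z' : C} (f : X ⟶ X') (f' : M ⟶ M') (f'' : Z ⟶ Z') :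
    ((f ⊗ₘ (T.F g).map f') ⊗ₘ (T.F g).map f'') ≫ (T.hμ g X' M' Z').hom =
      (T.hμ g X M Z).hom ≫ (f ⊗ₘ (T.F g).map (f' ⊗ₘ f'')) := by
  simp [hμ_hom, ← id_tensorHom, tensorHom_comp_tensorHom]

lemma hAssoc_eq {g h m : G} (e : g * h = m) (X Y Z : C) :
    (T.hAssoc e X Y Z).hom = (X ⊗ (T.F g).obj Y) ◁ T.cinv e Z ≫
      (T.hμ g X Y ((T.F h).obj Z)).hom := by
  rw [hAssoc_hom', hμ_hom]
  simp

lemma hμ_assoc (g : G) (X Y B Z : C) :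
    (T.hμ g X Y B).hom ▷ (T.F g).obj Z ≫ (T.hμ g X (Y ⊗ B) Z).hom ≫
      X ◁ (T.F g).map (α_ Y B Z).hom =
    (α_ _ _ _).hom ≫ (X ⊗ (T.F g).obj Y) ◁ LaxMonoidal.μ (T.F g) B Z ≫
      (T.hμ g X Y (B ⊗ Z)).hom := by
  simp only [hμ_hom, Category.assoc]
  rw [associator_naturality_right_assoc, ← MonoidalCategory.whiskerLeft_comp,
    ← MonoidalCategory.whiskerLeft_comp]
  apply aux_assoc
  rw [LaxMonoidal.associativity]

end TensorAction

namespace EquivariantObj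

variable {k : Type*} [Field k] {G : Type*} [Group G] {C : Type*} [Category* C]
    [Abelian C] [Linear k C] [MonoidalCategory C] {T : TensorAction k G C}
    (W : EquivariantObj T)

open Functor

/-- `(X ⊗ F_g M) ⊗ W ≅ (X ⊗ F_g M) ⊗ F_g W ≅ X ⊗ F_g (M ⊗ W)`. -/
def r (g : G) (X M : C) :
    (X ⊗ (T.F g).obj M) ⊗ W.obj ≅ X ⊗ (T.F g).obj (M ⊗ W.obj) :=
  whiskerLeftIso _ (W.s g) ≪≫ T.hμ g X M W.obj

lemma r_hom (g : G) (X M : C) : (W.r g X M).hom =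
    (X ⊗ (T.F g).obj M) ◁ (W.s g).hom ≫ (T.hμ g X M W.obj).hom := rfl

lemma r_nat (g : G) {X X' M M' : C} (f : X ⟶ X') (f' : M ⟶ M') :
    (f ⊗ₘ (T.F g).map f') ▷ W.obj ≫ (W.r g X' M').hom =
      (W.r g X M).hom ≫ (f ⊗ₘ (T.F g).map (f' ▷ W.obj)) := by
  have := T.hμ_nat g f f' (𝟙 W.obj)
  rw [CategoryTheory.Functor.map_id, tensorHom_id, tensorHom_id] at this
  rw [r_hom, r_hom, ← whisker_exchange_assoc, this, Category.assoc]

lemma r_assoc {g h m : G} (e : g * h = m) (X Y M : C) :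
    (W.r m (X ⊗ (T.F g).obj Y) M).hom ≫ (T.hAssoc e X Y (M ⊗ W.obj)).hom =
      (T.hAssoc e X Y M).hom ▷ W.obj ≫ (W.r g X (Y ⊗ (T.F h).obj M)).hom ≫
        X ◁ (T.F g).map (W.r h Y M).hom := by
  have h1 := T.hμ_nat g (𝟙 X) (𝟙 Y) ((T.F h).obj M ◁ (W.s h).hom ≫ LaxMonoidal.μ (T.F h) M W.obj)
  rw [CategoryTheory.Functor.map_id, id_tensorHom_id, id_tensorHom, id_tensorHom,
    id_tensorHom] at h1
  have h2 : (T.F m).obj M ◁ (W.s m).hom ≫ LaxMonoidal.μ (T.F m) M W.obj ≫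
      T.cinv e (M ⊗ W.obj) = T.cinv e M ▷ W.obj ≫ (T.F g).obj ((T.F h).obj M) ◁ (W.s g).hom ≫
      LaxMonoidal.μ (T.F g) ((T.F h).obj M) W.obj ≫ (T.F g).map
        ((T.F h).obj M ◁ (W.s h).hom ≫ LaxMonoidal.μ (T.F h) M W.obj) := by
    rw [T.cinv_μ, ← id_tensorHom, tensorHom_comp_tensorHom_assoc, Category.id_comp, W.s_mul,
      Functor.map_comp, ← LaxMonoidal.μ_natural_right_assoc,
      ← MonoidalCategory.whiskerLeft_comp_assoc,
      ← tensorHom_id, ← id_tensorHom, tensorHom_comp_tensorHom_assoc]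
    simp
  have h3 := T.hμ_assoc g X Y ((T.F h).obj M) W.obj
  have hL : (W.r m (X ⊗ (T.F g).obj Y) M).hom ≫ (X ⊗ (T.F g).obj Y) ◁ T.cinv e (M ⊗ W.obj) =
      (α_ _ _ _).hom ≫ (X ⊗ (T.F g).obj Y) ◁ ((T.F m).obj M ◁ (W.s m).hom ≫
        LaxMonoidal.μ (T.F m) M W.obj ≫ T.cinv e (M ⊗ W.obj)) := by
    rw [r_hom, T.hμ_hom]
    simp
  have hR : (W.r h Y M).hom = (α_ _ _ _).hom ≫
      Y ◁ ((T.F h).obj M ◁ (W.s h).hom ≫ LaxMonoidal.μ (T.F h) M W.obj) := by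
    rw [r_hom, T.hμ_hom]
    simp
  rw [T.hAssoc_eq, T.hAssoc_eq, hR, ← Category.assoc, hL, h2, comp_whiskerRight]
  simp only [MonoidalCategory.whiskerLeft_comp, Functor.map_comp, Category.assoc]
  simp only [MonoidalCategory.whiskerLeft_comp, Functor.map_comp, Category.assoc] at h1
  rw [h1, r_hom, Category.assoc, ← whisker_exchange_assoc, reassoc_of% h3]
  simp

lemma r_unit (M : C) :
    (W.r 1 (𝟙_ C) M).hom ≫ (T.hLeftUnitor rfl (M ⊗ W.obj)).hom =
      (T.hLeftUnitor rfl M).hom ▷ W.obj := by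
  have h5 : LaxMonoidal.μ (T.F 1) M W.obj ≫ T.unit.inv.app (M ⊗ W.obj) =
      T.unit.inv.app M ⊗ₘ T.unit.inv.app W.obj := by
    have := NatTrans.IsMonoidal.tensor (τ := T.unit.inv) M W.obj
    exact this.trans (Category.comp_id _)
  simp only [r_hom, T.hμ_hom, TensorAction.hLeftUnitor, TensorAction.unitIso, Iso.trans_hom,
    Category.assoc, eqToIso_refl, Iso.trans_refl, Iso.symm_hom, Iso.app_hom,
    leftUnitor_naturality_assoc, W.s_one]
  have h6 : T.unit.hom.app W.obj ≫ T.unit.inv.app W.obj = 𝟙 _ := Iso.hom_inv_id_app _ _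
  rw [h5, tensorHom_def', associator_naturality_right_assoc, leftUnitor_naturality_assoc,
    ← MonoidalCategory.whiskerLeft_comp_assoc, h6]
  simp [-LaxMonoidal.left_unitality]

variable [Finite G] [MonoidalPreadditive C]

open CrossedProduct MonoidalLeftAction

/-- The isomorphism `(X ▷ M) ⊗ W ≅ X ▷ (M ⊗ W)`; on the summand of `X ▷ M` in degree `g` it is
`X_g ⊗ F_g M ⊗ W ≅ X_g ⊗ F_g M ⊗ F_g W ≅ X_g ⊗ F_g (M ⊗ W)`. -/
noncomputable def lineatorHom (X : CrossedProduct T) (M : C) :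
    actObj X M ⊗ W.obj ⟶ actObj X (M ⊗ W.obj) :=
  sumDesc (tensorRight W.obj) fun g => (W.r g (X.comp g) M).hom ≫ actι X (M ⊗ W.obj) g

noncomputable def lineatorInv (X : CrossedProduct T) (M : C) :
    actObj X (M ⊗ W.obj) ⟶ actObj X M ⊗ W.obj :=
  biproduct.desc fun g => (W.r g (X.comp g) M).inv ≫ actι X M g ▷ W.obj

lemma ι_lineatorHom (X : CrossedProduct T) (M : C) (g : G) :
    actι X M g ▷ W.obj ≫ W.lineatorHom X M =
      (W.r g (X.comp g) M).hom ≫ actι X (M ⊗ W.obj) g :=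
  map_ι_sumDesc (tensorRight W.obj) _ g

lemma ι_lineatorInv (X : CrossedProduct T) (M : C) (g : G) :
    actι X (M ⊗ W.obj) g ≫ W.lineatorInv X M =
      (W.r g (X.comp g) M).inv ≫ actι X M g ▷ W.obj :=
  biproduct.ι_desc _ _

lemma lineator_ext {X : CrossedProduct T} {M Z : C} {f f' : actObj X M ⊗ W.obj ⟶ Z}
    (w : ∀ g, actι X M g ▷ W.obj ≫ f = actι X M g ▷ W.obj ≫ f') : f = f' :=
  act_hom_ext (tensorRight W.obj) w

noncomputable def lineator (X : CrossedProduct T) (M : C) :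
    actObj X M ⊗ W.obj ≅ actObj X (M ⊗ W.obj) where
  hom := W.lineatorHom X M
  inv := W.lineatorInv X M
  hom_inv_id := by
    refine W.lineator_ext fun g => ?_
    rw [reassoc_of% W.ι_lineatorHom, ι_lineatorInv]
    simp
  inv_hom_id := by
    refine act_hom_ext' fun g => ?_
    rw [reassoc_of% W.ι_lineatorInv, ι_lineatorHom]
    simp

lemma lineator_nat {X X' : CrossedProduct T} {M M' : C} (f : X ⟶ X') (f' : M ⟶ M') :
    actHom f f' ▷ W.obj ≫ W.lineatorHom X' M' =
      W.lineatorHom X M ≫ actHom f (f' ▷ W.obj) := by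
  refine W.lineator_ext fun g => ?_
  rw [reassoc_of% W.ι_lineatorHom, ι_actHom, ← comp_whiskerRight_assoc, ι_actHom,
    comp_whiskerRight, Category.assoc, ι_lineatorHom, reassoc_of% W.r_nat]

lemma lineator_assoc (X Y : CrossedProduct T) (M : C) :
    W.lineatorHom (CrossedProduct.tensorObj X Y) M ≫ actAssocHom X Y (M ⊗ W.obj) =
      actAssocHom X Y M ▷ W.obj ≫ W.lineatorHom X (actObj Y M) ≫
        actHom (𝟙 X) (W.lineatorHom Y M) := by
  refine W.lineator_ext fun m => tensor_hom_ext (tensorRight _ ⋙ tensorRight _) fun g h e => ?_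
  have L : (ι X Y e ▷ (T.F m).obj M) ▷ W.obj ≫ actι (CrossedProduct.tensorObj X Y) M m ▷ W.obj ≫
      W.lineatorHom (CrossedProduct.tensorObj X Y) M ≫ actAssocHom X Y (M ⊗ W.obj) =
      (W.r m _ M).hom ≫ (T.hAssoc e _ _ _).hom ≫
        X.comp g ◁ (T.F g).map (actι Y (M ⊗ W.obj) h) ≫ actι X _ g := by
    have h1 := W.r_nat m (ι X Y e) (𝟙 M)
    simp only [CategoryTheory.Functor.map_id, tensorHom_id, id_whiskerRight] at h1
    rw [reassoc_of% W.ι_lineatorHom, reassoc_of% h1, ι_actAssocHom X Y _ e]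
  have R : (ι X Y e ▷ (T.F m).obj M) ▷ W.obj ≫ actι (CrossedProduct.tensorObj X Y) M m ▷ W.obj ≫
      actAssocHom X Y M ▷ W.obj ≫ W.lineatorHom X (actObj Y M) ≫
        actHom (𝟙 X) (W.lineatorHom Y M) =
      (W.r m _ M).hom ≫ (T.hAssoc e _ _ _).hom ≫
        X.comp g ◁ (T.F g).map (actι Y (M ⊗ W.obj) h) ≫ actι X _ g := by
    have h1 := W.r_nat g (𝟙 (X.comp g)) (actι Y M h)
    simp only [id_tensorHom] at h1
    rw [← comp_whiskerRight_assoc, ← comp_whiskerRight_assoc, Category.assoc,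
      ι_actAssocHom X Y M e]
    simp only [comp_whiskerRight, Category.assoc]
    rw [reassoc_of% W.ι_lineatorHom, ι_actHom, id_app, id_tensorHom, reassoc_of% h1,
      ← MonoidalCategory.whiskerLeft_comp_assoc, ← Functor.map_comp, ι_lineatorHom,
      Functor.map_comp, MonoidalCategory.whiskerLeft_comp, Category.assoc,
      reassoc_of% W.r_assoc e]
  exact L.trans R.symm

lemma lineator_unit (M : C) :
    W.lineatorHom (single 1 (𝟙_ C)) M ≫ actUnitHom (M ⊗ W.obj) = actUnitHom M ▷ W.obj := by
  refine W.lineator_ext fun g => single_ext (tensorRight _ ⋙ tensorRight _) fun e => ?_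
  subst e
  have L : (singleι 1 (𝟙_ C) rfl ▷ (T.F 1).obj M) ▷ W.obj ≫
      actι (single 1 (𝟙_ C)) M 1 ▷ W.obj ≫
      W.lineatorHom (single 1 (𝟙_ C)) M ≫ actUnitHom (M ⊗ W.obj) =
      (T.hLeftUnitor rfl M).hom ▷ W.obj := by
    have h1 := W.r_nat 1 (singleι (T := T) 1 (𝟙_ C) rfl) (𝟙 M)
    simp only [CategoryTheory.Functor.map_id, tensorHom_id, id_whiskerRight] at h1
    rw [reassoc_of% W.ι_lineatorHom, reassoc_of% h1, ι_actUnitHom _ rfl, W.r_unit]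
  have R : (singleι 1 (𝟙_ C) rfl ▷ (T.F 1).obj M) ▷ W.obj ≫
      actι (single 1 (𝟙_ C)) M 1 ▷ W.obj ≫ actUnitHom M ▷ W.obj =
      (T.hLeftUnitor rfl M).hom ▷ W.obj := by
    rw [← comp_whiskerRight, ← comp_whiskerRight, ι_actUnitHom _ rfl]
  exact L.trans R.symm

variable [MonoidalLinear k C]

/-- The module functor `M ↦ M ⊗ W`. -/
noncomputable def toModuleEnd : ModuleEnd k (CrossedProduct T) C where
  functor := tensorRight W.obj
  additive := inferInstance
  linear := inferInstance
  leftLinear := leftLinearOfIso (tensorRight W.obj) (fun X M => W.lineator X M)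
    (naturality_left := fun {X X'} f M => by
      have := W.lineator_nat f (𝟙 M)
      rw [id_whiskerRight] at this
      exact this)
    (naturality_right := fun X _ _ f => W.lineator_nat (𝟙 X) f)
    (associativity := W.lineator_assoc)
    (unitality := W.lineator_unit)

/-- The morphism of module functors `- ⊗ f` for a compatible morphism `f`. -/
def homToModuleEnd {W W' : EquivariantObj T} (f : W.obj ⟶ W'.obj)
    (hf : ∀ g, (W.s g).hom ≫ (T.F g).map f = f ≫ (W'.s g).hom) :
    W.toModuleEnd ⟶ W'.toModuleEnd where
  natTrans := (curriedTensor C).flip.map f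
  comm X M := by
    change actObj X M ◁ f ≫ W'.lineatorHom X M = W.lineatorHom X M ≫ actHom (𝟙 X) (M ◁ f)
    refine W.lineator_ext fun g => ?_
    have h1 := T.hμ_nat g (𝟙 (X.comp g)) (𝟙 M) f
    rw [CategoryTheory.Functor.map_id, id_tensorHom_id, id_tensorHom, id_tensorHom,
      id_tensorHom] at h1
    rw [reassoc_of% W.ι_lineatorHom, ι_actHom, id_app, id_tensorHom,
      ← whisker_exchange_assoc, ι_lineatorHom, r_hom, r_hom, Category.assoc, Category.assoc,
      ← reassoc_of% h1, ← MonoidalCategory.whiskerLeft_comp_assoc,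
      ← MonoidalCategory.whiskerLeft_comp_assoc, hf]

end EquivariantObj

section Copower

variable (k : Type*) [Field k] {C : Type*} [Category* C] [Abelian C] [Linear k C]
    (V : Type*) [AddCommGroup V] [Module k V] [Module.Finite k V]

/-- The object `V ▶ A` for a finite-dimensional vector space `V`, realised as a direct sum of
copies of `A` indexed by a basis of `V`; it represents `B ↦ Hom_k (V, Hom (A, B))`, see
`copower.existsUnique`. -/
noncomputable def copower (A : C) : C := ⨁ fun _ : Fin (Module.finrank k V) => A

namespace copower

/-- The universal linear map `V → Hom (A, V ▶ A)`. -/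
noncomputable def i (A : C) : V →ₗ[k] (A ⟶ copower k V A) :=
  (Module.finBasis k V).constr k fun j =>
    biproduct.ι (fun _ : Fin (Module.finrank k V) => A) j

lemma i_basis (A : C) (j : Fin (Module.finrank k V)) :
    i k V A (Module.finBasis k V j) =
      biproduct.ι (fun _ : Fin (Module.finrank k V) => A) j :=
  Module.Basis.constr_basis _ _ _ _

variable {k V} {D : Type*} [Category* D] [Abelian D] [Linear k D]

/-- The morphism out of `Φ (V ▶ A)` determined by a linear map `V → Hom (Φ A, B)`, for a linear
functor `Φ`. -/
noncomputable def mapDesc (Φ : C ⥤ D) {A : C} {B : D} (φ : V →ₗ[k] (Φ.obj A ⟶ B)) :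
    Φ.obj (copower k V A) ⟶ B :=
  sumDesc Φ fun j => φ (Module.finBasis k V j)

/-- The morphism out of `V ▶ A` determined by a linear map `V → Hom (A, B)`. -/
noncomputable def desc {A B : C} (φ : V →ₗ[k] (A ⟶ B)) : copower k V A ⟶ B :=
  mapDesc (𝟭 C) φ

lemma map_i_mapDesc (Φ : C ⥤ D) [Φ.Additive] [Φ.Linear k] {A : C} {B : D}
    (φ : V →ₗ[k] (Φ.obj A ⟶ B)) (v : V) : Φ.map (i k V A v) ≫ mapDesc Φ φ = φ v := by
  let ψ : V →ₗ[k] (Φ.obj A ⟶ B) :=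
    (Linear.rightComp k _ (mapDesc Φ φ)).comp ((Functor.mapLinearMap k Φ).comp (i k V A))
  have : ψ = φ := (Module.finBasis k V).ext fun j => by
    change Φ.map (i k V A (Module.finBasis k V j)) ≫ mapDesc Φ φ = _
    rw [i_basis]
    exact map_ι_sumDesc Φ _ j
  exact LinearMap.congr_fun this v

lemma i_desc {A B : C} (φ : V →ₗ[k] (A ⟶ B)) (v : V) : i k V A v ≫ desc φ = φ v :=
  map_i_mapDesc (𝟭 C) φ v

lemma map_hom_ext (Φ : C ⥤ D) [Φ.Additive] {A : C} {B : D}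
    {f f' : Φ.obj (copower k V A) ⟶ B}
    (h : ∀ v, Φ.map (i k V A v) ≫ f = Φ.map (i k V A v) ≫ f') : f = f' :=
  sum_hom_ext Φ fun j => by
    rw [← i_basis]
    exact h _

lemma hom_ext {A B : C} {f f' : copower k V A ⟶ B}
    (h : ∀ v, i k V A v ≫ f = i k V A v ≫ f') : f = f' :=
  map_hom_ext (𝟭 C) h

/-- The universal property `Hom (V ▶ A, B) ≅ Hom_k (V, Hom (A, B))`. -/
lemma existsUnique {A B : C} (φ : V →ₗ[k] (A ⟶ B)) :
    ∃! f : copower k V A ⟶ B, ∀ v, i k V A v ≫ f = φ v :=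
  ⟨desc φ, i_desc φ, fun _ h => hom_ext fun v => (h v).trans (i_desc φ v).symm⟩

/-- The morphism `f ▶ A` for a linear map `f`. -/
noncomputable def map {V' : Type*} [AddCommGroup V'] [Module k V'] [Module.Finite k V']
    (f : V →ₗ[k] V') (A : C) : copower k V A ⟶ copower k V' A :=
  desc ((i k V' A).comp f)

lemma i_map {V' : Type*} [AddCommGroup V'] [Module k V'] [Module.Finite k V']
    (f : V →ₗ[k] V') (A : C) (v : V) : i k V A v ≫ map f A = i k V' A (f v) :=
  i_desc _ _

end copower

end Copower

section RepInclusion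

open Functor

variable {k : Type*} [Field k] {G : Type*} [Group G] {C : Type*} [Category* C]
    [Abelian C] [Linear k C] [MonoidalCategory C] (T : TensorAction k G C)
    (N : Subgroup G) [N.Normal]

variable {N} in
/-- The isomorphism `s_g : V ▶ 𝟙 ≅ V ▶ F_g 𝟙 ≅ F_g (V ▶ 𝟙)` given by the action of `g` on `V`.
In order that these isomorphisms define a module functor, the left action of `g` on `V` has to be
turned into a right action, so `v` is sent to `g⁻¹ v`. -/
noncomputable def repIso (V : FDRep k (G ⧸ N)) (g : G) :
    copower k V (𝟙_ C) ≅ (T.F g).obj (copower k V (𝟙_ C)) where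
  hom := copower.desc ((Linear.leftComp k _ (LaxMonoidal.ε (T.F g))).comp
    ((Functor.mapLinearMap k (T.F g)).comp ((copower.i k V (𝟙_ C)).comp
      (V.ρ ((g : G ⧸ N)⁻¹)))))
  inv := copower.mapDesc (T.F g) ((Linear.leftComp k _ (OplaxMonoidal.η (T.F g))).comp
    ((copower.i k V (𝟙_ C)).comp (V.ρ (g : G ⧸ N))))
  hom_inv_id := copower.hom_ext fun v => by
    rw [← Category.assoc, copower.i_desc, Category.comp_id]
    change (LaxMonoidal.ε (T.F g) ≫ (T.F g).map (copower.i k V (𝟙_ C) _)) ≫ _ = _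
    rw [Category.assoc, copower.map_i_mapDesc]
    change LaxMonoidal.ε (T.F g) ≫ OplaxMonoidal.η (T.F g) ≫
      copower.i k V (𝟙_ C) ((V.ρ (g : G ⧸ N) * V.ρ ((g : G ⧸ N)⁻¹)) v) = _
    rw [← map_mul, mul_inv_cancel, map_one, Monoidal.ε_η_assoc]
    rfl
  inv_hom_id := copower.map_hom_ext _ fun v => by
    rw [← Category.assoc, copower.map_i_mapDesc, Category.comp_id]
    change (OplaxMonoidal.η (T.F g) ≫ copower.i k V (𝟙_ C) _) ≫ _ = _
    rw [Category.assoc, copower.i_desc]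
    change OplaxMonoidal.η (T.F g) ≫ LaxMonoidal.ε (T.F g) ≫ (T.F g).map
      (copower.i k V (𝟙_ C) ((V.ρ ((g : G ⧸ N)⁻¹) * V.ρ (g : G ⧸ N)) v)) = _
    rw [← map_mul, inv_mul_cancel, map_one, Monoidal.η_ε_assoc]
    rfl

variable {N} in
lemma i_repIso (V : FDRep k (G ⧸ N)) (g : G) (v : V) :
    copower.i k V (𝟙_ C) v ≫ (repIso T V g).hom = LaxMonoidal.ε (T.F g) ≫
      (T.F g).map (copower.i k V (𝟙_ C) (V.ρ ((g : G ⧸ N)⁻¹) v)) :=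
  copower.i_desc _ v

variable {N} in
/-- The object `V ▶ 𝟙` with the isomorphisms `s_g`. -/
noncomputable def repEquivariant (V : FDRep k (G ⧸ N)) : EquivariantObj T where
  obj := copower k V (𝟙_ C)
  s g := repIso T V g
  s_mul {g h m} e := copower.hom_ext fun v => by
    subst e
    have h1 := NatTrans.IsMonoidal.unit (τ := (T.comp (rfl : g * h = g * h)).inv)
    have h2 := (T.comp (rfl : g * h = g * h)).inv.naturality
      (copower.i k V (𝟙_ C) (V.ρ (((g * h : G) : G ⧸ N)⁻¹) v))
    have h3 : V.ρ ((h : G ⧸ N)⁻¹) (V.ρ ((g : G ⧸ N)⁻¹) v) =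
        V.ρ (((g * h : G) : G ⧸ N)⁻¹) v := by
      rw [QuotientGroup.mk_mul, mul_inv_rev, map_mul]
      rfl
    rw [reassoc_of% i_repIso, reassoc_of% i_repIso, ← Functor.map_comp, i_repIso, h3,
      TensorAction.cinv, h2, reassoc_of% h1]
    simp
  s_one := copower.hom_ext fun v => by
    have h1 := NatTrans.IsMonoidal.unit (τ := T.unit.hom)
    have h2 := T.unit.hom.naturality (copower.i k V (𝟙_ C) v)
    rw [i_repIso, QuotientGroup.mk_one, inv_one, map_one, ← h1, Category.assoc]
    exact (Category.id_comp _).trans h2.symm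

variable {N} in
/-- The linear map underlying a morphism of representations. -/
def repLin {V W : FDRep k (G ⧸ N)} (f : V ⟶ W) : V →ₗ[k] W := f.hom.hom.hom

variable {N} in
lemma repLin_comm {V W : FDRep k (G ⧸ N)} (f : V ⟶ W) (x : G ⧸ N) (v : V) :
    W.ρ x (repLin f v) = repLin f (V.ρ x v) := by
  have h := f.comm x
  have h' := congrArg (fun q => q.hom.hom v) h
  exact h'.symm

variable {N} in
lemma repMap_comm {V W : FDRep k (G ⧸ N)} (f : V ⟶ W) (g : G) :
    (repIso T V g).hom ≫ (T.F g).map (copower.map (repLin f) (𝟙_ C)) =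
      copower.map (repLin f) (𝟙_ C) ≫ (repIso T W g).hom :=
  copower.hom_ext fun v => by
    rw [reassoc_of% i_repIso, reassoc_of% copower.i_map, i_repIso, ← Functor.map_comp,
      copower.i_map, repLin_comm]

variable [Finite G] [MonoidalPreadditive C] [MonoidalLinear k C]

/-- The functor `V ↦ L_V`, where `L_V (Y) = Y ⊗ (V ▶ 𝟙)`, from `Rep (G / N)` to the dual category
of `C ⋊ G` with respect to `C`. -/
noncomputable def repFunctor : FDRep k (G ⧸ N) ⥤ ModuleEnd k (CrossedProduct T) C where
  obj V := (repEquivariant T V).toModuleEnd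
  map f := EquivariantObj.homToModuleEnd (copower.map (repLin f) (𝟙_ C)) (repMap_comm T f)
  map_id V := by
    ext M
    have : copower.map (repLin (𝟙 V)) (𝟙_ C) = 𝟙 _ := copower.hom_ext fun v => by
      rw [copower.i_map, Category.comp_id]
      rfl
    change M ◁ copower.map (repLin (𝟙 V)) (𝟙_ C) = 𝟙 _
    rw [this]
    exact MonoidalCategory.whiskerLeft_id _ _
  map_comp f f' := by
    ext M
    have : copower.map (repLin (f ≫ f')) (𝟙_ C) = copower.map (repLin f) (𝟙_ C) ≫
        copower.map (repLin f') (𝟙_ C) := copower.hom_ext fun v => by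
      rw [copower.i_map, reassoc_of% copower.i_map, copower.i_map]
      rfl
    change M ◁ copower.map (repLin (f ≫ f')) (𝟙_ C) = M ◁ copower.map (repLin f) (𝟙_ C) ≫
      M ◁ copower.map (repLin f') (𝟙_ C)
    rw [this, MonoidalCategory.whiskerLeft_comp]

end RepInclusion

section RelativeEnd

open MonoidalLeftAction Opposite

variable {𝒯 : Type*} [Category* 𝒯] [MonoidalCategory 𝒯] {ℳ : Type*} [Category* ℳ]
    [MonoidalLeftAction 𝒯 ℳ] {𝒜 : Type*} [Category* 𝒜]

/-- A family of morphisms `β^X_{M,N} : S (M, X ▷ N) ⟶ S (X^* ▷ M, N)`, where `X` runs over the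
objects of `𝒯` that satisfy `P`, and `X^*` over the duals of `X` with evaluation `X^* ⊗ X ⟶ 𝟙`. -/
abbrev Prebalancing (P : ObjectProperty 𝒯) (S : ℳᵒᵖ ⥤ ℳ ⥤ 𝒜) :=
  ∀ (X X' : 𝒯) [ExactPairing X X'] (_ : P X) (M N : ℳ),
    (S.obj (op M)).obj (X ⊙ₗ N) ⟶ (S.obj (op (X' ⊙ₗ M))).obj N

variable {P : ObjectProperty 𝒯} {S : ℳᵒᵖ ⥤ ℳ ⥤ 𝒜}

/-- A dinatural transformation `π_M : E ⟶ S (M, M)` is compatible with `β` if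
`S (ev_X ▷ M, M) π_M = S (m_{X^*,X,M}, M) β^X_{X ▷ M, M} π_{X ▷ M}`. -/
def IsCompatible (β : Prebalancing P S) (w : Wedge S) : Prop :=
  ∀ (X X' : 𝒯) [ExactPairing X X'] (hX : P X) (M : ℳ),
    w.ι M ≫ (S.map ((ExactPairing.evaluation X X' ⊵ₗ M) ≫ (λₗ[𝒯] M).hom).op).app M =
      w.ι (X ⊙ₗ M : ℳ) ≫ β X X' hX (X ⊙ₗ M) M ≫ (S.map (αₗ X' X M).hom.op).app M

/-- `w` is a relative end of `(S, β)`: it is compatible with `β` and universal with this property. -/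
def IsRelativeEnd (β : Prebalancing P S) (w : Wedge S) : Prop :=
  IsCompatible β w ∧ ∀ w' : Wedge S, IsCompatible β w' →
    ∃! h : w'.pt ⟶ w.pt, ∀ M, h ≫ w.ι M = w'.ι M

end RelativeEnd

section RelativeAdjoint

open MonoidalLeftAction Opposite Functor LaxLeftLinear

variable {k : Type*} [Field k] {𝒟 : Type*} [Category* 𝒟] [MonoidalCategory 𝒟]
    {ℳ : Type*} [Category* ℳ] [Preadditive ℳ] [Linear k ℳ] [MonoidalLeftAction 𝒟 ℳ]

variable (𝒟 ℳ) in
/-- An internal Hom `H (M, N)` of the `𝒟`-module category `ℳ`: natural bijections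
`Hom (X ▷ M, N) ≅ Hom (X, H (M, N))`. -/
abbrev InternalHom (H : ℳᵒᵖ ⥤ ℳ ⥤ 𝒟) := (curriedAction 𝒟 ℳ).flip ⊣₂ H

variable {H : ℳᵒᵖ ⥤ ℳ ⥤ 𝒟}

/-- The evaluation `H (M, N) ▷ M ⟶ N`. -/
def InternalHom.ev (adj : InternalHom 𝒟 ℳ H) (M N : ℳ) :
    (H.obj (op M)).obj N ⊙ₗ M ⟶ N :=
  adj.homEquiv.symm (𝟙 ((H.obj (op M)).obj N))

/-- For a module functor `D` with left dual `D'` (so `D'` is left adjoint to `D`), the morphism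
`H (M, D N) ⟶ H (D' M, N)` which corresponds to the composition
`H (M, D N) ▷ D' M ⟶ D' (H (M, D N) ▷ M) ⟶ D' (D N) ⟶ N`. -/
def InternalHom.ξ (adj : InternalHom 𝒟 ℳ H) (P : ObjectProperty (ModuleEnd k 𝒟 ℳ)) :
    Prebalancing P H :=
  fun D D' _ _ M N => adj.homEquiv
    (μₗ D'.functor ((H.obj (op M)).obj (D.functor.obj N)) M ≫
      D'.functor.map (adj.ev M (D.functor.obj N)) ≫
      (ExactPairing.evaluation D D').natTrans.app N)

/-- `w` is a relative adjoint of `(P, ℳ)`: a relative end of the internal Hom, with respect to the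
full subcategory of the dual category given by `P`. -/
def IsRelativeAdjoint (P : ObjectProperty (ModuleEnd k 𝒟 ℳ)) (adj : InternalHom 𝒟 ℳ H)
    (w : Wedge H) : Prop :=
  IsRelativeEnd (adj.ξ P) w

end RelativeAdjoint

section AdjointObjects

open Opposite

variable {k : Type*} [Field k] {G : Type*} [Group G] {C : Type*} [Category* C]
    [Abelian C] [Linear k C] [MonoidalCategory C] [RightRigidCategory C] (T : TensorAction k G C)

/-- The functor `(X, Y) ↦ Y ⊗ F_g (X)^*`. -/
def twistedHom (g : G) : Cᵒᵖ ⥤ C ⥤ C where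
  obj X := tensorRight ((T.F g).obj X.unop)ᘁ
  map f := (curriedTensor C).flip.map (((T.F g).map f.unop)ᘁ)
  map_id X := by
    rw [unop_id, CategoryTheory.Functor.map_id, rightAdjointMate_id]
    exact (curriedTensor C).flip.map_id _
  map_comp f f' := by
    rw [unop_comp, CategoryTheory.Functor.map_comp, comp_rightAdjointMate]
    exact (curriedTensor C).flip.map_comp _ _

end AdjointObjects

section MainObjects

open Opposite

variable {k : Type*} [Field k] {G : Type*} [Group G] [Finite G] {C : Type*} [Category* C]
    [Abelian C] [Linear k C] [MonoidalCategory C] [RightRigidCategory C] (T : TensorAction k G C)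

/-- `A(N, C) = ⨁_{n ∈ N} [A_n, n]`, where `A_n = ∫_X X ⊗ F_n (X)^*`. -/
noncomputable def adjointSum [∀ g, HasEnd (twistedHom T g)] (N : Subgroup G) :
    CrossedProduct T :=
  ⨁ fun n : N => CrossedProduct.single (n : G) (end_ (twistedHom T (n : G)))

end MainObjects

/-- The finiteness conditions in the definition of a finite tensor category over `k`, and simplicity
of the unit object. -/
structure IsFiniteTensor (k : Type*) [Field k] (C : Type*) [Category* C] [Abelian C] [Linear k C]
    [MonoidalCategory C] : Prop where
  finite_hom (X Y : C) : Module.Finite k (X ⟶ Y)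
  artinian (X : C) : IsArtinianObject X
  noetherian (X : C) : IsNoetherianObject X
  enoughProjectives : EnoughProjectives C
  finite_simple : ∃ (n : ℕ) (S : Fin n → C), ∀ X : C, Simple X → ∃ i, Nonempty (X ≅ S i)
  simple_unit : Simple (𝟙_ C)

/-! By the adjunction that defines the internal Hom, a dinatural family from `E` to the internal
Homs of `M` with itself is the same as a natural family `E ▷ M ⟶ M`. Since `E ▷ M` is the sum of the
`E_g ⊗ F_g M`, this is one natural transformation β^g from `E_g ⊗ F_g (-)` to the identity for each
`g`. Duality turns β^g into a wedge with values in `M ⊗ (F_g M)^*`, so the end `A_g` carries the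
universal family in degree `g`.

Compatibility with ξ^D unwinds, by the adjunction between `D^*` and `D`, to the condition that the
family commutes with `D` (`InternalHom.compatible_iff`). For `D = L_V` the module structure acts in
degree `g` by `g⁻¹` on `V`. The condition therefore says that β^g_M followed by the map `M ⟶ M ⊗ (V
▶ 𝟙)` belonging to `g⁻¹ v` equals β^g_M followed by the map belonging to `v`
(`commutes_repFunctor_iff`). An element of `N` acts trivially on `V`, so nothing is required of it.
If `g` is not in `N`, a faithful representation of `G / N` has a vector with `g⁻¹ v ≠ v`; the map
belonging to the nonzero vector `g⁻¹ v - v` is split, and β^g vanishes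
(`component_eq_zero_of_commutes`). So the compatible families are those supported on `N`, and the
sum of the `[A_n, n]` represents them (`existsUnique_adjointWedge`). Compatibility is tested only on
functors that have a dual; `L_V` has one, because `Rep (G / N)` is rigid and `V ↦ L_V` is strong
monoidal.

The ends exist because `C` has a separator `Q`. A natural family on `Z` is determined by its
component at `Q`, hence by a map from `Z` to the noetherian object `Q ⊗ (F_g Q)^*`; a maximal
subobject that carries a family is universal (`exists_isUniversalFamily`).

Full faithfulness of `V ↦ L_V` has two sources: a module transformation between functors `- ⊗ W` is
determined by its component at `𝟙` (`EquivariantObj.exists_eq_whiskerLeft`), and Schur's lemma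
identifies `Hom (𝟙, V ▶ 𝟙)` with `V`. -/

set_option linter.unusedSectionVars false

/-! ### A separator in a finite tensor category. -/

section Separator

variable {k : Type*} [Field k] {C : Type*} [Category* C] [Abelian C] [Linear k C]
  [MonoidalCategory C]

/-- In a finite tensor category the sum of projective covers of the simple objects separates. -/
lemma IsFiniteTensor.exists_isSeparator (hC : IsFiniteTensor k C) : ∃ Q : C, IsSeparator Q := by
  obtain ⟨n, S, hS⟩ := hC.finite_simple
  have := hC.enoughProjectives
  refine ⟨⨁ fun i => Projective.over (S i), (Preadditive.isSeparator_iff _).2 ?_⟩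
  intro X Y f hf
  by_contra hne
  have hI : ¬ IsZero (image f) := fun h => hne <| by
    rw [← image.fac f, h.eq_of_src (image.ι f) 0, comp_zero]
  have := hC.artinian (image f)
  obtain ⟨Z, hZ⟩ := exists_simple_subobject hI
  obtain ⟨i, ⟨e⟩⟩ := hS _ hZ
  -- If the image of `f` is nonzero, it contains a simple object, which is covered by one of the
  -- projectives. The cover lifts along the epimorphism from `X` to the image, which gives a map
  -- from the sum of projectives to `X` that `f` does not kill.
  let q : Projective.over (S i) ⟶ image f := Projective.π (S i) ≫ e.inv ≫ Z.arrow
  let l : Projective.over (S i) ⟶ X := Projective.factorThru q (factorThruImage f)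
  have hl : l ≫ factorThruImage f = q := Projective.factorThru_comp _ _
  have h1 := hf (biproduct.π _ i ≫ l)
  rw [← image.fac f, Category.assoc, reassoc_of% hl] at h1
  have h2 : q ≫ image.ι f = 0 := by
    have := biproduct.ι _ i ≫= h1
    simpa using this
  have h3 : Z.arrow = 0 := by
    rw [← cancel_epi e.inv, ← cancel_epi (Projective.π (S i)), ← cancel_mono (image.ι f)]
    simpa [q] using h2
  have := id_nonzero (Z : C)
  apply this
  rw [← cancel_mono Z.arrow, h3]
  simp

end Separator

/-! ### Natural families `Z ⊗ F M ⟶ M` and the existence of a universal one. -/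

section NaturalFamilies

variable {C : Type*} [Category* C] [MonoidalCategory C]

/-- The natural family `Z ⊗ F M ⟶ Z' ⊗ F M ⟶ M` obtained from `Z' ⊗ F M ⟶ M` and `Z ⟶ Z'`. -/
@[simps]
def natPre {F : C ⥤ C} {Z Z' : C} (h : Z ⟶ Z') (α : F ⋙ tensorLeft Z' ⟶ 𝟭 C) :
    F ⋙ tensorLeft Z ⟶ 𝟭 C where
  app M := h ▷ F.obj M ≫ α.app M
  naturality M M' f := by
    have := α.naturality f
    dsimp at this ⊢
    rw [whisker_exchange_assoc, this, Category.assoc]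

lemma natPre_comp {F : C ⥤ C} {Z Z' Z'' : C} (h : Z ⟶ Z') (h' : Z' ⟶ Z'')
    (α : F ⋙ tensorLeft Z'' ⟶ 𝟭 C) : natPre (h ≫ h') α = natPre h (natPre h' α) := by
  ext M
  simp

variable [Abelian C] [RigidCategory C]

/-- Duals provide the right adjoints. These instances serve to preserve epimorphisms and to apply
the separator below a tensor product. -/
instance (Z : C) : (tensorLeft Z).IsLeftAdjoint := (tensorLeftAdjunction (ᘁZ) Z).isLeftAdjoint

instance (Z : C) : (tensorRight Z).IsLeftAdjoint := (tensorRightAdjunction Z Zᘁ).isLeftAdjoint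

/-- The right adjoint moves the comparison to maps out of `X`, where `Q` separates. -/
lemma hom_ext_of_isSeparator {C : Type*} [Category* C] {Q : C} (hQ : IsSeparator Q) (Φ : C ⥤ C)
    [Φ.IsLeftAdjoint] {X Y : C} {u v : Φ.obj X ⟶ Y} (h : ∀ f : Q ⟶ X, Φ.map f ≫ u = Φ.map f ≫ v) :
    u = v := by
  let adj := Adjunction.ofIsLeftAdjoint Φ
  apply (adj.homEquiv _ _).injective
  refine hQ.def _ _ fun f => ?_
  rw [← adj.homEquiv_naturality_left, h, adj.homEquiv_naturality_left]

/-- By naturality, the component at `X` restricted along `Φ f`, for `f : Q ⟶ X`, is governed by the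
component at `Q`. -/
lemma natTrans_ext_of_isSeparator {C : Type*} [Category* C] {Q : C} (hQ : IsSeparator Q)
    {Φ : C ⥤ C} [Φ.IsLeftAdjoint] {α β : Φ ⟶ 𝟭 C} (h : α.app Q = β.app Q) : α = β := by
  ext X
  refine hom_ext_of_isSeparator hQ Φ fun f => ?_
  rw [α.naturality, β.naturality, h]

variable (F : C ⥤ C)

/-- The morphism `Z ⟶ Q ⊗ (F Q)ᘁ` corresponding to the component at `Q` of a natural family. -/
def natMate (Q : C) {Z : C} (α : F ⋙ tensorLeft Z ⟶ 𝟭 C) : Z ⟶ Q ⊗ (F.obj Q)ᘁ :=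
  tensorRightHomEquiv Z (F.obj Q) (F.obj Q)ᘁ Q (α.app Q)

variable {F}

lemma natMate_natPre (Q : C) {Z Z' : C} (h : Z ⟶ Z') (α : F ⋙ tensorLeft Z' ⟶ 𝟭 C) :
    natMate F Q (natPre h α) = h ≫ natMate F Q α := by
  apply (tensorRightHomEquiv Z (F.obj Q) (F.obj Q)ᘁ Q).symm.injective
  rw [tensorRightHomEquiv_symm_naturality]
  simp [natMate]

/-- Families on `Z` thus form a subset of `Hom (Z, Q ⊗ (F Q)ᘁ)`, functorially in `Z`. The universal
family will be a subobject of `Q ⊗ (F Q)ᘁ` representing this subfunctor. -/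
lemma natMate_injective [F.IsLeftAdjoint] {Q : C} (hQ : IsSeparator Q) {Z : C}
    {α β : F ⋙ tensorLeft Z ⟶ 𝟭 C} (h : natMate F Q α = natMate F Q β) : α = β :=
  natTrans_ext_of_isSeparator hQ ((tensorRightHomEquiv _ _ _ _).injective h)

/-- The kernel of `e` kills the mate at `Q`, hence by injectivity the mates at all `M`; so every
component descends along `e`. -/
lemma exists_natPre_of_epi [F.IsLeftAdjoint] {Q : C} (hQ : IsSeparator Q) {Z I : C}
    (α : F ⋙ tensorLeft Z ⟶ 𝟭 C) (e : Z ⟶ I) [Epi e] (m : I ⟶ Q ⊗ (F.obj Q)ᘁ)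
    (hm : e ≫ m = natMate F Q α) : ∃ β : F ⋙ tensorLeft I ⟶ 𝟭 C, natPre e β = α := by
  -- `natPre 0 α` plays the role of the zero family: all its mates are visibly zero.
  have h0 : natPre (kernel.ι e) α = natPre 0 α := natMate_injective hQ <| by
    rw [natMate_natPre, natMate_natPre, ← hm, kernel.condition_assoc, zero_comp, zero_comp]
  have h1 : ∀ M, kernel.ι e ≫ natMate F M α = 0 := fun M => by
    rw [← natMate_natPre, h0, natMate_natPre, zero_comp]
  let b : ∀ M, I ⊗ F.obj M ⟶ M := fun M =>
    (tensorRightHomEquiv I (F.obj M) (F.obj M)ᘁ M).symm (Abelian.epiDesc e _ (h1 M))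
  have hb : ∀ M, e ▷ F.obj M ≫ b M = α.app M := fun M => by
    rw [← tensorRightHomEquiv_symm_naturality, Abelian.comp_epiDesc]
    exact Equiv.symm_apply_apply _ _
  -- Naturality of the descended family may be checked after precomposition with these epimorphisms.
  have he : ∀ X, Epi (e ▷ X) := fun X => inferInstanceAs (Epi ((tensorRight X).map e))
  refine ⟨⟨b, fun M M' f => ?_⟩, ?_⟩
  · rw [← cancel_epi (e ▷ F.obj M)]
    have := α.naturality f
    dsimp at this ⊢
    rw [← whisker_exchange_assoc, hb, this, reassoc_of% hb]
  · ext M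
    exact hb M

/-- A universal natural family `A ⊗ F M ⟶ M`; it corresponds to the end `∫_M M ⊗ (F M)ᘁ`. -/
def IsUniversalFamily {A : C} (α : F ⋙ tensorLeft A ⟶ 𝟭 C) : Prop :=
  ∀ (Z : C) (β : F ⋙ tensorLeft Z ⟶ 𝟭 C), ∃! h : Z ⟶ A, natPre h α = β

variable [MonoidalPreadditive C]

/-- Among the subobjects of `Q ⊗ (F Q)ᘁ` whose inclusion is the mate of a family there is a maximal
one. Images of mates belong to this set, so maximality forces every mate to factor through that
subobject. -/
lemma exists_isUniversalFamily [F.IsLeftAdjoint] {Q : C} (hQ : IsSeparator Q)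
    [IsNoetherianObject (Q ⊗ (F.obj Q)ᘁ)] :
    ∃ (A : C) (α : F ⋙ tensorLeft A ⟶ 𝟭 C), IsUniversalFamily α := by
  let 𝒮 : Set (Subobject (Q ⊗ (F.obj Q)ᘁ)) :=
    {s | ∃ α : F ⋙ tensorLeft (s : C) ⟶ 𝟭 C, natMate F Q α = s.arrow}
  have image_mem : ∀ (Z : C) (α : F ⋙ tensorLeft Z ⟶ 𝟭 C),
      ∃ s ∈ 𝒮, s.Factors (natMate F Q α) := fun Z α => by
    obtain ⟨β, hβ⟩ := exists_natPre_of_epi hQ α (factorThruImageSubobject (natMate F Q α))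
      (imageSubobject (natMate F Q α)).arrow (imageSubobject_arrow_comp _)
    refine ⟨imageSubobject (natMate F Q α), ⟨β, ?_⟩, ?_⟩
    · rw [← cancel_epi (factorThruImageSubobject (natMate F Q α)), ← natMate_natPre, hβ,
        imageSubobject_arrow_comp]
    · exact (Subobject.factors_iff _ _).2 ⟨_, imageSubobject_arrow_comp _⟩
  -- Any family shows that the set is nonempty; the zero family on `Q` will do.
  obtain ⟨s₀, hs₀, -⟩ := image_mem Q 0
  obtain ⟨s, ⟨α, hα⟩, hmax⟩ := WellFounded.has_min
    (wellFounded_gt : WellFounded (α := Subobject (Q ⊗ (F.obj Q)ᘁ)) (· > ·)) 𝒮 ⟨s₀, hs₀⟩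
  refine ⟨s, α, fun Z β => ?_⟩
  have hf : s.Factors (natMate F Q β) := by
    -- The image of the mate of this joint family contains both `s` and the image of the mate of
    -- `β`. By maximality it equals `s`.
    let γ : F ⋙ tensorLeft ((s : C) ⊞ Z) ⟶ 𝟭 C := natPre biprod.fst α + natPre biprod.snd β
    obtain ⟨t, ht, htf⟩ := image_mem _ γ
    have h1 : natPre biprod.inl γ = α := by ext M; simp [γ, ← comp_whiskerRight_assoc]
    have h2 : natPre biprod.inr γ = β := by ext M; simp [γ, ← comp_whiskerRight_assoc]
    have hle : s ≤ t := Subobject.le_of_comm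
      (biprod.inl ≫ t.factorThru _ htf) (by
        rw [Category.assoc, Subobject.factorThru_arrow, ← natMate_natPre, h1, hα])
    have hst : s = t := by
      by_contra hne
      exact hmax t ht (lt_of_le_of_ne hle hne)
    subst hst
    rw [← h2, natMate_natPre]
    exact Subobject.factors_of_factors_right _ htf
  refine ⟨s.factorThru _ hf, natMate_injective hQ ?_, fun h hh => ?_⟩
  · rw [natMate_natPre, hα, Subobject.factorThru_arrow]
  · rw [← cancel_mono s.arrow, Subobject.factorThru_arrow, ← hh, natMate_natPre, hα]

end NaturalFamilies

/-! ### The ends `A_g` as universal natural families. -/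

section Ends

open Opposite

/-- Naturality in the dualised variable; it rests on the dinaturality of the coevaluation. -/
lemma tensorRightHomEquiv_whiskerLeft_comp {C : Type*} [Category* C] [MonoidalCategory C]
    {X Y Z W : C} [HasRightDual X] [HasRightDual Y] (φ : X ⟶ Y) (u : Z ⊗ Y ⟶ W) :
    tensorRightHomEquiv Z X Xᘁ W (Z ◁ φ ≫ u) = tensorRightHomEquiv Z Y Yᘁ W u ≫ W ◁ φᘁ := by
  dsimp [tensorRightHomEquiv]
  simp only [comp_whiskerRight, Category.assoc]
  rw [← whisker_exchange, ← associator_inv_naturality_right_assoc,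
    ← MonoidalCategory.whiskerLeft_comp_assoc, coevaluation_comp_rightAdjointMate,
    MonoidalCategory.whiskerLeft_comp_assoc, associator_inv_naturality_middle_assoc]

variable {k : Type*} [Field k] {G : Type*} [Group G] {C : Type*} [Category* C]
    [Abelian C] [Linear k C] [MonoidalCategory C]

/-- The inverse is `F_{g⁻¹}`. The arguments with a separator need `F_g` to be a left adjoint; later
also its faithfulness is used. -/
instance (T : TensorAction k G C) (g : G) : (T.F g).IsEquivalence :=
  (CategoryTheory.Equivalence.mk (T.F g) (T.F g⁻¹)
    (T.unit ≪≫ (T.comp (inv_mul_cancel g)).symm)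
    (T.comp (mul_inv_cancel g) ≪≫ T.unit.symm)).isEquivalence_functor

variable [RightRigidCategory C] (T : TensorAction k G C) (g : G)

/-- The bijection `Hom (Z ⊗ F_g M, M') ≃ Hom (Z, M' ⊗ (F_g M)ᘁ)`. -/
def twistedHomEquiv (Z M M' : C) :
    (Z ⊗ (T.F g).obj M ⟶ M') ≃ (Z ⟶ ((twistedHom T g).obj (op M)).obj M') :=
  tensorRightHomEquiv Z ((T.F g).obj M) ((T.F g).obj M)ᘁ M'

variable {T g}

lemma twistedHomEquiv_comp {Z M M' M'' : C} (u : Z ⊗ (T.F g).obj M ⟶ M') (f : M' ⟶ M'') :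
    twistedHomEquiv T g Z M M'' (u ≫ f) =
      twistedHomEquiv T g Z M M' u ≫ ((twistedHom T g).obj (op M)).map f :=
  tensorRightHomEquiv_naturality u f

lemma twistedHomEquiv_map_comp {Z M M' M'' : C} (f : M ⟶ M') (u : Z ⊗ (T.F g).obj M' ⟶ M'') :
    twistedHomEquiv T g Z M M'' (Z ◁ (T.F g).map f ≫ u) =
      twistedHomEquiv T g Z M' M'' u ≫ ((twistedHom T g).map f.op).app M'' :=
  tensorRightHomEquiv_whiskerLeft_comp _ u

lemma twistedHomEquiv_whiskerRight_comp {Z Z' M M' : C} (h : Z ⟶ Z')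
    (u : Z' ⊗ (T.F g).obj M ⟶ M') :
    twistedHomEquiv T g Z M M' (h ▷ (T.F g).obj M ≫ u) = h ≫ twistedHomEquiv T g Z' M M' u := by
  apply (twistedHomEquiv T g Z M M').symm.injective
  refine (Equiv.symm_apply_apply _ _).trans
    (Eq.trans ?_ (tensorRightHomEquiv_symm_naturality h _).symm)
  exact congrArg _ ((twistedHomEquiv T g Z' M M').symm_apply_apply u).symm

/-- The dictionary between wedges and families: dinaturality of the transposes is naturality of the
family. -/
lemma twistedHom_condition_iff {Z : C} (b : ∀ M, Z ⊗ (T.F g).obj M ⟶ M) {M M' : C} (f : M ⟶ M') :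
    twistedHomEquiv T g Z M M (b M) ≫ ((twistedHom T g).obj (op M)).map f =
      twistedHomEquiv T g Z M' M' (b M') ≫ ((twistedHom T g).map f.op).app M' ↔
    Z ◁ (T.F g).map f ≫ b M' = b M ≫ f := by
  rw [← twistedHomEquiv_comp, ← twistedHomEquiv_map_comp, Equiv.apply_eq_iff_eq, eq_comm]

/-- The natural family which corresponds to a wedge. -/
@[simps]
def familyOfWedge {Z : C} (π : ∀ M, Z ⟶ ((twistedHom T g).obj (op M)).obj M)
    (hπ : ∀ ⦃M M' : C⦄ (f : M ⟶ M'), π M ≫ ((twistedHom T g).obj (op M)).map f =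
      π M' ≫ ((twistedHom T g).map f.op).app M') : T.F g ⋙ tensorLeft Z ⟶ 𝟭 C where
  app M := (twistedHomEquiv T g Z M M).symm (π M)
  naturality M M' f := (twistedHom_condition_iff
    (fun M => (twistedHomEquiv T g Z M M).symm (π M)) f).1 (by
      simpa only [Equiv.apply_symm_apply] using hπ f)

lemma natPre_eq_iff {Z A : C} (h : Z ⟶ A) (α : T.F g ⋙ tensorLeft A ⟶ 𝟭 C)
    (β : T.F g ⋙ tensorLeft Z ⟶ 𝟭 C) : natPre h α = β ↔
      ∀ M, h ≫ twistedHomEquiv T g A M M (α.app M) = twistedHomEquiv T g Z M M (β.app M) := by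
  rw [NatTrans.ext_iff, funext_iff]
  refine forall_congr' fun M => ?_
  rw [← twistedHomEquiv_whiskerRight_comp]
  exact (Equiv.apply_eq_iff_eq _).symm

lemma hasEnd_twistedHom {A : C} {α : T.F g ⋙ tensorLeft A ⟶ 𝟭 C} (hα : IsUniversalFamily α) :
    HasEnd (twistedHom T g) := by
  let w : Wedge (twistedHom T g) := Wedge.mk A (fun M => twistedHomEquiv T g A M M (α.app M))
    fun M M' f => (twistedHom_condition_iff α.app f).2 (α.naturality f)
  let β : ∀ w' : Wedge (twistedHom T g), T.F g ⋙ tensorLeft w'.pt ⟶ 𝟭 C := fun w' =>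
    familyOfWedge w'.ι fun _ _ f => w'.condition f
  have key : ∀ (w' : Wedge (twistedHom T g)) (h : w'.pt ⟶ A),
      (∀ M, h ≫ twistedHomEquiv T g A M M (α.app M) = w'.ι M) ↔ natPre h α = β w' :=
    fun w' h => by
      rw [natPre_eq_iff]
      refine forall_congr' fun M => Eq.congr_right ?_
      exact ((twistedHomEquiv T g w'.pt M M).apply_symm_apply (w'.ι M)).symm
  have hw : IsLimit w := Multifork.IsLimit.mk _
    (fun w' => (hα _ (β w')).choose)
    (fun w' => (key w' _).2 (hα _ (β w')).choose_spec.1)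
    (fun w' m hm => (hα _ (β w')).choose_spec.2 _ ((key w' m).1 hm))
  exact ⟨⟨w, hw⟩⟩

variable (T g)

/-- The natural family given by the projections of `∫_M M ⊗ (F_g M)ᘁ`. -/
noncomputable def endFamily [HasEnd (twistedHom T g)] :
    T.F g ⋙ tensorLeft (end_ (twistedHom T g)) ⟶ 𝟭 C :=
  familyOfWedge (end_.π (twistedHom T g)) fun _ _ f => end_.condition (twistedHom T g) f

/-- The converse of `hasEnd_twistedHom`: the universal property is needed for the chosen end `end_`,
which occurs in `adjointSum`, and not only for the object constructed above. -/
lemma isUniversalFamily_endFamily [HasEnd (twistedHom T g)] :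
    IsUniversalFamily (endFamily T g) := fun Z β => by
  simp only [natPre_eq_iff, endFamily, familyOfWedge_app, Equiv.apply_symm_apply]
  have hl := end_.lift_π (F := twistedHom T g) (fun M => twistedHomEquiv T g Z M M (β.app M))
    fun M M' f => (twistedHom_condition_iff β.app f).2 (β.naturality f)
  exact ⟨_, hl, fun h hh => end_.hom_ext fun M => (hh M).trans (hl M).symm⟩

end Ends

lemma IsFiniteTensor.hasEnd_twistedHom {k : Type*} [Field k] {C : Type*} [Category* C] [Abelian C]
    [Linear k C] [MonoidalCategory C] [MonoidalPreadditive C] [RigidCategory C]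
    (hC : IsFiniteTensor k C) {G : Type*} [Group G] (T : TensorAction k G C) (g : G) :
    HasEnd (twistedHom T g) := by
  obtain ⟨Q, hQ⟩ := hC.exists_isSeparator
  have := hC.noetherian (Q ⊗ ((T.F g).obj Q)ᘁ)
  obtain ⟨A, α, hα⟩ := exists_isUniversalFamily (F := T.F g) hQ
  exact _root_.hasEnd_twistedHom hα

/-! ### Existence of the internal Hom. -/

section InternalHom

open Opposite CrossedProduct

variable {k : Type*} [Field k] {G : Type*} [Group G] {C : Type*} [Category* C]
    [Abelian C] [Linear k C] [MonoidalCategory C] [RightRigidCategory C] (T : TensorAction k G C)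

/-- The internal Hom `(M, M') ↦ ⨁_g [M' ⊗ (F_g M)ᘁ, g]` of the `C ⋊ G`-module category `C`. -/
def crossedHom : Cᵒᵖ ⥤ C ⥤ CrossedProduct T where
  obj M :=
    { obj := fun M' => ⟨fun g => ((twistedHom T g).obj M).obj M'⟩
      map := fun f => ⟨fun g => ((twistedHom T g).obj M).map f⟩
      map_id := fun M' => CrossedProduct.hom_ext fun g => ((twistedHom T g).obj M).map_id M'
      map_comp := fun f f' => CrossedProduct.hom_ext fun g =>
        ((twistedHom T g).obj M).map_comp f f' }
  map φ :=
    { app := fun M' => ⟨fun g => ((twistedHom T g).map φ).app M'⟩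
      naturality := fun _ _ f => CrossedProduct.hom_ext fun g =>
        ((twistedHom T g).map φ).naturality f }
  map_id M := NatTrans.ext <| funext fun M' => CrossedProduct.hom_ext fun g =>
    NatTrans.congr_app ((twistedHom T g).map_id M) M'
  map_comp φ ψ := NatTrans.ext <| funext fun M' => CrossedProduct.hom_ext fun g =>
    NatTrans.congr_app ((twistedHom T g).map_comp φ ψ) M'

variable [Finite G] [MonoidalPreadditive C]

/-- The morphism out of `X ▷ M` with given components. -/
noncomputable def CrossedProduct.actDesc {T : TensorAction k G C} {X : CrossedProduct T} {M Z : C}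
    (f : ∀ g, X.comp g ⊗ (T.F g).obj M ⟶ Z) : actObj X M ⟶ Z :=
  biproduct.desc f

lemma CrossedProduct.actι_actDesc {T : TensorAction k G C} {X : CrossedProduct T} {M Z : C}
    (f : ∀ g, X.comp g ⊗ (T.F g).obj M ⟶ Z) (g : G) : actι X M g ≫ actDesc f = f g :=
  biproduct.ι_desc _ _

/-- The bijection `Hom (X ▷ M, M') ≃ Hom (X, ⨁_g [M' ⊗ (F_g M)ᘁ, g])`. -/
noncomputable def crossedHomEquiv (X : CrossedProduct T) (M M' : C) :
    (actObj X M ⟶ M') ≃ (X ⟶ ((crossedHom T).obj (op M)).obj M') where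
  toFun f := ⟨fun g => twistedHomEquiv T g _ M M' (actι X M g ≫ f)⟩
  invFun u := actDesc fun g => (twistedHomEquiv T g _ M M').symm (u.app g)
  left_inv f := act_hom_ext' fun g => (actι_actDesc _ _).trans (Equiv.symm_apply_apply _ _)
  right_inv u := CrossedProduct.hom_ext fun g => by
    change twistedHomEquiv T g _ M M' (actι X M g ≫ actDesc _) = u.app g
    rw [actι_actDesc]
    exact Equiv.apply_symm_apply _ _

variable {T}

lemma crossedHomEquiv_app {X : CrossedProduct T} {M M' : C} (f : actObj X M ⟶ M') (g : G) :
    (crossedHomEquiv T X M M' f).app g = twistedHomEquiv T g _ M M' (actι X M g ≫ f) := rfl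

/-- Here and in the next two lemmas, naturality in each of the three variables is checked degree by
degree and reduces to that of `twistedHomEquiv`. -/
lemma crossedHomEquiv_actHom_left {X X' : CrossedProduct T} {M M' : C} (h : X ⟶ X')
    (v : actObj X' M ⟶ M') :
    crossedHomEquiv T X M M' (actHom h (𝟙 M) ≫ v) = h ≫ crossedHomEquiv T X' M M' v :=
  CrossedProduct.hom_ext fun g => by
    rw [crossedHomEquiv_app, reassoc_of% ι_actHom, CategoryTheory.Functor.map_id, tensorHom_id,
      twistedHomEquiv_whiskerRight_comp]
    rfl

lemma crossedHomEquiv_actHom_right {X : CrossedProduct T} {M M' M'' : C} (f : M ⟶ M')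
    (v : actObj X M' ⟶ M'') : crossedHomEquiv T X M M'' (actHom (𝟙 X) f ≫ v) =
      crossedHomEquiv T X M' M'' v ≫ ((crossedHom T).map f.op).app M'' :=
  CrossedProduct.hom_ext fun g => by
    rw [crossedHomEquiv_app, reassoc_of% ι_actHom, id_app, id_tensorHom]
    exact twistedHomEquiv_map_comp f _

lemma crossedHomEquiv_comp {X : CrossedProduct T} {M M' M'' : C} (v : actObj X M ⟶ M')
    (f : M' ⟶ M'') : crossedHomEquiv T X M M'' (v ≫ f) =
      crossedHomEquiv T X M M' v ≫ ((crossedHom T).obj (op M)).map f :=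
  CrossedProduct.hom_ext fun g => by
    rw [crossedHomEquiv_app, ← Category.assoc]
    exact twistedHomEquiv_comp _ f

variable (T)

/-- `crossedHom` is an internal Hom. -/
noncomputable def crossedHomAdjunction : InternalHom (CrossedProduct T) C (crossedHom T) :=
  ParametrizedAdjunction.mk'
    (fun M => Adjunction.mkOfHomEquiv
      { homEquiv := fun X M' => crossedHomEquiv T X M M'
        homEquiv_naturality_left_symm := fun {X X' M'} h u => by
          refine (Equiv.symm_apply_eq (crossedHomEquiv T X M M')).2 (Eq.trans ?_ (crossedHomEquiv_actHom_left h _).symm)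
          exact congrArg (h ≫ ·) ((crossedHomEquiv T X' M M').apply_symm_apply u).symm
        homEquiv_naturality_right := fun v f => crossedHomEquiv_comp v f })
    (fun f _ _ v => by
      simp only [Adjunction.mkOfHomEquiv_homEquiv]
      exact crossedHomEquiv_actHom_right f v)

end InternalHom

/-! ### Dual pairs of module functors, and compatibility as commutation. -/

section ModuleEnd

open MonoidalLeftAction Opposite Functor LaxLeftLinear

variable {k : Type*} [Field k] {𝒟 : Type*} [Category* 𝒟] [MonoidalCategory 𝒟]
    {ℳ : Type*} [Category* ℳ] [Preadditive ℳ] [Linear k ℳ] [MonoidalLeftAction 𝒟 ℳ]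

namespace ModuleEnd

variable (D D' : ModuleEnd k 𝒟 ℳ) [ExactPairing D D']

/-- The component `D' (D M) ⟶ M` of the evaluation of a dual pair of module functors. -/
def evApp (M : ℳ) : D'.functor.obj (D.functor.obj M) ⟶ M :=
  (ExactPairing.evaluation D D').natTrans.app M

/-- The component `M ⟶ D (D' M)` of the coevaluation of a dual pair of module functors. -/
def coevApp (M : ℳ) : M ⟶ D.functor.obj (D'.functor.obj M) :=
  (ExactPairing.coevaluation D D').natTrans.app M

lemma evApp_naturality {M N : ℳ} (f : M ⟶ N) :
    D'.functor.map (D.functor.map f) ≫ evApp D D' N = evApp D D' M ≫ f :=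
  (ExactPairing.evaluation D D').natTrans.naturality f

lemma coevApp_naturality {M N : ℳ} (f : M ⟶ N) :
    f ≫ coevApp D D' N = coevApp D D' M ≫ D.functor.map (D'.functor.map f) :=
  (ExactPairing.coevaluation D D').natTrans.naturality f

/-- One of the two triangle identities of `D' ⊣ D`; the unitors and associators of the dual category
have identity components and drop out. -/
lemma coevApp_evApp (M : ℳ) :
    coevApp D D' (D.functor.obj M) ≫ D.functor.map (evApp D D' M) = 𝟙 (D.functor.obj M) := by
  have h := congrArg (fun f => f.natTrans.app M) (ExactPairing.evaluation_coevaluation D D')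
  change coevApp D D' (D.functor.obj M) ≫ 𝟙 _ ≫ D.functor.map (evApp D D' M) = 𝟙 _ ≫ 𝟙 _ at h
  simpa using h

/-- The map `x ↦ D' x ≫ ev` is the bijection `Hom (Y, D M) ≃ Hom (D' Y, M)` of the adjunction, and
its left inverse is built from the coevaluation. It allows `D'` to be removed from the compatibility
condition. -/
lemma map_comp_evApp_injective {Y M : ℳ} {x y : Y ⟶ D.functor.obj M}
    (h : D'.functor.map x ≫ evApp D D' M = D'.functor.map y ≫ evApp D D' M) : x = y := by
  have key : ∀ z : Y ⟶ D.functor.obj M,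
      coevApp D D' Y ≫ D.functor.map (D'.functor.map z ≫ evApp D D' M) = z := fun z => by
    rw [Functor.map_comp, ← reassoc_of% coevApp_naturality, coevApp_evApp, Category.comp_id]
  rw [← key x, h, key]

/-- The evaluation is a module transformation from `D' ∘ D` to the identity, whose module structure
is trivial. -/
lemma μ_evApp (X : 𝒟) (M : ℳ) :
    μₗ D'.functor X (D.functor.obj M) ≫ D'.functor.map (μₗ D.functor X M) ≫ evApp D D' (X ⊙ₗ M) =
      X ⊴ₗ evApp D D' M := by
  have h := comm_μ (ExactPairing.evaluation D D') X M
  rw [← Category.assoc]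
  exact h.trans (Category.comp_id _)

end ModuleEnd

namespace InternalHom

variable {H : ℳᵒᵖ ⥤ ℳ ⥤ 𝒟} (adj : InternalHom 𝒟 ℳ H)

/-- The bijection `Hom (X ▷ M, N) ≃ Hom (X, H (M, N))`. -/
def equiv (X : 𝒟) (M N : ℳ) : (X ⊙ₗ M ⟶ N) ≃ (X ⟶ (H.obj (op M)).obj N) :=
  adj.homEquiv

variable {adj}

lemma equiv_actionHomLeft {X X' : 𝒟} (h : X ⟶ X') {M N : ℳ} (v : X' ⊙ₗ M ⟶ N) :
    equiv adj X M N (h ⊵ₗ M ≫ v) = h ≫ equiv adj X' M N v :=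
  adj.homEquiv_naturality_two h v

lemma equiv_actionHomRight {X : 𝒟} {M M' N : ℳ} (f : M ⟶ M') (v : X ⊙ₗ M' ⟶ N) :
    equiv adj X M N (X ⊴ₗ f ≫ v) = equiv adj X M' N v ≫ (H.map f.op).app N :=
  adj.homEquiv_naturality_one f v

lemma equiv_comp {X : 𝒟} {M N N' : ℳ} (v : X ⊙ₗ M ⟶ N) (f : N ⟶ N') :
    equiv adj X M N' (v ≫ f) = equiv adj X M N v ≫ (H.obj (op M)).map f :=
  adj.homEquiv_naturality_three f v

/-- The evaluation is the counit of the adjunction. -/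
lemma equiv_ev (X : 𝒟) {M N : ℳ} (u : X ⟶ (H.obj (op M)).obj N) :
    u ⊵ₗ M ≫ adj.ev M N = (equiv adj X M N).symm u := by
  rw [Equiv.eq_symm_apply, equiv_actionHomLeft]
  exact (congrArg (u ≫ ·) (Equiv.apply_symm_apply _ _)).trans (Category.comp_id _)

/-- The dictionary for an arbitrary internal Hom: a wedge over `H` is a natural family `E ▷ M ⟶ M`.
Everything below is phrased in such families, so no particular `H` matters. -/
lemma wedge_condition_iff {E : 𝒟} (a : ∀ M : ℳ, E ⊙ₗ M ⟶ M) {M M' : ℳ} (f : M ⟶ M') :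
    equiv adj E M M (a M) ≫ (H.obj (op M)).map f =
      equiv adj E M' M' (a M') ≫ (H.map f.op).app M' ↔ E ⊴ₗ f ≫ a M' = a M ≫ f := by
  rw [← equiv_comp, ← equiv_actionHomRight, Equiv.apply_eq_iff_eq, eq_comm]

variable (adj) in
/-- The family `E ▷ M ⟶ M` that corresponds to a wedge `E ⟶ H (M, M)`. -/
def act (w : Wedge H) (M : ℳ) : w.pt ⊙ₗ M ⟶ M := (equiv adj w.pt M M).symm (w.ι M)

lemma equiv_act (w : Wedge H) (M : ℳ) : equiv adj w.pt M M (act adj w M) = w.ι M :=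
  Equiv.apply_symm_apply _ _

lemma act_naturality (w : Wedge H) {M M' : ℳ} (f : M ⟶ M') :
    w.pt ⊴ₗ f ≫ act adj w M' = act adj w M ≫ f :=
  (wedge_condition_iff (act adj w) f).1 (by
    rw [equiv_act, equiv_act]
    exact w.condition f)

variable (adj) in
/-- The wedge that corresponds to a natural family `E ▷ M ⟶ M`. -/
def wedge {E : 𝒟} (a : ∀ M : ℳ, E ⊙ₗ M ⟶ M)
    (ha : ∀ ⦃M M' : ℳ⦄ (f : M ⟶ M'), E ⊴ₗ f ≫ a M' = a M ≫ f) : Wedge H :=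
  Wedge.mk E (fun M => equiv adj E M M (a M)) fun _ _ f => (wedge_condition_iff a f).2 (ha f)

lemma act_wedge {E : 𝒟} (a : ∀ M : ℳ, E ⊙ₗ M ⟶ M)
    (ha : ∀ ⦃M M' : ℳ⦄ (f : M ⟶ M'), E ⊴ₗ f ≫ a M' = a M ≫ f) (M : ℳ) :
    act adj (wedge adj a ha) M = a M :=
  Equiv.symm_apply_apply _ _

lemma comp_ι_eq_iff {w w' : Wedge H} (h : w'.pt ⟶ w.pt) (M : ℳ) :
    h ≫ w.ι M = w'.ι M ↔ h ⊵ₗ M ≫ act adj w M = act adj w' M := by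
  rw [← equiv_act (adj := adj) w M, ← equiv_act (adj := adj) w' M]
  refine Iff.trans ?_ (Equiv.apply_eq_iff_eq (equiv adj w'.pt M M))
  rw [equiv_actionHomLeft]
  rfl

/-- Both sides correspond, under the internal Hom adjunction, to maps `E ▷ D' (D M) ⟶ M` of the form
`μ ≫ D' x ≫ ev`, where `x` is one of the two maps `E ▷ D M ⟶ D M` in the conclusion. Since `μ` is
invertible and `x ↦ D' x ≫ ev` is injective, equality of the two sides is equality of the two `x`.
-/
lemma compatible_iff (w : Wedge H) (D D' : ModuleEnd k 𝒟 ℳ) [ExactPairing D D']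
    {P : ObjectProperty (ModuleEnd k 𝒟 ℳ)} (hD : P D) (M : ℳ) :
    w.ι M ≫ (H.map ((ExactPairing.evaluation D D' ⊵ₗ M) ≫ (λₗ[ModuleEnd k 𝒟 ℳ] M).hom).op).app M =
      w.ι (D ⊙ₗ M : ℳ) ≫ adj.ξ P D D' hD (D ⊙ₗ M) M ≫ (H.map (αₗ D' D M).hom.op).app M ↔
    μₗ D.functor w.pt M ≫ D.functor.map (act adj w M) = act adj w (D.functor.obj M) := by
  have e1 : (ExactPairing.evaluation D D' ⊵ₗ M) ≫ (λₗ[ModuleEnd k 𝒟 ℳ] M).hom =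
      ModuleEnd.evApp D D' M := Category.comp_id _
  -- Composition of functors acts strictly, so the associativity isomorphism of the action is an
  -- identity.
  have e2 : (H.map (αₗ D' D M).hom.op).app M =
      𝟙 ((H.obj (op (D'.functor.obj (D.functor.obj M)))).obj M) :=
    NatTrans.congr_app (H.map_id _) M
  have e3 : adj.ξ P D D' hD (D ⊙ₗ M) M = equiv adj _ _ _
      (μₗ D'.functor ((H.obj (op (D.functor.obj M))).obj (D.functor.obj M)) (D.functor.obj M) ≫
      D'.functor.map (adj.ev (D.functor.obj M) (D.functor.obj M)) ≫ ModuleEnd.evApp D D' M) := rfl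
  -- For this side, `E ▷ ev` is expanded by `μ_evApp`, and naturality of the evaluation moves the
  -- family under `D' D`.
  have L : w.ι M ≫ (H.map ((ExactPairing.evaluation D D' ⊵ₗ M) ≫
      (λₗ[ModuleEnd k 𝒟 ℳ] M).hom).op).app M = equiv adj w.pt _ M
        (μₗ D'.functor w.pt (D.functor.obj M) ≫ D'.functor.map
          (μₗ D.functor w.pt M ≫ D.functor.map (act adj w M)) ≫ ModuleEnd.evApp D D' M) := by
    rw [e1, Functor.map_comp, Category.assoc, ModuleEnd.evApp_naturality,
      reassoc_of% ModuleEnd.μ_evApp, equiv_actionHomRight, equiv_act]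
    rfl
  -- For this side, the wedge leg at `D M` is absorbed into the evaluation of the internal Hom, by
  -- naturality of `μ` in its first variable.
  have R : w.ι (D ⊙ₗ M : ℳ) ≫ adj.ξ P D D' hD (D ⊙ₗ M) M ≫ (H.map (αₗ D' D M).hom.op).app M =
      equiv adj w.pt _ M (μₗ D'.functor w.pt (D.functor.obj M) ≫ D'.functor.map
        (act adj w (D.functor.obj M)) ≫ ModuleEnd.evApp D D' M) := by
    rw [e2]
    refine (congrArg (_ ≫ ·) (Category.comp_id _)).trans ?_
    rw [e3]
    refine (equiv_actionHomLeft _ _).symm.trans ?_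
    congr 1
    have := equiv_ev (adj := adj) _ (w.ι (D.functor.obj M))
    rw [act, ← this, Functor.map_comp, Category.assoc]
    exact (μₗ_naturality_left_assoc D'.functor (w.ι (D.functor.obj M)) (D.functor.obj M) _)
  refine ((Eq.congr L R).trans (Equiv.apply_eq_iff_eq _)).trans ?_
  constructor
  · intro h
    refine ModuleEnd.map_comp_evApp_injective D D' ?_
    rw [← cancel_epi (μₗ D'.functor w.pt (D.functor.obj M))]
    exact h
  · intro h
    rw [h]

/-- The condition that the family `E ▷ M ⟶ M` of a wedge commutes with the module functors in `P`. -/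
def Commutes (adj : InternalHom 𝒟 ℳ H) (w : Wedge H) (D : ModuleEnd k 𝒟 ℳ) : Prop :=
  ∀ M, μₗ D.functor w.pt M ≫ D.functor.map (act adj w M) = act adj w (D.functor.obj M)

/-- Conjugation by `e` is harmless since the family is natural with respect to the components of `e`
and `e` respects the module structures. Hence the essential image of `repFunctor` imposes no more
than the functors `L_V` themselves. -/
lemma Commutes.of_iso {w : Wedge H} {D D' : ModuleEnd k 𝒟 ℳ} (e : D ≅ D')
    (h : Commutes adj w D) : Commutes adj w D' := fun M => by
  have h1 := ModuleEnd.comm_μ e.inv w.pt M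
  have h2 : e.inv.natTrans.app M ≫ e.hom.natTrans.app M = 𝟙 _ :=
    congrArg (fun f => f.natTrans.app M) e.inv_hom_id
  have h3 : e.inv.natTrans.app (w.pt ⊙ₗ M) ≫ e.hom.natTrans.app (w.pt ⊙ₗ M) = 𝟙 _ :=
    congrArg (fun f => f.natTrans.app (w.pt ⊙ₗ M)) e.inv_hom_id
  have h4 := e.hom.natTrans.naturality (act adj w M)
  have h5 : D'.functor.map (act adj w M) =
      e.inv.natTrans.app (w.pt ⊙ₗ M) ≫ D.functor.map (act adj w M) ≫ e.hom.natTrans.app M := by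
    rw [h4, reassoc_of% h3]
  rw [h5, reassoc_of% h1, ← Category.assoc (μₗ D.functor w.pt M), h M, ← act_naturality,
    ← actionHomRight_comp_assoc, h2]
  simp

end InternalHom

end ModuleEnd

/-! ### Vectors of `V` as maps into `V ▶ A`. -/

namespace copower

variable {k : Type*} [Field k] {C : Type*} [Category* C] [Abelian C] [Linear k C]
    {V : Type*} [AddCommGroup V] [Module k V] [Module.Finite k V]

/-- A linear functional that does not vanish at `u`, rescaled to take the value 1 there, induces the
retraction. -/
lemma exists_retraction (A : C) {u : V} (hu : u ≠ 0) :
    ∃ r : copower k V A ⟶ A, i k V A u ≫ r = 𝟙 A := by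
  obtain ⟨f, hf⟩ : ∃ f : Module.Dual k V, f u ≠ 0 := by
    by_contra! h
    exact hu ((Module.forall_dual_apply_eq_zero_iff k u).1 h)
  refine ⟨desc ((f u)⁻¹ • f.smulRight (𝟙 A)), ?_⟩
  rw [i_desc]
  simp [smul_smul, hf]

lemma i_injective {A : C} (hA : 𝟙 A ≠ 0) : Function.Injective (i k V A) := by
  rw [← LinearMap.ker_eq_bot, LinearMap.ker_eq_bot']
  intro u hu
  by_contra hne
  obtain ⟨r, hr⟩ := exists_retraction (k := k) A hne
  rw [hu, zero_comp] at hr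
  exact hA hr.symm

end copower

/-! ### Commutation of a family with the functors `L_V`, degree by degree. -/

section Commutation

open Functor CrossedProduct MonoidalLeftAction

variable {k : Type*} [Field k] {G : Type*} [Group G] {C : Type*} [Category* C]
    [Abelian C] [Linear k C] [MonoidalCategory C] (T : TensorAction k G C)
    {N : Subgroup G} [N.Normal]

variable {T} in
-- The hypothesis says that `s_g` carries the element `i` of `W` to `i'`. The tensor structure of
-- `F_g` then carries `- ⊗ i` to `F_g (- ⊗ i')`, by right unitality. For `V ▶ 𝟙` it is applied to
-- the elements `v` and `g⁻¹ v`.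
lemma EquivariantObj.whiskerLeft_r (W : EquivariantObj T) (g : G) {i i' : 𝟙_ C ⟶ W.obj}
    (h : i ≫ (W.s g).hom = LaxMonoidal.ε (T.F g) ≫ (T.F g).map i') (X M : C) :
    (X ⊗ (T.F g).obj M) ◁ i ≫ (W.r g X M).hom =
      (ρ_ _).hom ≫ X ◁ (T.F g).map ((ρ_ M).inv ≫ M ◁ i') := by
  have h2 : (T.F g).obj M ◁ LaxMonoidal.ε (T.F g) ≫ LaxMonoidal.μ (T.F g) M (𝟙_ C) =
      (ρ_ _).hom ≫ (T.F g).map (ρ_ M).inv := by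
    rw [LaxMonoidal.right_unitality]
    simp [-LaxMonoidal.right_unitality, ← Functor.map_comp]
  rw [W.r_hom, T.hμ_hom, ← MonoidalCategory.whiskerLeft_comp_assoc, h,
    associator_naturality_right_assoc, ← MonoidalCategory.whiskerLeft_comp,
    MonoidalCategory.whiskerLeft_comp ((T.F g).obj M), Category.assoc,
    LaxMonoidal.μ_natural_right, reassoc_of% h2, ← Functor.map_comp,
    MonoidalCategory.whiskerLeft_comp, rightUnitor_tensor_hom, Category.assoc]

variable [Finite G] [MonoidalPreadditive C] [MonoidalLinear k C]

variable {T} in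
/-- The component `E_g ⊗ F_g M ⟶ M` of a natural family `E ▷ M ⟶ M`. -/
noncomputable def actComponent {E : CrossedProduct T} (a : ∀ M : C, E ⊙ₗ M ⟶ M)
    (ha : ∀ ⦃M M' : C⦄ (f : M ⟶ M'), E ⊴ₗ f ≫ a M' = a M ≫ f) (g : G) :
    T.F g ⋙ tensorLeft (E.comp g) ⟶ 𝟭 C where
  app M := actι E M g ≫ a M
  naturality M M' f := by
    have h := actι E M g ≫= ha f
    have h' : actι E M g ≫ E ⊴ₗ f = E.comp g ◁ (T.F g).map f ≫ actι E M' g :=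
      (ι_actHom (𝟙 E) f g).trans (by rw [id_app, id_tensorHom])
    rw [reassoc_of% h'] at h
    rw [Category.assoc]
    exact h

open InternalHom

variable {T} {H : Cᵒᵖ ⥤ C ⥤ CrossedProduct T} {adj : InternalHom (CrossedProduct T) C H}

variable (adj) in
/-- The natural family in degree `g` which corresponds to a wedge. -/
noncomputable def component (w : Wedge H) (g : G) :
    T.F g ⋙ tensorLeft (CrossedProduct.comp w.pt g) ⟶ 𝟭 C :=
  actComponent (E := w.pt) (act adj w) (fun _ _ f => act_naturality w f) g

lemma component_app (w : Wedge H) (g : G) (M : C) :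
    (component adj w g).app M = actι w.pt M g ≫ act adj w M := rfl

/-- The structure map of `- ⊗ W` is given summand by summand by `r`, and maps out of `(E ▷ M) ⊗ W`
are tested on the summands. -/
lemma EquivariantObj.commutes_iff (w : Wedge H) (W : EquivariantObj T) :
    Commutes adj w W.toModuleEnd ↔ ∀ (g : G) (M : C),
      (W.r g (CrossedProduct.comp w.pt g) M).hom ≫ (component adj w g).app (M ⊗ W.obj) =
        (component adj w g).app M ▷ W.obj := by
  let E : CrossedProduct T := w.pt
  have h1 : Commutes adj w W.toModuleEnd ↔
      ∀ M : C, W.lineatorHom E M ≫ act adj w (M ⊗ W.obj) = act adj w M ▷ W.obj :=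
    forall_congr' fun M => (Iso.inv_comp_eq (W.lineator E M)).trans eq_comm
  have h2 : ∀ M : C, W.lineatorHom E M ≫ act adj w (M ⊗ W.obj) = act adj w M ▷ W.obj ↔
      ∀ g : G, (W.r g (E.comp g) M).hom ≫ (component adj w g).app (M ⊗ W.obj) =
        (component adj w g).app M ▷ W.obj := fun M => by
    have h3 : ∀ g, actι E M g ▷ W.obj ≫ W.lineatorHom E M ≫ act adj w (M ⊗ W.obj) =
        (W.r g (E.comp g) M).hom ≫ (component adj w g).app (M ⊗ W.obj) := fun g => by
      rw [reassoc_of% W.ι_lineatorHom]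
      rfl
    have h4 : ∀ g, actι E M g ▷ W.obj ≫ act adj w M ▷ W.obj =
        (component adj w g).app M ▷ W.obj := fun g => (comp_whiskerRight _ _ _).symm
    constructor
    · intro h g
      rw [← h3, h, h4]
    · intro h
      exact W.lineator_ext fun g => by rw [h3, h4, h]
  rw [h1, forall_congr' h2]
  exact forall_comm

/-- Maps out of a tensor product with `V ▶ 𝟙` are tested on vectors `v`. On one side of
`commutes_iff` the structure isomorphism replaces `v` by `g⁻¹ v`; on the other `v` stays. -/
lemma commutes_repFunctor_iff (w : Wedge H) (V : FDRep k (G ⧸ N)) :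
    Commutes adj w ((repFunctor T N).obj V) ↔ ∀ (g : G) (M : C) (v : V),
      (component adj w g).app M ≫ (ρ_ M).inv ≫
        M ◁ copower.i k V (𝟙_ C) (V.ρ ((g : G ⧸ N)⁻¹) v) =
      (component adj w g).app M ≫ (ρ_ M).inv ≫ M ◁ copower.i k V (𝟙_ C) v := by
  let W := repEquivariant T V
  refine (W.commutes_iff w).trans (forall_congr' fun g => forall_congr' fun M => ?_)
  -- After `whiskerLeft_r`, naturality of the component brings it in front of `M ◁ i`.
  have hL : ∀ v : V, (CrossedProduct.comp w.pt g ⊗ (T.F g).obj M) ◁ copower.i k V (𝟙_ C) v ≫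
      (W.r g (CrossedProduct.comp w.pt g) M).hom ≫ (component adj w g).app (M ⊗ W.obj) =
      (ρ_ _).hom ≫ (component adj w g).app M ≫ (ρ_ M).inv ≫
        M ◁ copower.i k V (𝟙_ C) (V.ρ ((g : G ⧸ N)⁻¹) v) := fun v => by
    have h := W.whiskerLeft_r g (i_repIso T V g v) (CrossedProduct.comp w.pt g) M
    refine (reassoc_of% h) _ |>.trans ?_
    congr 1
    exact (component adj w g).naturality _
  -- Only the interchange law enters here.
  have hR : ∀ v : V, (CrossedProduct.comp w.pt g ⊗ (T.F g).obj M) ◁ copower.i k V (𝟙_ C) v ≫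
      (component adj w g).app M ▷ W.obj =
      (ρ_ _).hom ≫ (component adj w g).app M ≫ (ρ_ M).inv ≫
        M ◁ copower.i k V (𝟙_ C) v := fun v => by
    refine (whisker_exchange _ _).trans ?_
    rw [← rightUnitor_naturality_assoc]
    congr 1
    exact ((ρ_ M).hom_inv_id_assoc _).symm
  constructor
  · intro h v
    rw [← cancel_epi (ρ_ _).hom]
    exact (hL v).symm.trans ((congrArg (_ ≫ ·) h).trans (hR v))
  · intro h
    refine copower.map_hom_ext (V := V) (k := k) (tensorLeft _) fun v => ?_
    refine (hL v).trans (Eq.trans ?_ (hR v).symm)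
    rw [h v]

/-- In degrees in `N` the action on `V` is trivial; in the other degrees both sides are zero. -/
lemma commutes_repFunctor_of_component_eq_zero (w : Wedge H)
    (hw : ∀ g ∉ N, component adj w g = 0) (V : FDRep k (G ⧸ N)) :
    Commutes adj w ((repFunctor T N).obj V) := by
  rw [commutes_repFunctor_iff]
  intro g M v
  by_cases hg : g ∈ N
  · rw [(QuotientGroup.eq_one_iff g).2 hg, inv_one, map_one]
    rfl
  · rw [hw g hg]
    simp

/-- Subtracting the two sides shows that the component followed by `M ⊗ i (g⁻¹ v - v)` is zero. The
vector is nonzero, so that map has a retraction, and the component itself is zero. -/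
lemma component_eq_zero_of_commutes (w : Wedge H) (V : FDRep k (G ⧸ N))
    (h : Commutes adj w ((repFunctor T N).obj V)) {g : G} {v : V}
    (hv : V.ρ ((g : G ⧸ N)⁻¹) v ≠ v) : component adj w g = 0 := by
  rw [commutes_repFunctor_iff] at h
  ext M
  obtain ⟨r, hr⟩ := copower.exists_retraction (k := k) (𝟙_ C) (sub_ne_zero.2 hv)
  have h1 := sub_eq_zero.2 (h g M v)
  have h3 : ∀ a b : 𝟙_ C ⟶ copower k V (𝟙_ C), M ◁ a - M ◁ b = M ◁ (a - b) := fun a b =>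
    ((tensorLeft M).map_sub).symm
  rw [← Preadditive.comp_sub, ← Preadditive.comp_sub, h3, ← _root_.map_sub] at h1
  have h2 := h1 =≫ (M ◁ r ≫ (ρ_ M).hom)
  rw [Category.assoc, Category.assoc, ← MonoidalCategory.whiskerLeft_comp_assoc, hr] at h2
  simpa using h2

end Commutation

/-! ### The object `⨁_n [A_n, n]` and its universal property. -/

section AdjointSum

open CrossedProduct MonoidalLeftAction InternalHom

namespace CrossedProduct

variable {k : Type*} [Field k] {G : Type*} [Group G] {C : Type*} [Category* C]
    [Abelian C] [Linear k C] [MonoidalCategory C] {T : TensorAction k G C}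

/-- The projection of `[X, g]` to its component in degree `g`. -/
noncomputable def singleπ (g : G) (X : C) : (single (T := T) g X).comp g ⟶ X :=
  biproduct.π (fun _ : PLift (g = g) => X) ⟨rfl⟩

/-- The morphism to `[X, g]` with a given component in degree `g`. -/
noncomputable def singleLift {Z : CrossedProduct T} {g : G} {X : C} (t : Z.comp g ⟶ X) :
    Z ⟶ single g X :=
  ⟨fun _ => biproduct.lift fun e => (Z.tr e.down.symm).hom ≫ t⟩

lemma singleLift_π {Z : CrossedProduct T} {g : G} {X : C} (t : Z.comp g ⟶ X) :
    (singleLift t).app g ≫ singleπ g X = t := by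
  refine (biproduct.lift_π _ _).trans ?_
  simp [tr]

lemma single_hom_ext {Z : CrossedProduct T} {g : G} {X : C} {f f' : Z ⟶ single g X}
    (h : f.app g ≫ singleπ g X = f'.app g ≫ singleπ g X) : f = f' := by
  ext x
  refine biproduct.hom_ext _ _ fun ⟨e⟩ => ?_
  subst e
  exact h

/-- The finite sum is also a product, and a map into `[X, g]` is determined freely by its component
in degree `g`. -/
lemma existsUnique_sum_single [Finite G] {J : Type*} [Finite J] (g : J → G) (X : J → C)
    {Z : CrossedProduct T} (t : ∀ j, Z.comp (g j) ⟶ X j) :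
    ∃! h : Z ⟶ ⨁ fun j => single (T := T) (g j) (X j), ∀ j,
      (h ≫ biproduct.π (fun j => single (T := T) (g j) (X j)) j).app (g j) ≫ singleπ _ _ = t j := by
  refine ⟨biproduct.lift fun j => singleLift (t j), fun j => ?_, fun h hh => ?_⟩
  · rw [biproduct.lift_π, singleLift_π]
  · refine biproduct.hom_ext _ _ fun j => single_hom_ext ?_
    rw [biproduct.lift_π, singleLift_π, hh j]

end CrossedProduct

variable {k : Type*} [Field k] {G : Type*} [Group G] [Finite G] {C : Type*} [Category* C]
    [Abelian C] [Linear k C] [MonoidalCategory C] [RightRigidCategory C] (T : TensorAction k G C)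
    (N : Subgroup G) [∀ g, HasEnd (twistedHom T g)]

/-- The projection of `⨁_n [A_n, n]` to its component in degree `n`. -/
noncomputable def adjointSumπ (n : N) :
    (adjointSum T N).comp n ⟶ end_ (twistedHom T (n : G)) :=
  (biproduct.π (fun n : N => single (T := T) (n : G) (end_ (twistedHom T (n : G)))) n).app n ≫
    singleπ _ _

lemma existsUnique_adjointSum {Z : CrossedProduct T}
    (t : ∀ n : N, Z.comp n ⟶ end_ (twistedHom T (n : G))) :
    ∃! h : Z ⟶ adjointSum T N, ∀ n : N, h.app n ≫ adjointSumπ T N n = t n := by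
  exact (existsUnique_congr fun h => forall_congr' fun n =>
    Eq.congr_left (Category.assoc _ _ _)).1 (existsUnique_sum_single _ _ t)

variable [MonoidalPreadditive C]

open Classical in
/-- The natural family in degree `g` of the relative adjoint. -/
noncomputable def adjointFamily (g : G) :
    T.F g ⋙ tensorLeft ((adjointSum T N).comp g) ⟶ 𝟭 C :=
  -- Outside `N` the object has zero component, so the zero family is the only one there.
  if h : g ∈ N then natPre (adjointSumπ T N ⟨g, h⟩) (endFamily T g) else 0

lemma adjointFamily_of_mem (n : N) :
    adjointFamily T N n = natPre (adjointSumπ T N n) (endFamily T n) :=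
  dif_pos n.2

lemma adjointFamily_of_notMem {g : G} (hg : g ∉ N) : adjointFamily T N g = 0 :=
  dif_neg hg

variable {T} in
/-- The family `E ▷ M ⟶ M` with given components. -/
noncomputable def actOfComponents {E : CrossedProduct T}
    (α : ∀ g, T.F g ⋙ tensorLeft (E.comp g) ⟶ 𝟭 C) (M : C) : E ⊙ₗ M ⟶ M :=
  actDesc fun g => (α g).app M

variable {T} in
lemma actι_actOfComponents {E : CrossedProduct T}
    (α : ∀ g, T.F g ⋙ tensorLeft (E.comp g) ⟶ 𝟭 C) (M : C) (g : G) :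
    actι E M g ≫ actOfComponents α M = (α g).app M :=
  actι_actDesc _ _

variable {T} in
lemma actOfComponents_naturality {E : CrossedProduct T}
    (α : ∀ g, T.F g ⋙ tensorLeft (E.comp g) ⟶ 𝟭 C) ⦃M M' : C⦄ (f : M ⟶ M') :
    E ⊴ₗ f ≫ actOfComponents α M' = actOfComponents α M ≫ f := by
  refine act_hom_ext' fun g => ?_
  have h' : actι E M g ≫ E ⊴ₗ f = E.comp g ◁ (T.F g).map f ≫ actι E M' g :=
    (ι_actHom (𝟙 E) f g).trans (by rw [id_app, id_tensorHom])
  rw [reassoc_of% h', actι_actOfComponents, reassoc_of% actι_actOfComponents]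
  exact (α g).naturality f

variable {T} {N} {H : Cᵒᵖ ⥤ C ⥤ CrossedProduct T} (adj : InternalHom (CrossedProduct T) C H)

variable (T N) in
/-- The relative adjoint, with point `⨁_n [A_n, n]`. -/
noncomputable def adjointWedge : Wedge H :=
  wedge adj (actOfComponents (adjointFamily T N)) (actOfComponents_naturality _)

variable [MonoidalLinear k C]

lemma component_adjointWedge (g : G) :
    component adj (adjointWedge T N adj) g = adjointFamily T N g := by
  ext M
  exact (congrArg (actι (adjointSum T N) M g ≫ ·) (act_wedge (adj := adj) _
    (actOfComponents_naturality _) M)).trans (actι_actOfComponents _ _ _)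

variable {adj}

/-- Morphisms of wedges decompose by degree as the families do, since maps out of `E ▷ M` are tested
on the summands. -/
lemma comp_ι_eq_iff_component {w w' : Wedge H} (h : w'.pt ⟶ w.pt) :
    (∀ M, h ≫ w.ι M = w'.ι M) ↔
      ∀ g, natPre (Hom.app h g) (component adj w g) = component adj w' g := by
  have h1 : ∀ M g, actι w'.pt M g ≫ h ⊵ₗ M = Hom.app h g ▷ (T.F g).obj M ≫ actι w.pt M g :=
    fun M g => (ι_actHom h (𝟙 M) g).trans (by rw [CategoryTheory.Functor.map_id, tensorHom_id])
  have h2 : ∀ M, h ⊵ₗ M ≫ act adj w M = act adj w' M ↔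
      ∀ g, (natPre (Hom.app h g) (component adj w g)).app M = (component adj w' g).app M :=
    fun M => by
      have h3 : ∀ g, actι w'.pt M g ≫ h ⊵ₗ M ≫ act adj w M =
          (natPre (Hom.app h g) (component adj w g)).app M := fun g => by
        rw [← Category.assoc, h1, Category.assoc]
        rfl
      exact ⟨fun e g => by rw [← h3, e, component_app],
        fun e => act_hom_ext' fun g => (h3 g).trans (e g)⟩
  refine (forall_congr' fun M => (comp_ι_eq_iff (adj := adj) h M).trans (h2 M)).trans ?_
  exact forall_comm.trans (forall_congr' fun g => by rw [NatTrans.ext_iff, funext_iff])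

/-- In each degree `n` of `N` the universal family on `A_n` yields the one possible map to `A_n`,
and these maps assemble uniquely. In the remaining degrees both families vanish and there is nothing
to satisfy. -/
lemma existsUnique_adjointWedge (w' : Wedge H) (hw' : ∀ g ∉ N, component adj w' g = 0) :
    ∃! h : w'.pt ⟶ (adjointWedge T N adj).pt, ∀ M, h ≫ (adjointWedge T N adj).ι M = w'.ι M := by
  have key : ∀ h : w'.pt ⟶ adjointSum T N,
      (∀ M, h ≫ (adjointWedge T N adj).ι M = w'.ι M) ↔ ∀ n : N, h.app n ≫ adjointSumπ T N n =
        (isUniversalFamily_endFamily T (n : G) _ (component adj w' n)).choose := fun h => by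
    refine (comp_ι_eq_iff_component (adj := adj) (w := adjointWedge T N adj) h).trans ?_
    have h1 : ∀ n : N, natPre (Hom.app h n) (component adj (adjointWedge T N adj) n) =
        natPre (h.app n ≫ adjointSumπ T N n) (endFamily T n) := fun n => by
      rw [component_adjointWedge, adjointFamily_of_mem, natPre_comp]
    constructor
    · intro e n
      exact (isUniversalFamily_endFamily T (n : G) _ (component adj w' n)).choose_spec.2 _
        ((h1 n).symm.trans (e n))
    · intro e g
      by_cases hg : g ∈ N
      · refine (h1 ⟨g, hg⟩).trans ?_
        rw [e]
        exact (isUniversalFamily_endFamily T g _ (component adj w' g)).choose_spec.1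
      · rw [component_adjointWedge, adjointFamily_of_notMem T N hg, hw' g hg]
        ext M
        exact comp_zero
  obtain ⟨h, h1, h2⟩ := existsUnique_adjointSum T N (Z := w'.pt) fun n =>
    (isUniversalFamily_endFamily T (n : G) _ (component adj w' n)).choose
  exact ⟨h, (key h).2 h1, fun h' hh' => h2 h' ((key h').1 hh')⟩

variable [N.Normal]

/-- Compatible families are exactly those supported on `N`. For the direction from compatibility to
vanishing a single `V` suffices, provided that every `g` outside `N` moves a vector of it. Its `L_V`
must have a dual in the whole dual category, as the compatibility condition concerns only functors
with a dual. -/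
lemma isRelativeAdjoint_adjointWedge (adj : InternalHom (CrossedProduct T) C H)
    (hN : ∃ (V : FDRep k (G ⧸ N)) (D' : ModuleEnd k (CrossedProduct T) C)
      (_ : ExactPairing ((repFunctor T N).obj V) D'),
      ∀ g ∉ N, ∃ v : V, V.ρ ((g : G ⧸ N)⁻¹) v ≠ v) :
    IsRelativeAdjoint (repFunctor T N).essImage adj (adjointWedge T N adj) := by
  refine ⟨fun D D' _ hD M => ?_, fun w' hw' => existsUnique_adjointWedge w' fun g hg => ?_⟩
  · obtain ⟨V, ⟨e⟩⟩ := hD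
    refine (compatible_iff (adjointWedge T N adj) D D' _ M).2 ?_
    refine Commutes.of_iso e (commutes_repFunctor_of_component_eq_zero _ (fun g hg => ?_) V) M
    exact (component_adjointWedge adj g).trans (adjointFamily_of_notMem T N hg)
  · obtain ⟨V, D', _, hV⟩ := hN
    obtain ⟨v, hv⟩ := hV g hg
    have hP := (repFunctor T N).obj_mem_essImage V
    exact component_eq_zero_of_commutes w' V
      (fun M => (compatible_iff w' _ D' hP M).1 (hw' _ D' hP M)) hv

end AdjointSum

lemma IsRelativeEnd.nonempty_iso {𝒯 : Type*} [Category* 𝒯] [MonoidalCategory 𝒯] {ℳ : Type*}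
    [Category* ℳ] [MonoidalLeftAction 𝒯 ℳ] {𝒜 : Type*} [Category* 𝒜] {P : ObjectProperty 𝒯}
    {S : ℳᵒᵖ ⥤ ℳ ⥤ 𝒜} {β : Prebalancing P S} {w w' : Wedge S} (h : IsRelativeEnd β w)
    (h' : IsRelativeEnd β w') : Nonempty (w.pt ≅ w'.pt) := by
  obtain ⟨f, hf, -⟩ := h'.2 w h.1
  obtain ⟨f', hf', -⟩ := h.2 w' h'.1
  refine ⟨⟨f, f', (h.2 w h.1).unique (fun M => ?_) fun M => Category.id_comp _,
    (h'.2 w' h'.1).unique (fun M => ?_) fun M => Category.id_comp _⟩⟩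
  · rw [Category.assoc, hf', hf]
  · rw [Category.assoc, hf, hf']

/-! ### Module transformations between the functors `- ⊗ W`; full faithfulness. -/

section FullyFaithful

open Functor CrossedProduct MonoidalLeftAction OplaxLeftLinear

variable {k : Type*} [Field k] {G : Type*} [Group G] {C : Type*} [Category* C]
    [Abelian C] [Linear k C] [MonoidalCategory C] {T : TensorAction k G C}

/-- At `M = 𝟙`, once `F_g 𝟙` is identified with `𝟙`, the structure isomorphism `r` reduces to `s_g`,
by left unitality of `F_g`. -/
lemma EquivariantObj.rightUnitor_inv_r (W : EquivariantObj T) (g : G) (X : C) :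
    ((ρ_ X).inv ≫ X ◁ LaxMonoidal.ε (T.F g)) ▷ W.obj ≫ (W.r g X (𝟙_ C)).hom =
      X ◁ ((W.s g).hom ≫ (T.F g).map (λ_ W.obj).inv) := by
  have h : LaxMonoidal.ε (T.F g) ▷ (T.F g).obj W.obj ≫ LaxMonoidal.μ (T.F g) (𝟙_ C) W.obj =
      (λ_ _).hom ≫ (T.F g).map (λ_ W.obj).inv := by
    rw [LaxMonoidal.left_unitality]
    simp [-LaxMonoidal.left_unitality, ← Functor.map_comp]
  rw [W.r_hom, T.hμ_hom, ← whisker_exchange_assoc, comp_whiskerRight, Category.assoc,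
    associator_naturality_middle_assoc, ← MonoidalCategory.whiskerLeft_comp, h,
    MonoidalCategory.whiskerLeft_comp, MonoidalCategory.triangle_assoc,
    ← comp_whiskerRight_assoc, Iso.inv_hom_id, id_whiskerRight, Category.id_comp,
    MonoidalCategory.whiskerLeft_comp]

variable [Finite G] [MonoidalPreadditive C] [MonoidalLinear k C]

instance (X : CrossedProduct T) (M : C) (g : G) : Mono (actι X M g) :=
  inferInstanceAs (Mono (biproduct.ι (fun g : G => X.comp g ⊗ (T.F g).obj M) g))

/-- Restricts the module condition to one summand of `E ▷ M`; the inclusion of the summand is a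
monomorphism and cancels on the target. -/
lemma EquivariantObj.comp_r_of_comm {W W' : EquivariantObj T} (η : ∀ M : C, M ⊗ W.obj ⟶ M ⊗ W'.obj)
    (hη : ∀ {M M' : C} (f : M ⟶ M'), f ▷ W.obj ≫ η M' = η M ≫ f ▷ W'.obj)
    (h : ∀ (E : CrossedProduct T) (M : C), η (actObj E M) ≫ W'.lineatorHom E M =
      W.lineatorHom E M ≫ actHom (𝟙 E) (η M)) (g : G) (X M : C) :
    η (X ⊗ (T.F g).obj M) ≫ (W'.r g X M).hom = (W.r g X M).hom ≫ X ◁ (T.F g).map (η M) := by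
  -- The constant family contains `X` in degree `g` on the nose, without the transport that `[X, g]`
  -- would bring; the other summands are ignored.
  let E : CrossedProduct T := ⟨fun _ => X⟩
  have h1 : actι E M g ▷ W.obj ≫ η (actObj E M) =
      η (X ⊗ (T.F g).obj M) ≫ actι E M g ▷ W'.obj := hη _
  have h2 := (actι E M g ▷ W.obj) ≫= h E M
  rw [reassoc_of% h1, W'.ι_lineatorHom, reassoc_of% W.ι_lineatorHom] at h2
  have h3 : actι E (M ⊗ W.obj) g ≫ actHom (𝟙 E) (η M) =
      X ◁ (T.F g).map (η M) ≫ actι E (M ⊗ W'.obj) g :=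
    (ι_actHom (𝟙 E) (η M) g).trans (by rw [id_app, id_tensorHom])
  rw [h3] at h2
  refine (cancel_mono (actι E (M ⊗ W'.obj) g)).1 ?_
  exact (Category.assoc _ _ _).trans (h2.trans (Category.assoc _ _ _).symm)

/-- The morphism `f` is the component at `𝟙`. The module condition at `M = 𝟙` expresses `η X`, up to
the isomorphisms `s_g`, through `F_g f`. Degree `g = 1` then gives `η X = X ◁ f`, and `X = 𝟙` gives
the compatibility of `f` with all `s_g`. -/
lemma EquivariantObj.exists_eq_whiskerLeft {W W' : EquivariantObj T}
    (η : ∀ M : C, M ⊗ W.obj ⟶ M ⊗ W'.obj)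
    (hη : ∀ {M M' : C} (f : M ⟶ M'), f ▷ W.obj ≫ η M' = η M ≫ f ▷ W'.obj)
    (h : ∀ (g : G) (X M : C), η (X ⊗ (T.F g).obj M) ≫ (W'.r g X M).hom =
      (W.r g X M).hom ≫ X ◁ (T.F g).map (η M)) :
    ∃ f : W.obj ⟶ W'.obj, (∀ g, (W.s g).hom ≫ (T.F g).map f = f ≫ (W'.s g).hom) ∧
      ∀ M, η M = M ◁ f := by
  let f : W.obj ⟶ W'.obj := (λ_ _).inv ≫ η (𝟙_ C) ≫ (λ_ _).hom
  have key : ∀ (g : G) (X : C), η X ≫ X ◁ (W'.s g).hom =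
      X ◁ ((W.s g).hom ≫ (T.F g).map f) := fun g X => by
    have h1 := ((ρ_ X).inv ≫ X ◁ LaxMonoidal.ε (T.F g)) ▷ W.obj ≫= h g X (𝟙_ C)
    rw [reassoc_of% W.rightUnitor_inv_r, reassoc_of% hη, W'.rightUnitor_inv_r,
      ← MonoidalCategory.whiskerLeft_comp] at h1
    have h2 := h1 =≫ X ◁ (T.F g).map (λ_ W'.obj).hom
    rw [Category.assoc, ← MonoidalCategory.whiskerLeft_comp, Category.assoc, ← Functor.map_comp,
      Iso.inv_hom_id, CategoryTheory.Functor.map_id, Category.comp_id, ← MonoidalCategory.whiskerLeft_comp,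
      Category.assoc, Category.assoc, ← Functor.map_comp, ← Functor.map_comp] at h2
    exact h2
  have hη' : ∀ X, η X = X ◁ f := fun X => by
    have h1 := key 1 X
    -- In degree 1 compatibility is automatic, since `s_1` is a component of the natural isomorphism
    -- `Id ≅ F_1`.
    have h2 : (W.s 1).hom ≫ (T.F 1).map f = f ≫ (W'.s 1).hom := by
      rw [W.s_one, W'.s_one]
      exact (T.unit.hom.naturality f).symm
    rw [h2, MonoidalCategory.whiskerLeft_comp] at h1
    exact (cancel_mono (X ◁ (W'.s 1).hom)).1 h1
  refine ⟨f, fun g => ?_, hη'⟩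
  have h1 := key g (𝟙_ C)
  rw [hη', ← MonoidalCategory.whiskerLeft_comp, id_whiskerLeft, id_whiskerLeft] at h1
  exact ((cancel_mono _).1 ((cancel_epi _).1 h1)).symm

lemma EquivariantObj.exists_homToModuleEnd {W W' : EquivariantObj T}
    (η : W.toModuleEnd ⟶ W'.toModuleEnd) :
    ∃ (f : W.obj ⟶ W'.obj) (hf : ∀ g, (W.s g).hom ≫ (T.F g).map f = f ≫ (W'.s g).hom),
      η = homToModuleEnd f hf := by
  obtain ⟨f, hf, h⟩ := exists_eq_whiskerLeft (fun M => η.natTrans.app M)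
    (fun f => η.natTrans.naturality f)
    (comp_r_of_comm _ (fun f => η.natTrans.naturality f) (fun E M => η.comm E M))
  exact ⟨f, hf, ModuleEnd.hom_ext h⟩

/-- By Schur's lemma the coordinates of a map `𝟙 ⟶ V ▶ 𝟙` are scalars, and they are the coordinates
of the required vector. -/
lemma copower.i_surjective [IsAlgClosed k] [Simple (𝟙_ C)] [Module.Finite k (𝟙_ C ⟶ 𝟙_ C)]
    (V : Type*) [AddCommGroup V] [Module k V] [Module.Finite k V] :
    Function.Surjective (copower.i k V (𝟙_ C)) := fun h => by
  choose c hc using fun j : Fin (Module.finrank k V) => endomorphism_simple_eq_smul_id k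
    (h ≫ biproduct.π (fun _ : Fin (Module.finrank k V) => 𝟙_ C) j)
  refine ⟨∑ j, c j • Module.finBasis k V j, ?_⟩
  rw [_root_.map_sum]
  have h1 : ∀ j, copower.i k V (𝟙_ C) (c j • Module.finBasis k V j) =
      h ≫ biproduct.π (fun _ : Fin (Module.finrank k V) => 𝟙_ C) j ≫
        biproduct.ι (fun _ : Fin (Module.finrank k V) => 𝟙_ C) j := fun j => by
    rw [_root_.map_smul, copower.i_basis]
    refine Eq.trans ?_ ((hc j =≫ biproduct.ι (fun _ => 𝟙_ C) j).trans (Category.assoc _ _ _))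
    rw [Linear.smul_comp, Category.id_comp]
    rfl
  simp only [h1]
  exact (Preadditive.comp_sum _ _ _).symm.trans
    ((congrArg (h ≫ ·) biproduct.total).trans (Category.comp_id _))

variable (T) (N : Subgroup G) [N.Normal]

lemma repLin_injective {V W : FDRep k (G ⧸ N)} {f f' : V ⟶ W} (h : repLin f = repLin f') :
    f = f' :=
  Action.Hom.ext (InducedCategory.hom_ext (ModuleCat.hom_ext h))

lemma exists_repLin_eq {V W : FDRep k (G ⧸ N)} (f : V →ₗ[k] W)
    (hf : ∀ x v, W.ρ x (f v) = f (V.ρ x v)) : ∃ f' : V ⟶ W, repLin f' = f :=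
  ⟨⟨InducedCategory.homMk (ModuleCat.ofHom f), fun x => by
    ext v
    exact (hf x v).symm⟩, rfl⟩

/-- The component at `𝟙` recovers `V ▶ 𝟙 ⟶ W ▶ 𝟙`, and `W` embeds into `Hom (𝟙, W ▶ 𝟙)`. -/
lemma repFunctor_faithful [Simple (𝟙_ C)] : (repFunctor T N).Faithful where
  map_injective {V W f f'} h := by
    apply repLin_injective
    ext v
    apply copower.i_injective (k := k) (id_nonzero (𝟙_ C))
    have h1 : 𝟙_ C ◁ copower.map (repLin f) (𝟙_ C) = 𝟙_ C ◁ copower.map (repLin f') (𝟙_ C) :=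
      congrArg (fun η => η.natTrans.app (𝟙_ C)) h
    have h2 : copower.map (repLin f) (𝟙_ C) = copower.map (repLin f') (𝟙_ C) := by
      simpa using h1
    rw [← copower.i_map, h2, copower.i_map]

/-- A module transformation is `- ⊗ φ` with `φ` compatible with the `s_g`. Since `i` identifies `V`
and `W` with the Hom spaces from `𝟙`, composition with `φ` is a linear map `V → W`; compatibility
with the `s_g` is its equivariance. -/
lemma repFunctor_full [IsAlgClosed k] [Simple (𝟙_ C)] [Module.Finite k (𝟙_ C ⟶ 𝟙_ C)] :
    (repFunctor T N).Full where
  map_surjective {V W} η := by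
    obtain ⟨φ, hφ, hη⟩ : ∃ (φ : copower k V (𝟙_ C) ⟶ copower k W (𝟙_ C))
        (hφ : ∀ g, (repIso T V g).hom ≫ (T.F g).map φ = φ ≫ (repIso T W g).hom),
        η = EquivariantObj.homToModuleEnd (W := repEquivariant T V)
          (W' := repEquivariant T W) φ hφ := EquivariantObj.exists_homToModuleEnd η
    have hi := copower.i_injective (k := k) (V := W) (id_nonzero (𝟙_ C))
    let e := LinearEquiv.ofBijective (copower.i k W (𝟙_ C)) ⟨hi, copower.i_surjective W⟩
    let f : V →ₗ[k] W := e.symm.toLinearMap ∘ₗ Linear.rightComp k _ φ ∘ₗ copower.i k V (𝟙_ C)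
    have hf : ∀ v, copower.i k V (𝟙_ C) v ≫ φ = copower.i k W (𝟙_ C) (f v) := fun v =>
      (e.apply_symm_apply _).symm
    obtain ⟨f', hf'⟩ : ∃ f' : V ⟶ W, repLin f' = f := exists_repLin_eq N f fun x v => by
      obtain ⟨g, rfl⟩ := QuotientGroup.mk_surjective x
      -- The element `g⁻¹` is used because `s_g` acts by the inverse. What remains is to cancel the
      -- isomorphism `ε` and the faithful functor `F_{g⁻¹}`.
      have h1 := copower.i k V (𝟙_ C) v ≫= hφ g⁻¹
      rw [reassoc_of% i_repIso, ← Functor.map_comp, hf, reassoc_of% hf, i_repIso,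
        QuotientGroup.mk_inv, inv_inv] at h1
      have h2 := (cancel_epi (Monoidal.εIso (T.F g⁻¹)).hom).1 h1
      exact (hi ((T.F g⁻¹).map_injective h2)).symm
    refine ⟨f', ?_⟩
    rw [hη]
    refine ModuleEnd.hom_ext fun M => ?_
    have h2 : copower.map (repLin f') (𝟙_ C) = φ := copower.hom_ext fun v => by
      rw [copower.i_map, hf, hf']
    exact congrArg (M ◁ ·) h2

lemma repFunctor_additive : (repFunctor T N ⋙ ModuleEnd.forget k (CrossedProduct T) C).Additive where
  map_add {V W f f'} := by
    ext M
    have h : copower.map (repLin (f + f')) (𝟙_ C) =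
        copower.map (repLin f) (𝟙_ C) + copower.map (repLin f') (𝟙_ C) :=
      copower.hom_ext fun v => by
        rw [Preadditive.comp_add, copower.i_map, copower.i_map, copower.i_map, ← _root_.map_add]
        rfl
    exact (congrArg (M ◁ ·) h).trans (MonoidalPreadditive.whiskerLeft_add _ _)

lemma repFunctor_linear :
    (repFunctor T N ⋙ ModuleEnd.forget k (CrossedProduct T) C).Linear k where
  map_smul {V W} f c := by
    ext M
    have h : copower.map (repLin (c • f)) (𝟙_ C) = c • copower.map (repLin f) (𝟙_ C) :=
      copower.hom_ext fun v => by
        rw [Linear.comp_smul, copower.i_map, copower.i_map, ← _root_.map_smul]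
        rfl
    exact (congrArg (M ◁ ·) h).trans (MonoidalLinear.whiskerLeft_smul _ _ _)

end FullyFaithful

/-! ### Tensor products of representations, described on elements. -/

namespace FDRep

variable {k : Type*} [Field k] {Γ : Type*} [Group Γ]

/-- The canonical bilinear map `V × W → V ⊗ W`. -/
def tmul (V W : FDRep k Γ) : V →ₗ[k] W →ₗ[k] (V ⊗ W : FDRep k Γ) := TensorProduct.mk k V W

/-- The carrier of `V ⊗ W` is by definition the tensor product of vector spaces. The later arguments
use only such formulas on pure tensors. -/
lemma ρ_tmul (V W : FDRep k Γ) (x : Γ) (v : V) (w : W) :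
    (V ⊗ W : FDRep k Γ).ρ x (tmul V W v w) = tmul V W (V.ρ x v) (W.ρ x w) := rfl

/-- The canonical generator of the trivial representation. -/
def one : (𝟙_ (FDRep k Γ) : FDRep k Γ) := (1 : k)

variable {B : Type*} [AddCommGroup B] [Module k B]

/-- The linear map out of `V ⊗ W` given by a bilinear map. -/
noncomputable def lift {V W : FDRep k Γ} (f : V →ₗ[k] W →ₗ[k] B) :
    (V ⊗ W : FDRep k Γ) →ₗ[k] B := TensorProduct.lift f

lemma lift_tmul {V W : FDRep k Γ} (f : V →ₗ[k] W →ₗ[k] B) (v : V) (w : W) :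
    lift f (tmul V W v w) = f v w := TensorProduct.lift.tmul _ _

lemma tensor_ext {V W : FDRep k Γ} {f f' : (V ⊗ W : FDRep k Γ) →ₗ[k] B}
    (h : ∀ v w, f (tmul V W v w) = f' (tmul V W v w)) : f = f' := TensorProduct.ext' h

/-- The linear map out of the trivial representation which takes a given value on the generator. -/
def unitLift (b : B) : (𝟙_ (FDRep k Γ) : FDRep k Γ) →ₗ[k] B := LinearMap.toSpanSingleton k B b

lemma unitLift_one (b : B) : unitLift (k := k) (Γ := Γ) b one = b :=
  one_smul k b

lemma unit_ext {f f' : (𝟙_ (FDRep k Γ) : FDRep k Γ) →ₗ[k] B} (h : f one = f' one) : f = f' :=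
  LinearMap.ext_ring h

variable {G : Type*} [Group G] {N : Subgroup G} [N.Normal]

lemma repLin_whiskerRight {V V' : FDRep k (G ⧸ N)} (f : V ⟶ V') (W : FDRep k (G ⧸ N)) (v : V)
    (w : W) : repLin (f ▷ W) (tmul V W v w) = tmul V' W (repLin f v) w := rfl

lemma repLin_whiskerLeft (V : FDRep k (G ⧸ N)) {W W' : FDRep k (G ⧸ N)} (f : W ⟶ W') (v : V)
    (w : W) : repLin (V ◁ f) (tmul V W v w) = tmul V W' v (repLin f w) := rfl

lemma repLin_associator (U V W : FDRep k (G ⧸ N)) (u : U) (v : V) (w : W) :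
    repLin (α_ U V W).hom (tmul _ W (tmul U V u v) w) = tmul U _ u (tmul V W v w) := rfl

lemma repLin_leftUnitor (V : FDRep k (G ⧸ N)) (v : V) :
    repLin (λ_ V).hom (tmul _ V one v) = v := one_smul k v

lemma repLin_rightUnitor (V : FDRep k (G ⧸ N)) (v : V) :
    repLin (ρ_ V).hom (tmul V _ v one) = v := one_smul k v

end FDRep

/-! ### Composition of the functors `- ⊗ W` as module functors. -/

namespace EquivariantObj

open Functor CrossedProduct MonoidalLeftAction OplaxLeftLinear

variable {k : Type*} [Field k] {G : Type*} [Group G] {C : Type*} [Category* C]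
    [Abelian C] [Linear k C] [MonoidalCategory C] {T : TensorAction k G C}

/-- Applying `- ⊗ W'` and then `- ⊗ W` puts `W'` on the left of `W`, so `m` starts at `W' ⊗ W`. The
structure isomorphisms match since `m` is equivariant for the product of `s'_g` and `s_g`, and since
`μ` is associative. -/
lemma tensor_comp_r (W W' W'' : EquivariantObj T) (m : W'.obj ⊗ W.obj ⟶ W''.obj) (g : G)
    (hm : m ≫ (W''.s g).hom = ((W'.s g).hom ⊗ₘ (W.s g).hom) ≫ LaxMonoidal.μ (T.F g) _ _ ≫
      (T.F g).map m) (X M : C) :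
    (α_ (X ⊗ (T.F g).obj M) W'.obj W.obj).hom ≫ (X ⊗ (T.F g).obj M) ◁ m ≫ (W''.r g X M).hom =
      (W'.r g X M).hom ▷ W.obj ≫ (W.r g X (M ⊗ W'.obj)).hom ≫
        X ◁ (T.F g).map ((α_ M W'.obj W.obj).hom ≫ M ◁ m) := by
  have h1 := T.hμ_nat g (𝟙 X) (𝟙 M) m
  rw [CategoryTheory.Functor.map_id, id_tensorHom_id, id_tensorHom, id_tensorHom,
    id_tensorHom] at h1
  rw [Functor.map_comp, MonoidalCategory.whiskerLeft_comp, W.r_hom, W'.r_hom, W''.r_hom,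
    ← MonoidalCategory.whiskerLeft_comp_assoc, hm, comp_whiskerRight, Category.assoc,
    Category.assoc, ← whisker_exchange_assoc, reassoc_of% T.hμ_assoc, ← h1, MonoidalCategory.tensorHom_def]
  simp

variable [Finite G] [MonoidalPreadditive C] [MonoidalLinear k C]

/-- The isomorphism `L_W ∘ L_{W'} ≅ L_{W''}` given by a compatible isomorphism `W' ⊗ W ≅ W''`. -/
noncomputable def tensorIso (W W' W'' : EquivariantObj T) (m : W'.obj ⊗ W.obj ≅ W''.obj)
    (hm : ∀ g, m.hom ≫ (W''.s g).hom =
      ((W'.s g).hom ⊗ₘ (W.s g).hom) ≫ LaxMonoidal.μ (T.F g) _ _ ≫ (T.F g).map m.hom) :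
    W.toModuleEnd ⊗ W'.toModuleEnd ≅ W''.toModuleEnd :=
  ModuleEnd.isoOfEq _ _
    (NatIso.ofComponents (F := tensorRight W'.obj ⋙ tensorRight W.obj) (G := tensorRight W''.obj)
      (fun M => α_ M W'.obj W.obj ≪≫ whiskerLeftIso M m) (fun {M M'} f => by
        change (f ▷ W'.obj) ▷ W.obj ≫ (α_ _ _ _).hom ≫ M' ◁ m.hom =
          ((α_ _ _ _).hom ≫ M ◁ m.hom) ≫ f ▷ W''.obj
        rw [associator_naturality_left_assoc, Category.assoc, whisker_exchange]))
    (fun X M => by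
      change ((α_ (actObj X M) W'.obj W.obj).hom ≫ actObj X M ◁ m.hom) ≫ W''.lineatorHom X M =
        (W'.lineatorHom X M ▷ W.obj ≫ W.lineatorHom X (M ⊗ W'.obj)) ≫
          actHom (𝟙 X) ((α_ M W'.obj W.obj).hom ≫ M ◁ m.hom)
      refine act_hom_ext (tensorRight W'.obj ⋙ tensorRight W.obj) fun g => ?_
      change (actι X M g ▷ W'.obj) ▷ W.obj ≫ _ = (actι X M g ▷ W'.obj) ▷ W.obj ≫ _
      rw [Category.assoc, Category.assoc, associator_naturality_left_assoc,
        ← whisker_exchange_assoc, W''.ι_lineatorHom, ← comp_whiskerRight_assoc, W'.ι_lineatorHom,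
        comp_whiskerRight, Category.assoc, reassoc_of% W.ι_lineatorHom, ι_actHom, id_app,
        id_tensorHom, reassoc_of% W.tensor_comp_r W' W'' m.hom g (hm g)])

/-- The isomorphism `Id ≅ L_W` given by an isomorphism `𝟙 ≅ W` compatible with `ε`. -/
noncomputable def unitIso (W : EquivariantObj T) (i : 𝟙_ C ≅ W.obj)
    (hi : ∀ g, i.hom ≫ (W.s g).hom = LaxMonoidal.ε (T.F g) ≫ (T.F g).map i.hom) :
    𝟙_ (ModuleEnd k (CrossedProduct T) C) ≅ W.toModuleEnd :=
  ModuleEnd.isoOfEq _ _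
    (NatIso.ofComponents (F := 𝟭 C) (G := tensorRight W.obj)
      (fun M => (ρ_ M).symm ≪≫ whiskerLeftIso M i) (fun {M M'} f => by
        change f ≫ (ρ_ _).inv ≫ M' ◁ i.hom = ((ρ_ _).inv ≫ M ◁ i.hom) ≫ f ▷ W.obj
        rw [rightUnitor_inv_naturality_assoc, Category.assoc, whisker_exchange]))
    (fun X M => by
      change ((ρ_ (actObj X M)).inv ≫ actObj X M ◁ i.hom) ≫ W.lineatorHom X M =
        𝟙 (actObj X M) ≫ actHom (𝟙 X) ((ρ_ M).inv ≫ M ◁ i.hom)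
      refine act_hom_ext' fun g => ?_
      rw [Category.id_comp, Category.assoc, rightUnitor_inv_naturality_assoc,
        ← whisker_exchange_assoc, W.ι_lineatorHom, ι_actHom, id_app,
        id_tensorHom, reassoc_of% W.whiskerLeft_r g (hi g), Iso.inv_hom_id_assoc])

end EquivariantObj

/-! ### The strong monoidal structure of `V ↦ L_V`. -/

section Monoidal

open Functor

variable {k : Type*} [Field k] {C : Type*} [Category* C]
    [Abelian C] [Linear k C] [MonoidalCategory C] [MonoidalPreadditive C] [MonoidalLinear k C]

namespace copower

variable {U V W : Type*} [AddCommGroup U] [Module k U] [Module.Finite k U] [AddCommGroup V]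
    [Module k V] [Module.Finite k V] [AddCommGroup W] [Module k W] [Module.Finite k W]

lemma tensor_hom_ext {A B Z : C} {f f' : copower k V A ⊗ copower k W B ⟶ Z}
    (h : ∀ v w, (i k V A v ⊗ₘ i k W B w) ≫ f = (i k V A v ⊗ₘ i k W B w) ≫ f') : f = f' :=
  map_hom_ext (k := k) (V := V) (tensorRight (copower k W B)) fun v =>
    map_hom_ext (k := k) (V := W) (tensorLeft A) fun w => by
      change A ◁ i k W B w ≫ i k V A v ▷ copower k W B ≫ f =
        A ◁ i k W B w ≫ i k V A v ▷ copower k W B ≫ f'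
      rw [← tensorHom_def'_assoc, h, tensorHom_def'_assoc]

lemma tensor_tensor_hom_ext {A B D Z : C}
    {f f' : (copower k U A ⊗ copower k V B) ⊗ copower k W D ⟶ Z}
    (h : ∀ u v w, ((i k U A u ⊗ₘ i k V B v) ⊗ₘ i k W D w) ≫ f =
      ((i k U A u ⊗ₘ i k V B v) ⊗ₘ i k W D w) ≫ f') : f = f' :=
  map_hom_ext (k := k) (V := U) (tensorRight (copower k V B) ⋙ tensorRight (copower k W D))
    fun u => map_hom_ext (k := k) (V := V) (tensorLeft A ⋙ tensorRight (copower k W D)) fun v =>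
      map_hom_ext (k := k) (V := W) (tensorLeft (A ⊗ B)) fun w => by
        have h1 : ∀ q : (copower k U A ⊗ copower k V B) ⊗ copower k W D ⟶ Z,
            (A ⊗ B) ◁ i k W D w ≫ (A ◁ i k V B v) ▷ copower k W D ≫
              (i k U A u ▷ copower k V B) ▷ copower k W D ≫ q =
            ((i k U A u ⊗ₘ i k V B v) ⊗ₘ i k W D w) ≫ q := fun q => by
          rw [← comp_whiskerRight_assoc, ← tensorHom_def', ← tensorHom_def'_assoc]
        exact (h1 f).trans ((h u v w).trans (h1 f').symm)

/-- The linear map `W → Hom (𝟙 ⊗ (V ▶ 𝟙), P ▶ 𝟙)` given by a bilinear map `V × W → P`. -/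
noncomputable def bilinCoelement (t : V →ₗ[k] W →ₗ[k] U) :
    W →ₗ[k] (𝟙_ C ⊗ copower k V (𝟙_ C) ⟶ copower k U (𝟙_ C)) where
  toFun w := (λ_ _).hom ≫ desc ((i k U (𝟙_ C)).comp (t.flip w))
  map_add' w w' := by
    rw [← Preadditive.comp_add]
    congr 1
    refine hom_ext fun v => ?_
    rw [Preadditive.comp_add, i_desc, i_desc, i_desc]
    simp
  map_smul' c w := by
    rw [RingHom.id_apply, ← Linear.comp_smul]
    congr 1
    refine hom_ext fun v => ?_
    rw [Linear.comp_smul, i_desc, i_desc]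
    simp

/-- The morphism `(W ▶ 𝟙) ⊗ (V ▶ 𝟙) ⟶ P ▶ 𝟙` given by a bilinear map `V × W → P`. -/
noncomputable def bilinDesc (t : V →ₗ[k] W →ₗ[k] U) :
    copower k W (𝟙_ C) ⊗ copower k V (𝟙_ C) ⟶ copower k U (𝟙_ C) :=
  mapDesc (tensorRight (copower k V (𝟙_ C))) (bilinCoelement t)

/-- The order of the factors is reversed on purpose: `L_V ∘ L_W` tensors with `W ▶ 𝟙` before it
tensors with `V ▶ 𝟙`. -/
lemma tensor_i_bilinDesc (t : V →ₗ[k] W →ₗ[k] U) (v : V) (w : W) :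
    (i k W (𝟙_ C) w ⊗ₘ i k V (𝟙_ C) v) ≫ bilinDesc t =
      (λ_ (𝟙_ C)).hom ≫ i k U (𝟙_ C) (t v w) := by
  have h := map_i_mapDesc (tensorRight (copower k V (𝟙_ C))) (bilinCoelement t) w
  rw [tensorHom_def', Category.assoc]
  refine (congrArg (_ ≫ ·) h).trans ?_
  refine (leftUnitor_naturality_assoc _ _).trans ?_
  rw [i_desc]
  rfl

end copower

variable {G : Type*} [Group G] {N : Subgroup G} [N.Normal]

open FDRep

section

variable (C) {Γ : Type*} [Group Γ] (V W : FDRep k Γ)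

/-- The bilinear map `V × W → Hom (𝟙, (W ▶ 𝟙) ⊗ (V ▶ 𝟙))`. -/
noncomputable def tensorElement :
    V →ₗ[k] W →ₗ[k] (𝟙_ C ⟶ copower k W (𝟙_ C) ⊗ copower k V (𝟙_ C)) :=
  LinearMap.mk₂ k
    (fun v w => (λ_ (𝟙_ C)).inv ≫ (copower.i k W (𝟙_ C) w ⊗ₘ copower.i k V (𝟙_ C) v))
    (fun v v' w => by rw [_root_.map_add, MonoidalPreadditive.tensor_add, Preadditive.comp_add])
    (fun c v w => by
      rw [_root_.map_smul, MonoidalCategory.tensorHom_def, MonoidalCategory.tensorHom_def, MonoidalLinear.whiskerLeft_smul,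
        Linear.comp_smul, Linear.comp_smul])
    (fun v w w' => by rw [_root_.map_add, MonoidalPreadditive.add_tensor, Preadditive.comp_add])
    (fun c v w => by
      rw [_root_.map_smul, MonoidalCategory.tensorHom_def, MonoidalCategory.tensorHom_def, MonoidalLinear.smul_whiskerRight,
        Linear.smul_comp, Linear.comp_smul])

/-- The isomorphism `(W ▶ 𝟙) ⊗ (V ▶ 𝟙) ≅ (V ⊗ W) ▶ 𝟙`. -/
noncomputable def copowerTensorIso :
    copower k W (𝟙_ C) ⊗ copower k V (𝟙_ C) ≅ copower k (V ⊗ W : FDRep k Γ) (𝟙_ C) where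
  hom := copower.bilinDesc (tmul V W)
  inv := copower.desc (lift (tensorElement C V W))
  hom_inv_id := copower.tensor_hom_ext fun w v => by
    rw [reassoc_of% copower.tensor_i_bilinDesc, copower.i_desc, lift_tmul, Category.comp_id]
    exact Iso.hom_inv_id_assoc _ _
  inv_hom_id := copower.hom_ext fun x => by
    have h : Linear.rightComp k _ (copower.bilinDesc (tmul V W)) ∘ₗ lift (tensorElement C V W) =
        copower.i k (V ⊗ W : FDRep k Γ) (𝟙_ C) := tensor_ext fun v w => by
      change lift (tensorElement C V W) (tmul V W v w) ≫ _ = _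
      rw [lift_tmul]
      refine (Category.assoc _ _ _).trans
        ((congrArg (_ ≫ ·) (copower.tensor_i_bilinDesc _ v w)).trans ?_)
      exact Iso.inv_hom_id_assoc _ _
    rw [reassoc_of% copower.i_desc, Category.comp_id]
    exact LinearMap.congr_fun h x

lemma tensor_i_copowerTensorIso (v : V) (w : W) :
    (copower.i k W (𝟙_ C) w ⊗ₘ copower.i k V (𝟙_ C) v) ≫ (copowerTensorIso C V W).hom =
      (λ_ (𝟙_ C)).hom ≫ copower.i k (V ⊗ W : FDRep k Γ) (𝟙_ C) (tmul V W v w) :=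
  copower.tensor_i_bilinDesc _ v w

variable (k Γ) in
/-- The isomorphism `𝟙 ≅ k ▶ 𝟙`. -/
noncomputable def copowerUnitIso : 𝟙_ C ≅ copower k (𝟙_ (FDRep k Γ) : FDRep k Γ) (𝟙_ C) where
  hom := copower.i k (𝟙_ (FDRep k Γ) : FDRep k Γ) (𝟙_ C) one
  inv := copower.desc (unitLift (𝟙 (𝟙_ C)))
  hom_inv_id := by rw [copower.i_desc, unitLift_one]
  inv_hom_id := copower.hom_ext fun x => by
    have h : Linear.rightComp k _ (copower.i k (𝟙_ (FDRep k Γ) : FDRep k Γ) (𝟙_ C) one) ∘ₗ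
        unitLift (𝟙 (𝟙_ C)) = copower.i k (𝟙_ (FDRep k Γ) : FDRep k Γ) (𝟙_ C) := unit_ext (by
      change unitLift (k := k) (Γ := Γ) (𝟙 (𝟙_ C)) one ≫ _ = _
      rw [unitLift_one, Category.id_comp])
    rw [reassoc_of% copower.i_desc, Category.comp_id]
    exact LinearMap.congr_fun h x

end

variable (T : TensorAction k G C)

/-- On vectors, both sides apply `g⁻¹` to `v` and to `w`: the group acts diagonally on `V ⊗ W`. The
remaining discrepancy between `ε ⊗ ε` and `ε` is left unitality of `F_g`. -/
lemma copowerTensorIso_comm (V W : FDRep k (G ⧸ N)) (g : G) :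
    (copowerTensorIso C V W).hom ≫ (repIso T (V ⊗ W) g).hom =
      ((repIso T W g).hom ⊗ₘ (repIso T V g).hom) ≫ LaxMonoidal.μ (T.F g) _ _ ≫
        (T.F g).map (copowerTensorIso C V W).hom :=
  copower.tensor_hom_ext fun w v => by
    have h : (LaxMonoidal.ε (T.F g) ⊗ₘ LaxMonoidal.ε (T.F g)) ≫ LaxMonoidal.μ (T.F g) _ _ ≫
        (T.F g).map (λ_ (𝟙_ C)).hom = (λ_ _).hom ≫ LaxMonoidal.ε (T.F g) := by
      rw [tensorHom_def', Category.assoc, ← LaxMonoidal.left_unitality, leftUnitor_naturality]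
    rw [reassoc_of% tensor_i_copowerTensorIso, i_repIso, tensorHom_comp_tensorHom_assoc,
      i_repIso, i_repIso, ← tensorHom_comp_tensorHom_assoc, LaxMonoidal.μ_natural_assoc,
      ← Functor.map_comp, tensor_i_copowerTensorIso, Functor.map_comp, reassoc_of% h, ρ_tmul]

lemma copowerUnitIso_comm (g : G) :
    (copowerUnitIso k C (G ⧸ N)).hom ≫ (repIso T (𝟙_ (FDRep k (G ⧸ N))) g).hom =
      LaxMonoidal.ε (T.F g) ≫ (T.F g).map (copowerUnitIso k C (G ⧸ N)).hom :=
  i_repIso T _ g _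

/-- On triples of vectors both sides give `u ⊗ (v ⊗ w)`; the unit coherences of `C` account for the
rest. -/
lemma copowerTensorIso_assoc (U V W : FDRep k (G ⧸ N)) :
    (α_ _ _ _).hom ≫ copower k W (𝟙_ C) ◁ (copowerTensorIso C U V).hom ≫
      (copowerTensorIso C (U ⊗ V) W).hom ≫ copower.map (repLin (α_ U V W).hom) (𝟙_ C) =
    (copowerTensorIso C V W).hom ▷ copower k U (𝟙_ C) ≫ (copowerTensorIso C U (V ⊗ W)).hom :=
  copower.tensor_tensor_hom_ext fun w v u => by
    rw [associator_naturality_assoc, ← id_tensorHom, tensorHom_comp_tensorHom_assoc,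
      tensor_i_copowerTensorIso, Category.comp_id, ← tensorHom_id, tensorHom_comp_tensorHom_assoc,
      tensor_i_copowerTensorIso, Category.comp_id,
      ← Category.id_comp (copower.i k W (𝟙_ C) w), ← tensorHom_comp_tensorHom_assoc,
      reassoc_of% tensor_i_copowerTensorIso, copower.i_map, repLin_associator,
      ← Category.id_comp (copower.i k U (𝟙_ C) u), ← tensorHom_comp_tensorHom_assoc,
      tensor_i_copowerTensorIso, id_tensorHom, tensorHom_id, MonoidalCategory.triangle_assoc,
      unitors_equal]

lemma copowerTensorIso_naturality_left {V V' : FDRep k (G ⧸ N)} (f : V ⟶ V')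
    (W : FDRep k (G ⧸ N)) :
    copower k W (𝟙_ C) ◁ copower.map (repLin f) (𝟙_ C) ≫ (copowerTensorIso C V' W).hom =
      (copowerTensorIso C V W).hom ≫ copower.map (repLin (f ▷ W)) (𝟙_ C) :=
  copower.tensor_hom_ext fun w v => by
    rw [← id_tensorHom, tensorHom_comp_tensorHom_assoc, copower.i_map, Category.comp_id,
      tensor_i_copowerTensorIso, reassoc_of% tensor_i_copowerTensorIso, copower.i_map,
      repLin_whiskerRight]

lemma copowerTensorIso_naturality_right (W : FDRep k (G ⧸ N)) {V V' : FDRep k (G ⧸ N)}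
    (f : V ⟶ V') :
    copower.map (repLin f) (𝟙_ C) ▷ copower k W (𝟙_ C) ≫ (copowerTensorIso C W V').hom =
      (copowerTensorIso C W V).hom ≫ copower.map (repLin (W ◁ f)) (𝟙_ C) :=
  copower.tensor_hom_ext fun v w => by
    rw [← tensorHom_id, tensorHom_comp_tensorHom_assoc, copower.i_map, Category.comp_id,
      tensor_i_copowerTensorIso, reassoc_of% tensor_i_copowerTensorIso, copower.i_map,
      repLin_whiskerLeft]

lemma copowerUnitIso_hom :
    (copowerUnitIso k C (G ⧸ N)).hom = copower.i k (𝟙_ (FDRep k (G ⧸ N)) : FDRep k _) (𝟙_ C) one :=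
  rfl

/-- The reversal of factors makes the left unitor of representations correspond to the right unitor
of `C`; in the lemma after this one the roles are exchanged. -/
lemma copowerTensorIso_leftUnitor (V : FDRep k (G ⧸ N)) :
    copower k V (𝟙_ C) ◁ (copowerUnitIso k C (G ⧸ N)).hom ≫ (copowerTensorIso C (𝟙_ _) V).hom ≫
      copower.map (repLin (λ_ V).hom) (𝟙_ C) = (ρ_ _).hom := by
  rw [← cancel_epi (ρ_ _).inv, Iso.inv_hom_id]
  refine copower.hom_ext fun v => ?_
  rw [rightUnitor_inv_naturality_assoc, ← MonoidalCategory.tensorHom_def_assoc, copowerUnitIso_hom,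
    reassoc_of% tensor_i_copowerTensorIso, copower.i_map, repLin_leftUnitor, unitors_equal,
    Iso.inv_hom_id_assoc, Category.comp_id]

lemma copowerTensorIso_rightUnitor (V : FDRep k (G ⧸ N)) :
    (copowerUnitIso k C (G ⧸ N)).hom ▷ copower k V (𝟙_ C) ≫ (copowerTensorIso C V (𝟙_ _)).hom ≫
      copower.map (repLin (ρ_ V).hom) (𝟙_ C) = (λ_ _).hom := by
  rw [← cancel_epi (λ_ _).inv, Iso.inv_hom_id]
  refine copower.hom_ext fun v => ?_
  rw [leftUnitor_inv_naturality_assoc, ← tensorHom_def'_assoc, copowerUnitIso_hom,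
    reassoc_of% tensor_i_copowerTensorIso, copower.i_map, repLin_rightUnitor,
    Iso.inv_hom_id_assoc, Category.comp_id]

variable [Finite G]

variable (N) in
/-- The isomorphism `L_V ∘ L_W ≅ L_{V ⊗ W}`. -/
noncomputable def repTensorIso (V W : FDRep k (G ⧸ N)) :
    (repFunctor T N).obj V ⊗ (repFunctor T N).obj W ≅ (repFunctor T N).obj (V ⊗ W) :=
  EquivariantObj.tensorIso (repEquivariant T V) (repEquivariant T W) (repEquivariant T (V ⊗ W))
    (copowerTensorIso C V W) (copowerTensorIso_comm T V W)

variable (N) in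
/-- The isomorphism `Id ≅ L_k`. -/
noncomputable def repUnitIso :
    𝟙_ (ModuleEnd k (CrossedProduct T) C) ≅ (repFunctor T N).obj (𝟙_ _) :=
  EquivariantObj.unitIso (repEquivariant T (𝟙_ (FDRep k (G ⧸ N)))) (copowerUnitIso k C (G ⧸ N))
    (copowerUnitIso_comm T)

variable (N) in
/-- The tensor structure of `V ↦ L_V`. -/
noncomputable def repCoreMonoidal : (repFunctor T N).CoreMonoidal where
  εIso := repUnitIso N T
  μIso := repTensorIso N T
  μIso_hom_natural_left {V V'} f W := by
    refine ModuleEnd.hom_ext fun M => ?_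
    change (M ⊗ copower k W (𝟙_ C)) ◁ copower.map (repLin f) (𝟙_ C) ≫
      (α_ _ _ _).hom ≫ M ◁ (copowerTensorIso C V' W).hom =
      ((α_ _ _ _).hom ≫ M ◁ (copowerTensorIso C V W).hom) ≫
        M ◁ copower.map (repLin (f ▷ W)) (𝟙_ C)
    rw [associator_naturality_right_assoc, ← MonoidalCategory.whiskerLeft_comp,
      copowerTensorIso_naturality_left, MonoidalCategory.whiskerLeft_comp, Category.assoc]
  μIso_hom_natural_right {V V'} W f := by
    refine ModuleEnd.hom_ext fun M => ?_
    change (M ◁ copower.map (repLin f) (𝟙_ C)) ▷ copower k W (𝟙_ C) ≫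
      (α_ _ _ _).hom ≫ M ◁ (copowerTensorIso C W V').hom =
      ((α_ _ _ _).hom ≫ M ◁ (copowerTensorIso C W V).hom) ≫
        M ◁ copower.map (repLin (W ◁ f)) (𝟙_ C)
    rw [associator_naturality_middle_assoc, ← MonoidalCategory.whiskerLeft_comp,
      copowerTensorIso_naturality_right, MonoidalCategory.whiskerLeft_comp, Category.assoc]
  associativity U V W := by
    refine ModuleEnd.hom_ext fun M => ?_
    -- The associator of the dual category has identity components. The associators of `C` come from
    -- `tensorIso`, and the pentagon reconciles them.
    change ((α_ _ _ _).hom ≫ (M ⊗ copower k W (𝟙_ C)) ◁ (copowerTensorIso C U V).hom) ≫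
      ((α_ _ _ _).hom ≫ M ◁ (copowerTensorIso C (U ⊗ V) W).hom) ≫
        M ◁ copower.map (repLin (α_ U V W).hom) (𝟙_ C) =
      𝟙 (((M ⊗ copower k W (𝟙_ C)) ⊗ copower k V (𝟙_ C)) ⊗ copower k U (𝟙_ C)) ≫
      ((α_ _ _ _).hom ≫ M ◁ (copowerTensorIso C V W).hom) ▷ copower k U (𝟙_ C) ≫
        (α_ _ _ _).hom ≫ M ◁ (copowerTensorIso C U (V ⊗ W)).hom
    rw [Category.id_comp, comp_whiskerRight]
    simp only [Category.assoc]
    rw [associator_naturality_middle_assoc, ← MonoidalCategory.whiskerLeft_comp,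
      ← MonoidalCategory.whiskerLeft_comp, ← copowerTensorIso_assoc,
      associator_naturality_right_assoc, ← MonoidalCategory.whiskerLeft_comp,
      MonoidalCategory.whiskerLeft_comp _ (α_ _ _ _).hom, pentagon_assoc]
  left_unitality V := by
    refine ModuleEnd.hom_ext fun M => ?_
    change 𝟙 (M ⊗ copower k V (𝟙_ C)) = ((ρ_ _).inv ≫
      (M ⊗ copower k V (𝟙_ C)) ◁ (copowerUnitIso k C (G ⧸ N)).hom) ≫
      ((α_ _ _ _).hom ≫ M ◁ (copowerTensorIso C (𝟙_ _) V).hom) ≫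
        M ◁ copower.map (repLin (λ_ V).hom) (𝟙_ C)
    rw [Category.assoc, Category.assoc, associator_naturality_right_assoc,
      ← MonoidalCategory.whiskerLeft_comp, ← MonoidalCategory.whiskerLeft_comp,
      copowerTensorIso_leftUnitor, ← rightUnitor_tensor_hom, Iso.inv_hom_id]
  right_unitality V := by
    refine ModuleEnd.hom_ext fun M => ?_
    change 𝟙 (M ⊗ copower k V (𝟙_ C)) = ((ρ_ _).inv ≫
      M ◁ (copowerUnitIso k C (G ⧸ N)).hom) ▷ copower k V (𝟙_ C) ≫
      ((α_ _ _ _).hom ≫ M ◁ (copowerTensorIso C V (𝟙_ _)).hom) ≫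
        M ◁ copower.map (repLin (ρ_ V).hom) (𝟙_ C)
    rw [comp_whiskerRight, Category.assoc, Category.assoc, associator_naturality_middle_assoc,
      ← MonoidalCategory.whiskerLeft_comp, ← MonoidalCategory.whiskerLeft_comp,
      copowerTensorIso_rightUnitor, MonoidalCategory.triangle, ← comp_whiskerRight,
      Iso.inv_hom_id, id_whiskerRight]

end Monoidal

/-! ### Duals of the functors `L_V`, and a faithful representation. -/

section

open Functor

variable {C : Type*} [Category* C] [MonoidalCategory C] {D : Type*} [Category* D]
    [MonoidalCategory D] (F : C ⥤ D) [F.Monoidal]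

/-- A monoidal functor preserves exact pairings. -/
abbrev CategoryTheory.Functor.Monoidal.mapExactPairing (X Y : C) [ExactPairing X Y] :
    ExactPairing (F.obj X) (F.obj Y) where
  coevaluation' := LaxMonoidal.ε F ≫ F.map (η_ X Y) ≫ OplaxMonoidal.δ F X Y
  evaluation' := LaxMonoidal.μ F Y X ≫ F.map (ε_ X Y) ≫ OplaxMonoidal.η F
  coevaluation_evaluation' := by
    -- The composite of `δ`, the associator and `μ` is moved to the image under `F` of the
    -- associator, so that the zigzag identity becomes the image of the one in the source category.
    have h1 : F.obj Y ◁ OplaxMonoidal.δ F X Y ≫ (α_ _ _ _).inv ≫ LaxMonoidal.μ F Y X ▷ F.obj Y =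
        LaxMonoidal.μ F Y (X ⊗ Y) ≫ F.map (α_ Y X Y).inv ≫ OplaxMonoidal.δ F (Y ⊗ X) Y := by
      rw [← cancel_epi (OplaxMonoidal.δ F Y (X ⊗ Y)), OplaxMonoidal.associativity_inv_assoc,
        Monoidal.whiskerRight_δ_μ, Category.comp_id, Monoidal.δ_μ_assoc]
    have h2 : F.obj Y ◁ LaxMonoidal.ε F ≫ LaxMonoidal.μ F Y (𝟙_ C) ≫ F.map (ρ_ Y).hom =
        (ρ_ _).hom := (LaxMonoidal.right_unitality F Y).symm
    have h3 : F.map (λ_ Y).inv ≫ OplaxMonoidal.δ F (𝟙_ C) Y ≫ OplaxMonoidal.η F ▷ F.obj Y =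
        (λ_ _).inv := (OplaxMonoidal.left_unitality F Y).symm
    have h := congrArg F.map (ExactPairing.coevaluation_evaluation X Y)
    rw [Functor.map_comp, Functor.map_comp, Functor.map_comp] at h
    simp only [MonoidalCategory.whiskerLeft_comp, comp_whiskerRight, Category.assoc]
    rw [reassoc_of% h1, LaxMonoidal.μ_natural_right_assoc, OplaxMonoidal.δ_natural_left_assoc,
      reassoc_of% h, h3, reassoc_of% h2]
  evaluation_coevaluation' := by
    have h1 : OplaxMonoidal.δ F X Y ▷ F.obj X ≫ (α_ _ _ _).hom ≫ F.obj X ◁ LaxMonoidal.μ F Y X =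
        LaxMonoidal.μ F (X ⊗ Y) X ≫ F.map (α_ X Y X).hom ≫ OplaxMonoidal.δ F X (Y ⊗ X) := by
      rw [← cancel_epi (OplaxMonoidal.δ F (X ⊗ Y) X), OplaxMonoidal.associativity_assoc,
        Monoidal.whiskerLeft_δ_μ, Category.comp_id, Monoidal.δ_μ_assoc]
    have h2 : LaxMonoidal.ε F ▷ F.obj X ≫ LaxMonoidal.μ F (𝟙_ C) X ≫ F.map (λ_ X).hom =
        (λ_ _).hom := (LaxMonoidal.left_unitality F X).symm
    have h3 : F.map (ρ_ X).inv ≫ OplaxMonoidal.δ F X (𝟙_ C) ≫ F.obj X ◁ OplaxMonoidal.η F =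
        (ρ_ _).inv := (OplaxMonoidal.right_unitality F X).symm
    have h := congrArg F.map (ExactPairing.evaluation_coevaluation X Y)
    rw [Functor.map_comp, Functor.map_comp, Functor.map_comp] at h
    simp only [MonoidalCategory.whiskerLeft_comp, comp_whiskerRight, Category.assoc]
    rw [reassoc_of% h1, LaxMonoidal.μ_natural_left_assoc, OplaxMonoidal.δ_natural_right_assoc,
      reassoc_of% h, h3, reassoc_of% h2]

end

/-- A finite group has a representation, over any field, in which every nontrivial element moves
some vector. -/
lemma FDRep.exists_faithful (k : Type*) [Field k] (Γ : Type*) [Group Γ] [Finite Γ] :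
    ∃ V : FDRep k Γ, ∀ x : Γ, x ≠ 1 → ∃ v : V, V.ρ x v ≠ v := by
  classical
  obtain ⟨n, ⟨e⟩⟩ := Finite.exists_equiv_fin Γ
  -- The regular representation on functions. The group is replaced by `Fin n`, which keeps the
  -- space in the universe of `k`.
  let ρ : Representation k Γ (Fin n → k) :=
    { toFun := fun x => LinearMap.funLeft k k fun i => e (x⁻¹ * e.symm i)
      map_one' := by
        ext
        simp [LinearMap.funLeft]
      map_mul' := fun x y => by
        ext
        simp [LinearMap.funLeft, mul_assoc] }
  refine ⟨FDRep.of ρ, fun x hx => ⟨Pi.single (e 1) 1, fun h => ?_⟩⟩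
  -- The element `x` moves the indicator function of 1 to that of `x`; evaluation at `x` tells them
  -- apart when `x ≠ 1`.
  have h1 : Pi.single (M := fun _ => k) (e 1) 1 (e (x⁻¹ * e.symm (e x))) =
      Pi.single (M := fun _ => k) (e 1) 1 (e x) := congrFun h (e x)
  rw [Equiv.symm_apply_apply, inv_mul_cancel, Pi.single_eq_same, Pi.single_eq_of_ne] at h1
  · exact one_ne_zero h1
  · exact fun h2 => hx (e.injective h2)

section

open Functor

variable {k : Type*} [Field k] {G : Type*} [Group G] [Finite G] {C : Type*} [Category* C]
    [Abelian C] [Linear k C] [MonoidalCategory C] [MonoidalPreadditive C] [MonoidalLinear k C]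
    (T : TensorAction k G C) (N : Subgroup G) [N.Normal]

/-- Supplies the hypothesis of `isRelativeAdjoint_adjointWedge`. A faithful representation of the
finite group `G / N` is moved by every `g` outside `N`, and a strong monoidal functor sends its dual
to a dual of `L_V`. -/
lemma exists_repFunctor_dual : ∃ (V : FDRep k (G ⧸ N)) (D' : ModuleEnd k (CrossedProduct T) C)
    (_ : ExactPairing ((repFunctor T N).obj V) D'),
    ∀ g ∉ N, ∃ v : V, V.ρ ((g : G ⧸ N)⁻¹) v ≠ v := by
  obtain ⟨V, hV⟩ := FDRep.exists_faithful k (G ⧸ N)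
  let _ := (repCoreMonoidal N T).toMonoidal
  exact ⟨V, (repFunctor T N).obj Vᘁ, Monoidal.mapExactPairing (repFunctor T N) V Vᘁ,
    fun g hg => hV _ fun h => hg ((QuotientGroup.eq_one_iff g).1 (inv_eq_one.1 h))⟩

end

theorem mainTheorem6 {k : Type*} [Field k] [IsAlgClosed k] [CharZero k]
    {C : Type*} [Category* C] [Abelian C] [Linear k C] [MonoidalCategory C]
    [MonoidalPreadditive C] [MonoidalLinear k C] [RigidCategory C] (hC : IsFiniteTensor k C)
    {G : Type*} [Group G] [Finite G] (T : TensorAction k G C) (N : Subgroup G) [N.Normal] :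
    ((repFunctor T N).Full ∧ (repFunctor T N).Faithful ∧ Nonempty (repFunctor T N).Monoidal ∧
      (repFunctor T N ⋙ ModuleEnd.forget k (CrossedProduct T) C).Additive ∧
      (repFunctor T N ⋙ ModuleEnd.forget k (CrossedProduct T) C).Linear k) ∧
    ∃ _ : ∀ g, HasEnd (twistedHom T g),
      (∃ H : Cᵒᵖ ⥤ C ⥤ CrossedProduct T, Nonempty (InternalHom (CrossedProduct T) C H)) ∧
      ∀ (H : Cᵒᵖ ⥤ C ⥤ CrossedProduct T) (adj : InternalHom (CrossedProduct T) C H),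
        (∃ w : Wedge H, IsRelativeAdjoint (repFunctor T N).essImage adj w) ∧
        ∀ w : Wedge H, IsRelativeAdjoint (repFunctor T N).essImage adj w →
          Nonempty (w.pt ≅ adjointSum T N) := by
  have := hC.simple_unit
  have := hC.finite_hom (𝟙_ C) (𝟙_ C)
  have hE : ∀ g, HasEnd (twistedHom T g) := fun g => hC.hasEnd_twistedHom T g
  have hN := exists_repFunctor_dual T N
  exact ⟨⟨repFunctor_full T N, repFunctor_faithful T N, ⟨(repCoreMonoidal N T).toMonoidal⟩,
    repFunctor_additive T N, repFunctor_linear T N⟩, hE, ⟨crossedHom T, ⟨crossedHomAdjunction T⟩⟩,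
    fun _ adj => ⟨⟨adjointWedge T N adj, isRelativeAdjoint_adjointWedge adj hN⟩,
      fun _ hw => hw.nonempty_iso (isRelativeAdjoint_adjointWedge adj hN)⟩⟩
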